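/- Let $M$ be a connected $C^\infty$-manifold of dimension $n\ge 2$ without boundary, and let $F:TM\to[0,\infty)$ be a $C^\infty$-Finsler structure: $F$ is $C^\infty$ off the zero section, $F(cv)=cF(v)$ for $c>0$, and $g_{ij}(v)=\frac12\,\partial^2(F^2)/\partial v^i\partial v^j(v)$ is positive definite for every $v\ne0$. Let $F^*(\alpha)=\sup\{\alpha(v): v\in T_xM,\ F(v)\le1\}$ be the dual norm on $T^*M$, let $\mathbf H^F(\alpha)=\sup_v(\alpha(v)-\frac12F(v)^2)=\frac12F^*(\alpha)^2$, and let $\tau_F^*(\alpha)=\sum_i \mathbf H^F_{\alpha_i}(\alpha)\,\partial_{x^i}\in T_xM$ be its Legendre transform. Let $h:\mathbb R\to[0,\infty)$ be a $C^\infty$-function with $h(0)=h'(0)=0$, $h''>0$ on $(0,\infty)$ and $\lim_{t\to\infty}h'(t)=\infty$. Put $\mathbf H(\alpha)=h(F^*(\alpha))$ and $c(\alpha)=h'(F^*(\alpha))/F^*(\alpha)$ for $\alpha\neq 0$. Fix a positive $C^\infty$-measure $\mathfrak m$ on $M$. Curvature of a Hamiltonian. Let $\mathbf K$ be $\mathbf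 H$ or $\mathbf H^F$, let $\alpha\in T_x^*M\setminus\{0\}$, let $\Phi_t$ be the flow of $\sum_i(\mathbf K_{\alpha_i}\partial_{x^i}-\mathbf K_{x^i}\partial_{\alpha_i})$, let $\mathcal V=\mathrm{span}\{\partial_{\alpha_i}\}$ be the vertical subspaces of $T(T^*M)$, let $\mathcal J^t_\alpha=(d\Phi_t)^{-1}(\mathcal V_{\Phi_t(\alpha)})\subset T_\alpha(T^*M)$, and let $\omega=\sum_i d\alpha_i\wedge dx^i$. A canonical frame is a family of smooth curves $e_i^t\in\mathcal J_\alpha^t$ $(1\le i\le n$, $|t|<\varepsilon)$ with $\omega(\dot e^t_i,e^t_j)=\delta_{ij}$ and $\ddot e^t_i\in\mathcal J^t_\alpha$. The curvature operator $\mathcal V_\alpha\to\mathcal V_\alpha$ of $\mathbf K$ at $\alpha$ is the linear map with $e^0_i\mapsto-\ddot e^0_i$; its trace is $\mathrm{Ric}^{\mathbf K}(\alpha)$. Write $\mathbf R^0_\alpha$ for the curvature operator of $\mathbf H$ and $\widetilde{\mathbf R}{}^0_\alpha$ for that of $\mathbf H^F$. Weighted Ricci curvature of $\mathbf H$. Let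 $\mathbf L(v)=\sup_\alpha(\alpha(v)-\mathbf H(\alpha))$ be the Lagrangian of $\mathbf H$ and $\eta(t)$ the projection of $\Phi_t(\alpha)$ to $M$, and write $\mathfrak m=e^{-\psi}\sqrt{\det(\mathbf L_{v^iv^j}(\dot\eta))}\,dx^1\cdots dx^n$ along $\eta$. For $N\in(n,\infty)$, $$\mathrm{Ric}^{\mathbf H}_N(\alpha)=\mathrm{Ric}^{\mathbf H}(\alpha)+(\psi\circ\eta)''(0)-\frac{(\psi\circ\eta)'(0)^2}{N-n},$$ $\mathrm{Ric}^{\mathbf H}_\infty(\alpha)=\mathrm{Ric}^{\mathbf H}(\alpha)+(\psi\circ\eta)''(0)$, and $\mathrm{Ric}^{\mathbf H}_n(\alpha)$ equals $\mathrm{Ric}^{\mathbf H}_\infty(\alpha)$ if $(\psi\circ\eta)'(0)=0$ and $-\infty$ otherwise. Finsler Ricci curvature. For $v\neq0$, $\mathrm{Ric}^F(v)$ is the trace of the Finsler curvature operator $w\mapsto R^F(w,v)v$, whose components are $$R^i{}_k=2\,\partial_{x^k}G^i-v^j\,\partial_{x^j}\partial_{v^k}G^i+2G^j\,\partial_{v^j}\partial_{v^k}G^i-\partial_{v^j}G^i\,\partial_{v^k}G^j,\qquad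 G^i=\tfrac14g^{il}\bigl(\partial_{x^k}\partial_{v^l}(F^2)\,v^k-\partial_{x^l}(F^2)\bigr)$$ (summation over repeated indices; equivalently, for $F(v)=1$ it is the trace of the flag curvature with flagpole $v$). $\mathrm{Ric}^F_N(v)$ is given by the formulas above with $\mathrm{Ric}^F(v)$ in place of $\mathrm{Ric}^{\mathbf H}(\alpha)$, with the $F$-geodesic $\eta$ with $\dot\eta(0)=v$, and with $\mathfrak m=e^{-\psi}\sqrt{\det (g_{ij}(\dot\eta))}\,dx^1\cdots dx^n$ along $\eta$. Then, for every $\alpha\in T^*M\setminus 0_{T^*M}$, both curvature operators are well defined (they exist and are unique), and $$\mathbf R^0_\alpha=c(\alpha)^2\,\widetilde{\mathbf R}{}^0_\alpha,\qquad \mathrm{Ric}^{\mathbf H}(\alpha)=c(\alpha)^2\,\mathrm{Ric}^F\bigl(\tau_F^*(\alpha)\bigr),$$ $$\mathrm{Ric}^{\mathbf H}_N(\alpha)=c(\alpha)^2\,\mathrm{Ric}^F_N\bigl(\tau_F^*(\alpha)\bigr)\qquad\text{for all }N\in[n,\infty].$$ -/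

import Mathlib

open Set Filter Topology MeasureTheory
open scoped Manifold ContDiff ENNReal

noncomputable section

namespace FinslerHamiltonian

/-- The model space `ℝⁿ` of the charts. -/
abbrev E (n : ℕ) := EuclideanSpace ℝ (Fin n)

/-! ### Calculus in a chart

In a chart, `TU` and `T*U` are identified with subsets of `ℝⁿ × ℝⁿ`: a point `(x, v)` stands for
`∑ vʲ ∂_{xʲ}`, resp. a point `(x, p)` stands for `∑ pⱼ dxʲ`. -/

/-- The partial derivative with respect to the `i`-th base coordinate. -/
def dBase {n : ℕ} (i : Fin n) (f : E n × E n → ℝ) (z : E n × E n) : ℝ :=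
  fderiv ℝ f z (EuclideanSpace.single i 1, 0)

/-- The partial derivative with respect to the `i`-th fibre coordinate. -/
def dFib {n : ℕ} (i : Fin n) (f : E n × E n → ℝ) (z : E n × E n) : ℝ :=
  fderiv ℝ f z (0, EuclideanSpace.single i 1)

/-- The fibrewise Hessian matrix `(∂² f / ∂vⁱ ∂vʲ)`. -/
def fibHessian {n : ℕ} (f : E n × E n → ℝ) (z : E n × E n) : Matrix (Fin n) (Fin n) ℝ :=
  Matrix.of fun i j => dFib i (dFib j f) z

/-! ### Hamiltonian flow, Jacobi curve and canonical frames in a chart -/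

/-- The Hamiltonian vector field `∑ (K_{αᵢ} ∂_{xⁱ} - K_{xⁱ} ∂_{αᵢ})`. -/
def hamVec {n : ℕ} (K : E n × E n → ℝ) (z : E n × E n) : E n × E n :=
  (WithLp.toLp 2 fun i => dFib i K z, WithLp.toLp 2 fun i => -dBase i K z)

/-- The canonical symplectic form `∑ dαᵢ ∧ dxⁱ`. -/
def symp {n : ℕ} (u w : E n × E n) : ℝ := ∑ i, (u.2 i * w.1 i - w.2 i * u.1 i)

/-- `Φ` is a local flow near `z` of the vector field `X`. -/
def IsLocalFlow {n : ℕ} (X : E n × E n → E n × E n) (z : E n × E n)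
    (Φ : ℝ → E n × E n → E n × E n) : Prop :=
  ∃ ε > 0, ∃ U ∈ 𝓝 z, ∀ y ∈ U, Φ 0 y = y ∧
    ∀ t ∈ Ioo (-ε) ε, HasDerivAt (fun s => Φ s y) (X (Φ t y)) t

/-- The local Hamiltonian flow near `z` (its germ at time `0` and at the point `z` is unique). -/
def hamFlow {n : ℕ} (K : E n × E n → ℝ) (z : E n × E n) : ℝ → E n × E n → E n × E n :=
  Classical.epsilon (IsLocalFlow (hamVec K) z)

/-- The vertical subspace `span {∂_{αᵢ}}` of `T(T*M)`. -/
def vertical (n : ℕ) : Submodule ℝ (E n × E n) :=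
  LinearMap.ker (LinearMap.fst ℝ (E n) (E n))

/-- The Jacobi curve `t ↦ (dΦₜ)⁻¹(𝒱)` in the tangent space of `T*M` at `z`. -/
def jacobiCurve {n : ℕ} (K : E n × E n → ℝ) (z : E n × E n) (t : ℝ) :
    Submodule ℝ (E n × E n) :=
  (vertical n).comap (fderiv ℝ (hamFlow K z t) z).toLinearMap

/-- `(eᵢᵗ)` is a canonical frame: `eᵢᵗ` are smooth curves in the Jacobi curve with
`ω(ėᵢᵗ, eⱼᵗ) = δᵢⱼ` and `ëᵢᵗ` in the Jacobi curve, for `t` in an interval around `0`. -/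
def IsCanonicalFrame {n : ℕ} (K : E n × E n → ℝ) (z : E n × E n)
    (e : Fin n → ℝ → E n × E n) : Prop :=
  ∃ ε > 0, (∀ i, ContDiffOn ℝ ∞ (e i) (Ioo (-ε) ε)) ∧
    ∀ t ∈ Ioo (-ε) ε, ∀ i,
      e i t ∈ jacobiCurve K z t ∧
      deriv (deriv (e i)) t ∈ jacobiCurve K z t ∧
      ∀ j, symp (deriv (e i) t) (e j t) = if i = j then 1 else 0

/-- `R` is the curvature operator `𝐑⁰ : 𝒱 → 𝒱`, `𝐑⁰(eᵢ⁰) = -ëᵢ⁰`, where `𝒱` is identified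
with `ℝⁿ` through its basis `∂_{αᵢ}`, that is, `ξ` is identified with `(0, ξ)`. -/
def IsCurvatureOperator {n : ℕ} (K : E n × E n → ℝ) (z : E n × E n)
    (R : E n →ₗ[ℝ] E n) : Prop :=
  ∃ e, IsCanonicalFrame K z e ∧ ∀ i, ((0 : E n), R (e i 0).2) = -deriv (deriv (e i)) 0

/-! ### Spray and curvature of a Finsler Lagrangian `L = F² / 2` in a chart -/

/-- The spray coefficients `Gⁱ = ½ gⁱˡ (L_{vˡ xᵏ} vᵏ - L_{xˡ})`
`= ¼ gⁱˡ ((F²)_{vˡ xᵏ} vᵏ - (F²)_{xˡ})`. -/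
def spray {n : ℕ} (L : E n × E n → ℝ) (i : Fin n) (z : E n × E n) : ℝ :=
  (1 / 2) * ∑ l, (fibHessian L z)⁻¹ i l *
    ((∑ k, dBase k (dFib l L) z * z.2 k) - dBase l L z)

/-- The components `Rⁱₖ(v)` of the Finsler curvature operator `w ↦ R(w, v) v`, whose flag
curvatures are `K(v, w) = g_v(R(w, v) v, w) / (g_v(v, v) g_v(w, w) - g_v(v, w)²)`:
`2 Gⁱ_{xᵏ} - vʲ Gⁱ_{xʲ vᵏ} + 2 Gʲ Gⁱ_{vʲ vᵏ} - Gⁱ_{vʲ} Gʲ_{vᵏ}`. -/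
def finslerCurvature {n : ℕ} (L : E n × E n → ℝ) (z : E n × E n) :
    Matrix (Fin n) (Fin n) ℝ :=
  Matrix.of fun i k =>
    2 * dBase k (spray L i) z
      - ∑ j, z.2 j * dBase j (dFib k (spray L i)) z
      + 2 * ∑ j, spray L j z * dFib j (dFib k (spray L i)) z
      - ∑ j, dFib j (spray L i) z * dFib k (spray L j) z

/-- `η` solves, near time `0`, the Euler-Lagrange equation
`L_{xⁱ} - ∑ⱼ (L_{vⁱ xʲ} η̇ʲ + L_{vⁱ vʲ} η̈ʲ) = 0`, with initial data `η(0) = z.1`, `η̇(0) = z.2`. -/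
def IsEulerLagrange {n : ℕ} (L : E n × E n → ℝ) (z : E n × E n) (η : ℝ → E n) : Prop :=
  ContDiffAt ℝ 2 η 0 ∧ η 0 = z.1 ∧ deriv η 0 = z.2 ∧
    ∀ᶠ t in 𝓝 (0 : ℝ), ∀ i,
      dBase i L (η t, deriv η t)
        - ∑ j, (dBase j (dFib i L) (η t, deriv η t) * deriv η t j
          + dFib j (dFib i L) (η t, deriv η t) * deriv (deriv η) t j) = 0

/-- The solution of the Euler-Lagrange equation with initial point `z.1` and initial velocity
`z.2` (unique near time `0`). For `L = F² / 2` it is the geodesic of `F`. -/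
def elCurve {n : ℕ} (L : E n × E n → ℝ) (z : E n × E n) : ℝ → E n :=
  Classical.epsilon (IsEulerLagrange L z)

/-- The function `t ↦ ψ(η(t))`, where `σ dx = e^{-ψ} √(det L_{vⁱ vʲ}(η̇)) dx` along `η`. -/
def weightAlong {n : ℕ} (L : E n × E n → ℝ) (σ : E n → ℝ) (η : ℝ → E n) (t : ℝ) : ℝ :=
  Real.log (√(fibHessian L (η t, deriv η t)).det / σ (η t))

/-- The weighted Ricci curvature of parameter `N ∈ [n, ∞]`, from the unweighted Ricci curvature
`ric` and from the weight `ψ ∘ η` along the curve. -/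
def weightedRicci (n : ℕ) (ric : ℝ) (ψ : ℝ → ℝ) (N : ℝ≥0∞) : EReal :=
  if N = ⊤ then ((ric + deriv (deriv ψ) 0 : ℝ) : EReal)
  else if N = n then
    if deriv ψ 0 = 0 then ((ric + deriv (deriv ψ) 0 : ℝ) : EReal) else ⊥
  else ((ric + deriv (deriv ψ) 0 - deriv ψ 0 ^ 2 / (N.toReal - n) : ℝ) : EReal)

/-! ### Lagrangians, Hamiltonians and Finsler structures on a manifold -/

section Manifold

variable {n : ℕ} {M : Type*} [TopologicalSpace M] [ChartedSpace (E n) M]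

/-- The cotangent space `T_x^* M`. -/
abbrev Cotangent (x : M) := TangentSpace (𝓡 n) x →L[ℝ] ℝ

/-- A function on `TM`, in the coordinates `(x, v)` given by the chart `e`. -/
def onTangent (e : OpenPartialHomeomorph M (E n))
    (L : ∀ x : M, TangentSpace (𝓡 n) x → ℝ) : E n × E n → ℝ :=
  fun z => L (e.symm z.1) (mfderiv (𝓡 n) (𝓡 n) e.symm z.1 z.2)

/-- A function on `T*M`, in the coordinates `(x, p)` given by the chart `e`: the covector
`∑ pⱼ dxʲ` is the composition of `v ↦ ∑ pⱼ vʲ` with the derivative of `e`. -/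
def onCotangent (e : OpenPartialHomeomorph M (E n))
    (H : ∀ x : M, Cotangent (n := n) x → ℝ) : E n × E n → ℝ :=
  fun z => H (e.symm z.1)
    (ContinuousLinearMap.comp (innerSL ℝ z.2) (mfderiv (𝓡 n) (𝓡 n) e (e.symm z.1)))

/-- The coordinates of a tangent vector in the chart `e`. -/
def vecCoord (e : OpenPartialHomeomorph M (E n)) (x : M) (v : TangentSpace (𝓡 n) x) :
    E n × E n :=
  (e x, mfderiv (𝓡 n) (𝓡 n) e x v)

/-- The coordinates of a covector in the chart `e`: `pᵢ = α(∂_{xⁱ})`. -/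
def covecCoord (e : OpenPartialHomeomorph M (E n)) (x : M) (α : Cotangent (n := n) x) :
    E n × E n :=
  (e x, WithLp.toLp 2 fun i =>
    α.comp (mfderiv (𝓡 n) (𝓡 n) e.symm (e x) : E n →L[ℝ] TangentSpace (𝓡 n) x)
      (EuclideanSpace.single i 1))

/-- The Hamiltonian `H(α) = sup_v (α(v) - L(v))` of a Lagrangian. -/
def hamiltonianOf (L : ∀ x : M, TangentSpace (𝓡 n) x → ℝ) (x : M)
    (α : Cotangent (n := n) x) : ℝ :=
  ⨆ v : TangentSpace (𝓡 n) x, (α v - L x v)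

/-- The Lagrangian `L(v) = sup_α (α(v) - H(α))` of a Hamiltonian. -/
def lagrangianOf (H : ∀ x : M, Cotangent (n := n) x → ℝ) (x : M)
    (v : TangentSpace (𝓡 n) x) : ℝ :=
  ⨆ α : Cotangent (n := n) x, (α v - H x α)

/-- The Legendre transform `τ*(α) = ∑ H_{αᵢ}(α) ∂_{xⁱ}`. -/
def legendre (e : OpenPartialHomeomorph M (E n)) (H : ∀ x : M, Cotangent (n := n) x → ℝ)
    (x : M) (α : Cotangent (n := n) x) : TangentSpace (𝓡 n) x :=
  (mfderiv (𝓡 n) (𝓡 n) e.symm (e x) : E n →L[ℝ] TangentSpace (𝓡 n) x)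
    (WithLp.toLp 2 fun i => dFib i (onCotangent e H) (covecCoord e x α))

/-- The Lagrangian `L^F = F² / 2`. -/
def finslerLagrangian (F : ∀ x : M, TangentSpace (𝓡 n) x → ℝ) (x : M)
    (v : TangentSpace (𝓡 n) x) : ℝ :=
  F x v ^ 2 / 2

/-- The Hamiltonian `H^F` associated with `L^F`. -/
def finslerHamiltonian (F : ∀ x : M, TangentSpace (𝓡 n) x → ℝ) (x : M)
    (α : Cotangent (n := n) x) : ℝ :=
  hamiltonianOf (finslerLagrangian F) x α

/-- The dual norm `F*(α) = sup {α(v) | F(v) ≤ 1}`. -/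
def dualNorm (F : ∀ x : M, TangentSpace (𝓡 n) x → ℝ) (x : M)
    (α : Cotangent (n := n) x) : ℝ :=
  sSup ((fun v => α v) '' {v : TangentSpace (𝓡 n) x | F x v ≤ 1})

/-- Smooth Finsler structures. -/
structure IsFinslerStructure [IsManifold (𝓡 n) ∞ M]
    (F : ∀ x : M, TangentSpace (𝓡 n) x → ℝ) : Prop where
  nonneg : ∀ x v, 0 ≤ F x v
  smooth : ContMDiffOn (𝓡 n).tangent 𝓘(ℝ, ℝ) ∞
    (fun p : TangentBundle (𝓡 n) M => F p.1 p.2) {p | p.2 ≠ 0}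
  homogeneous : ∀ x v, ∀ c : ℝ, 0 < c → F x (c • v) = c * F x v
  strongly_convex : ∀ e ∈ IsManifold.maximalAtlas (𝓡 n) ∞ M, ∀ y ∈ e.target,
    ∀ v : E n, v ≠ 0 → (fibHessian (onTangent e (finslerLagrangian F)) (y, v)).PosDef

/-- The functions `h : ℝ → [0, ∞)` allowed in a convex deformation `h ∘ F*`. -/
structure IsConvexDeformation (h : ℝ → ℝ) : Prop where
  smooth : ContDiff ℝ ∞ h
  nonneg : ∀ t, 0 ≤ h t
  zero : h 0 = 0
  deriv_zero : deriv h 0 = 0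
  deriv_deriv_pos : ∀ t, 0 < t → 0 < deriv (deriv h) t
  tendsto_deriv : Tendsto (deriv h) atTop atTop

/-- `m = σ(x) dx¹ ⋯ dxⁿ` in the chart `e`, with `σ` smooth and positive. -/
def IsChartDensity [MeasurableSpace M] (m : Measure M) (e : OpenPartialHomeomorph M (E n))
    (σ : E n → ℝ) : Prop :=
  ContDiffOn ℝ ∞ σ e.target ∧ (∀ y ∈ e.target, 0 < σ y) ∧
    ∀ A ⊆ e.target, MeasurableSet A → m (e.symm '' A) = ∫⁻ y in A, ENNReal.ofReal (σ y)

variable (n) in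
/-- Positive smooth measures on `M`. -/
def IsPositiveSmoothMeasure [MeasurableSpace M] (m : Measure M) : Prop :=
  ∀ e ∈ IsManifold.maximalAtlas (𝓡 n) ∞ M, ∃ σ, IsChartDensity m e σ

/-- The density of `m` in the chart `e` (unique on the range of the chart). -/
def chartDensity [MeasurableSpace M] (m : Measure M) (e : OpenPartialHomeomorph M (E n)) :
    E n → ℝ :=
  Classical.epsilon (IsChartDensity m e)

/-! ### Curvature of a Hamiltonian and of a Finsler structure

All these quantities are computed in a chart `e` around the point. -/

/-- The curvature operator `𝐑⁰_α` of the Hamiltonian `H`. -/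
def curvatureOperator (e : OpenPartialHomeomorph M (E n))
    (H : ∀ x : M, Cotangent (n := n) x → ℝ) (x : M) (α : Cotangent (n := n) x) :
    E n →ₗ[ℝ] E n :=
  Classical.epsilon (IsCurvatureOperator (onCotangent e H) (covecCoord e x α))

open scoped Classical in
/-- The Ricci curvature `Ric^H(α)`: the trace of the curvature operator, and `0` at `α = 0`. -/
def hamRicci (e : OpenPartialHomeomorph M (E n))
    (H : ∀ x : M, Cotangent (n := n) x → ℝ) (x : M) (α : Cotangent (n := n) x) : ℝ :=
  if α = 0 then 0 else LinearMap.trace ℝ (E n) (curvatureOperator e H x α)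

/-- The projection to `M`, in the chart `e`, of the Hamiltonian flow line starting at `α`. -/
def hamCurve (e : OpenPartialHomeomorph M (E n))
    (H : ∀ x : M, Cotangent (n := n) x → ℝ) (x : M) (α : Cotangent (n := n) x) (t : ℝ) : E n :=
  (hamFlow (onCotangent e H) (covecCoord e x α) t (covecCoord e x α)).1

open scoped Classical in
/-- The weighted Ricci curvature `Ric^H_N(α)`, with respect to the measure `m`. -/
def hamWeightedRicci [MeasurableSpace M] (m : Measure M) (e : OpenPartialHomeomorph M (E n))
    (H : ∀ x : M, Cotangent (n := n) x → ℝ) (N : ℝ≥0∞) (x : M)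
    (α : Cotangent (n := n) x) : EReal :=
  if α = 0 then 0
  else weightedRicci n (hamRicci e H x α)
    (weightAlong (onTangent e (lagrangianOf H)) (chartDensity m e) (hamCurve e H x α)) N

open scoped Classical in
/-- The Finsler Ricci curvature `Ric^F(v)`: the trace of `w ↦ R(w, v) v`, and `0` at `v = 0`. -/
def finslerRicci (e : OpenPartialHomeomorph M (E n))
    (F : ∀ x : M, TangentSpace (𝓡 n) x → ℝ) (x : M) (v : TangentSpace (𝓡 n) x) : ℝ :=
  if v = 0 then 0
  else (finslerCurvature (onTangent e (finslerLagrangian F)) (vecCoord e x v)).trace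

open scoped Classical in
/-- The Finsler weighted Ricci curvature `Ric^F_N(v)`, with respect to the measure `m`. The weight
is taken along the geodesic `η` with `η̇(0) = v`, with respect to `g_η̇`: for a field `V` that
extends `v` and has geodesic integral curves, `η` is an integral curve, so that `V = η̇` on it. -/
def finslerWeightedRicci [MeasurableSpace M] (m : Measure M)
    (e : OpenPartialHomeomorph M (E n)) (F : ∀ x : M, TangentSpace (𝓡 n) x → ℝ) (N : ℝ≥0∞)
    (x : M) (v : TangentSpace (𝓡 n) x) : EReal :=
  if v = 0 then 0
  else weightedRicci n (finslerRicci e F x v)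
    (weightAlong (onTangent e (finslerLagrangian F)) (chartDensity m e)
      (elCurve (onTangent e (finslerLagrangian F)) (vecCoord e x v))) N

end Manifold

end FinslerHamiltonian

end

open FinslerHamiltonian

/-! Everything is computed in one chart. Write `K` for `F*² / 2`, `X_K` for its Hamiltonian vector
field, `q` for the given covector and `v` for the vector whose Legendre transform is `q`. The
theorem rests on an explicit canonical frame for `K` and on the effect of a change of time.

For `K`: the Legendre map conjugates the flow of `K` to the geodesic spray `(v, -2G)`. Let `N =
∂G/∂v`, and let `P` be parallel transport along the geodesic, `P' = -N P`. Pull the vertical fields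
`(0, P w)` back to time `0` by the linearized spray flow. The first derivative of the resulting
curve is the pullback of `(-P w, N P w)`, and the second is the pullback of `-(0, R P w)`, where `R`
is the Finsler curvature operator. Hence second derivatives stay in the Jacobi curve, and the
curvature operator of `K` is `R` conjugated by the metric `g` (`ChartFinsler.exists_jacobiFamily`).
A positive linear family of this kind can be orthonormalized into a canonical frame
(`IsJacobiFamily.isCurvatureOperator`), and canonical frames differ by constant matrices, so the
operator is unique (`IsCurvatureOperator.unique`).

For `H = h(F*)`: near `q` its vector field is `c X_K`, and `c` is a function of `K` alone. So the
flow of `H` at time `t` is `z ↦ Φ (c z * t) z`, with `Φ` the flow of `K`, and its derivative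
acquires only the extra term `t dc(u) X_K`. If `Γ` is the family for `K`, then `Γ (c t) w - t dc(Γ 0
w) X_K(q)` is one for `H` (`IsJacobiFamily.timeChange`). This uses that `dc(Γ t w)` is constant in
`t`, because `dc` is a multiple of `dK` and `-X_K(q)` is the derivative of the family in the
direction `v`. The correction is linear in `t` and vanishes at `0`: initial vectors agree, while
second derivatives are multiplied by `c²`. Positivity of the new family follows from Cauchy-Schwarz
for `g` together with `h' > 0` and `h'' > 0`.

For the weights: flow lines of `H` project to geodesics run at `c` times their speed
(`ChartFinsler.hamFlow_deformed`). The determinant of the fibre Hessian of the Lagrangian of `H` is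
`det g` times a function of `F` (`ChartFinsler.exists_det_fibHessian`). As `F` is constant along a
geodesic, the two weights differ by an additive constant and the substitution `t ↦ c t`, so every
term of the weighted curvature scales by `c²`. -/

namespace FinslerHamiltonian

/-! ### Integral curves and local flows of smooth vector fields -/

section ODE

variable {V W Z : Type*} [NormedAddCommGroup V] [NormedSpace ℝ V]
  [NormedAddCommGroup W] [NormedSpace ℝ W] [NormedAddCommGroup Z] [NormedSpace ℝ Z]

/-- `f` is smooth on a neighbourhood of `z`. -/
def SmoothNear (f : V → W) (z : V) : Prop := ∀ᶠ y in 𝓝 z, ContDiffAt ℝ ∞ f y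

theorem SmoothNear.contDiffAt {f : V → W} {z : V} (hf : SmoothNear f z) : ContDiffAt ℝ ∞ f z :=
  hf.self_of_nhds

theorem SmoothNear.continuousAt {f : V → W} {z : V} (hf : SmoothNear f z) : ContinuousAt f z :=
  hf.contDiffAt.continuousAt

theorem SmoothNear.differentiableAt {f : V → W} {z : V} (hf : SmoothNear f z) :
    DifferentiableAt ℝ f z :=
  hf.contDiffAt.differentiableAt (by simp)

theorem SmoothNear.eventually {f : V → W} {z : V} (hf : SmoothNear f z) :
    ∀ᶠ y in 𝓝 z, SmoothNear f y :=
  eventually_eventually_nhds.2 hf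

theorem SmoothNear.congr {f g : V → W} {z : V} (hf : SmoothNear f z) (h : g =ᶠ[𝓝 z] f) :
    SmoothNear g z := by
  filter_upwards [hf, eventually_eventually_nhds.2 h] with y h1 h2
  exact h1.congr_of_eventuallyEq h2

theorem SmoothNear.comp {g : W → Z} {f : V → W} {z : V} (hg : SmoothNear g (f z))
    (hf : SmoothNear f z) : SmoothNear (fun y => g (f y)) z := by
  filter_upwards [hf, hf.continuousAt.eventually hg] with y h1 h2
  exact h2.comp y h1

theorem SmoothNear.prodMk {g : V → Z} {f : V → W} {z : V} (hf : SmoothNear f z)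
    (hg : SmoothNear g z) : SmoothNear (fun y => (f y, g y)) z := by
  filter_upwards [hf, hg] with y h1 h2
  exact h1.prodMk h2

theorem SmoothNear.fderiv {f : V → W} {z : V} (hf : SmoothNear f z) :
    SmoothNear (fderiv ℝ f) z := by
  filter_upwards [hf] with y h
  exact h.fderiv_right (by simp)

theorem smoothNear_of_contDiff {f : V → W} (hf : ContDiff ℝ ∞ f) (z : V) : SmoothNear f z :=
  Eventually.of_forall fun _ => hf.contDiffAt

theorem SmoothNear.exists_lipschitzOnWith {f : V → W} {z : V} (hf : SmoothNear f z) :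
    ∃ K, ∃ s ∈ 𝓝 z, LipschitzOnWith K f s :=
  (hf.contDiffAt.of_le (by simp) : ContDiffAt ℝ 1 f z).exists_lipschitzOnWith

theorem eventually_zero_iff_Ioo {p : ℝ → Prop} :
    (∀ᶠ t in 𝓝 (0 : ℝ), p t) ↔ ∃ ε > 0, ∀ t ∈ Ioo (-ε) ε, p t := by
  simp [Metric.eventually_nhds_iff_ball, Real.ball_eq_Ioo]

/-- The germ form in which most conservation laws below are proved: invariance of `symp`, constancy
of frame coefficients, constancy of speed. -/
theorem eventually_eq_of_hasDerivAt_zero {f : ℝ → V}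
    (hf : ∀ᶠ t in 𝓝 (0 : ℝ), HasDerivAt f 0 t) : ∀ᶠ t in 𝓝 (0 : ℝ), f t = f 0 := by
  obtain ⟨ε, hε, h⟩ := Metric.eventually_nhds_iff_ball.1 hf
  filter_upwards [Metric.ball_mem_nhds 0 hε] with t ht
  refine (convex_ball (0 : ℝ) ε).is_const_of_fderivWithin_eq_zero (𝕜 := ℝ)
    (fun s hs => (h s hs).differentiableAt.differentiableWithinAt) (fun s hs => ?_) ht
    (Metric.mem_ball_self hε)
  rw [fderivWithin_of_isOpen Metric.isOpen_ball hs]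
  simpa using (h s hs).hasFDerivAt.fderiv

theorem exists_integralCurve [CompleteSpace V] {X : V → V} {z : V} (hX : SmoothNear X z) :
    ∃ γ : ℝ → V, γ 0 = z ∧ ∀ᶠ t in 𝓝 (0 : ℝ), HasDerivAt γ (X (γ t)) t := by
  obtain ⟨γ, h0, ε, hε, h⟩ :=
    ContDiffAt.exists_forall_mem_closedBall_exists_eq_forall_mem_Ioo_hasDerivAt₀
      (hX.contDiffAt.of_le (by simp) : ContDiffAt ℝ 1 X z) 0
  exact ⟨γ, h0, eventually_zero_iff_Ioo.2 ⟨ε, hε, by simpa using h⟩⟩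

theorem integralCurve_unique {X : V → V} {γ δ : ℝ → V} (hX : SmoothNear X (γ 0))
    (hγ : ∀ᶠ t in 𝓝 (0 : ℝ), HasDerivAt γ (X (γ t)) t)
    (hδ : ∀ᶠ t in 𝓝 (0 : ℝ), HasDerivAt δ (X (δ t)) t) (h : γ 0 = δ 0) :
    γ =ᶠ[𝓝 0] δ := by
  obtain ⟨K, s, hs, hL⟩ := hX.exists_lipschitzOnWith
  have h1 := hγ.self_of_nhds.continuousAt.eventually_mem hs
  have h2 := hδ.self_of_nhds.continuousAt.eventually_mem (h ▸ hs)
  exact ODE_solution_unique_of_eventually (v := fun _ => X) (s := fun _ => s)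
    (Eventually.of_forall fun _ => hL) (hγ.and h1) (hδ.and h2) h

theorem smoothNear_integralCurve [CompleteSpace V] {X : V → V} {γ : ℝ → V}
    (hX : SmoothNear X (γ 0))
    (hγ : ∀ᶠ t in 𝓝 (0 : ℝ), HasDerivAt γ (X (γ t)) t) : SmoothNear γ 0 := by
  have h1 := hγ.self_of_nhds.continuousAt.eventually hX
  obtain ⟨ε, hε, h⟩ := eventually_zero_iff_Ioo.1 (hγ.and h1)
  refine eventually_zero_iff_Ioo.2 ⟨ε / 2, by positivity, fun t ht => ?_⟩
  have hsub : Icc (-(ε / 2)) (ε / 2) ⊆ Ioo (-ε) ε := fun s hs =>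
    ⟨by linarith [hs.1], by linarith [hs.2]⟩
  have := ODE.contDiffOn_enat_Icc_of_hasDerivWithinAt (n := ⊤) (f := fun _ => X)
    (α := γ) (tmin := -(ε / 2)) (tmax := ε / 2) (u := {y | ContDiffAt ℝ ∞ X y})
    (fun p hp => (ContDiffAt.comp p (show ContDiffAt ℝ ∞ X p.2 from hp.2)
      contDiffAt_snd).contDiffWithinAt)
    (fun s hs => (h s (hsub hs)).1.hasDerivWithinAt) (fun s hs => (h s (hsub hs)).2)
  exact this.contDiffAt (Icc_mem_nhds ht.1 ht.2)

/-- Along an integral curve of a smooth vector field, every smooth first order equation has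
smooth local solutions. -/
theorem exists_solution_along [CompleteSpace V] [CompleteSpace W] {X : V → V} {γ : ℝ → V}
    {Y : V × W → W} {w₀ : W} (hX : SmoothNear X (γ 0)) (hY : SmoothNear Y (γ 0, w₀))
    (hγ : ∀ᶠ t in 𝓝 (0 : ℝ), HasDerivAt γ (X (γ t)) t) :
    ∃ w : ℝ → W, w 0 = w₀ ∧ (∀ᶠ t in 𝓝 (0 : ℝ), HasDerivAt w (Y (γ t, w t)) t) ∧
      SmoothNear w 0 := by
  -- Adjoining the base curve as an unknown makes the equation autonomous; uniqueness then
  -- identifies the first component of the solution with `γ`.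
  have hXY : SmoothNear (fun q : V × W => (X q.1, Y q)) (γ 0, w₀) :=
    (SmoothNear.comp (g := X) (f := Prod.fst) hX (smoothNear_of_contDiff contDiff_fst _)).prodMk hY
  obtain ⟨δ, h0, hδ⟩ := exists_integralCurve hXY
  have h1 : ∀ᶠ t in 𝓝 (0 : ℝ), HasDerivAt (fun t => (δ t).1) (X (δ t).1) t :=
    hδ.mono fun t h => h.fst
  have h2 : ∀ᶠ t in 𝓝 (0 : ℝ), HasDerivAt (fun t => (δ t).2) (Y (δ t)) t :=
    hδ.mono fun t h => h.snd
  have h3 := integralCurve_unique hX hγ h1 (by simp [h0])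
  refine ⟨fun t => (δ t).2, by simp [h0], ?_, ?_⟩
  · filter_upwards [h2, h3] with t h4 h5
    rw [h5]
    exact h4
  · exact (smoothNear_of_contDiff contDiff_snd _).comp
      (smoothNear_integralCurve (h0 ▸ hXY) hδ)

/-- A barrier argument. The bound on `X` is known only inside the ball, but if the distance ever
equals `M * s ≤ r` the curve is still in the ball, and there the speed is strictly below `M`, so the
barrier cannot be crossed. -/
theorem norm_sub_le_of_integralCurve_aux {X : V → V} {x : V} {r M ε : ℝ}
    (hM : ∀ y, ‖y - x‖ ≤ r → ‖X y‖ < M) (hε : M * ε ≤ r) {γ : ℝ → V} (h0 : γ 0 = x)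
    (hM0 : 0 < M) (hγ : ∀ t ∈ Ioo (-ε) ε, HasDerivAt γ (X (γ t)) t) {t : ℝ} (ht : t ∈ Ico 0 ε) :
    ‖γ t - x‖ ≤ M * t := by
  have hsub : Icc 0 t ⊆ Ioo (-ε) ε := fun s hs =>
    ⟨by linarith [hs.1, ht.1, ht.2], by linarith [hs.2, ht.2]⟩
  have hd : ∀ s ∈ Icc 0 t, HasDerivAt (fun s => γ s - x) (X (γ s)) s := fun s hs =>
    (hγ s (hsub hs)).sub_const x
  refine image_norm_le_of_norm_deriv_right_lt_deriv_boundary (f := fun s => γ s - x)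
    (f' := fun s => X (γ s)) (B := fun s => M * s) (B' := fun _ => M) (a := 0) (b := t)
    (fun s hs => (hd s hs).continuousAt.continuousWithinAt)
    (fun s hs => (hd s (Ico_subset_Icc_self hs)).hasDerivWithinAt) (by simp [h0])
    (fun s => by simpa using (hasDerivAt_id s).const_mul M) (fun s hs he => hM _ ?_)
    ⟨ht.1, le_rfl⟩
  rw [he]
  nlinarith [hs.1, hs.2, ht.2]

theorem norm_sub_le_of_integralCurve {X : V → V} {x : V} {r M ε : ℝ}
    (hM : ∀ y, ‖y - x‖ ≤ r → ‖X y‖ < M) (hε : M * ε ≤ r) {γ : ℝ → V} (h0 : γ 0 = x)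
    (hM0 : 0 < M) (hγ : ∀ t ∈ Ioo (-ε) ε, HasDerivAt γ (X (γ t)) t) {t : ℝ}
    (ht : t ∈ Ioo (-ε) ε) : ‖γ t - x‖ ≤ M * |t| := by
  rcases le_total 0 t with h | h
  · rw [abs_of_nonneg h]
    exact norm_sub_le_of_integralCurve_aux hM hε h0 hM0 hγ ⟨h, ht.2⟩
  · rw [abs_of_nonpos h]
    -- Negative times: the reversed curve is an integral curve of `-X`.
    have := norm_sub_le_of_integralCurve_aux (X := fun y => -X y) (γ := fun s => γ (-s)) (x := x)
      (r := r) (M := M) (ε := ε) (by simpa using hM) hε (by simpa using h0) hM0 (fun s hs => by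
        have h1 : HasDerivAt (γ ∘ Neg.neg) _ s :=
          (hγ (-s) ⟨by linarith [hs.2], by linarith [hs.1]⟩).scomp s (hasDerivAt_neg s)
        rw [neg_one_smul] at h1
        exact h1)
      (t := -t) ⟨by linarith, by linarith [ht.1]⟩
    simpa using this

/-- Solutions that start near `z` stay, for a short time, in a given neighbourhood of `z`. -/
theorem flow_confined {X : V → V} {z : V} (hX : ContinuousAt X z) {Φ : ℝ → V → V}
    (hΦ : ∃ ε > 0, ∀ᶠ y in 𝓝 z, Φ 0 y = y ∧
      ∀ t ∈ Ioo (-ε) ε, HasDerivAt (fun s => Φ s y) (X (Φ t y)) t) {p : V → Prop}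
    (hp : ∀ᶠ y in 𝓝 z, p y) :
    ∃ ε > 0, ∀ᶠ y in 𝓝 z, ∀ t ∈ Ioo (-ε) ε, p (Φ t y) := by
  obtain ⟨ε, hε, hΦ⟩ := hΦ
  have hb : ∀ᶠ y in 𝓝 z, ‖X y‖ < ‖X z‖ + 1 := hX.norm.eventually (gt_mem_nhds (lt_add_one _))
  obtain ⟨r, hr, hball⟩ := Metric.eventually_nhds_iff_ball.1 (hp.and hb)
  set M := ‖X z‖ + 1
  have hM : 0 < M := by positivity
  -- Start within `r / 2` of `z` and travel at most `r / 4` at speed below `M`: the curve stays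
  -- inside the ball of radius `r`.
  refine ⟨min ε (r / 4 / M), by positivity, ?_⟩
  filter_upwards [hΦ, Metric.ball_mem_nhds z (half_pos hr)] with y hy hyz t ht
  have hsub : Ioo (-min ε (r / 4 / M)) (min ε (r / 4 / M)) ⊆ Ioo (-ε) ε :=
    Ioo_subset_Ioo (by simp) (by simp)
  have hyz' : ‖y - z‖ < r / 2 := by simpa [dist_eq_norm] using hyz
  have h1 : M * min ε (r / 4 / M) ≤ r / 4 := by
    calc M * min ε (r / 4 / M) ≤ M * (r / 4 / M) := by gcongr; exact min_le_right _ _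
      _ = r / 4 := by field_simp
  have h2 := norm_sub_le_of_integralCurve (X := X) (x := y) (r := r / 4) (M := M)
    (fun w hw => (hball w (by
      have := norm_sub_le_norm_sub_add_norm_sub w y z
      rw [Metric.mem_ball, dist_eq_norm]; linarith)).2) h1 hy.1 hM
    (fun s hs => hy.2 s (hsub hs)) ht
  have h3 : |t| ≤ min ε (r / 4 / M) := (abs_lt.2 ht).le
  have h4 : M * |t| ≤ r / 4 := le_trans (by gcongr) h1
  refine (hball _ ?_).1
  have := norm_sub_le_norm_sub_add_norm_sub (Φ t y) y z
  rw [Metric.mem_ball, dist_eq_norm]; linarith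

end ODE

open scoped NNReal

/-! ### Differentiability of a flow with respect to its initial point -/

section Linearization

variable {V : Type*} [NormedAddCommGroup V] [NormedSpace ℝ V]

/-- With `u = b 0 - a 0`, the remainder `r = b - a - A u` satisfies `‖r'‖ ≤ (L₁ + 1) ‖r‖ + e`. Here
`e` bounds the Taylor remainder of `X` on the segment from `a s` to `b s`, and is quadratic in `‖u‖`
because the two trajectories separate at most exponentially. Gronwall turns this into a bound
quadratic in `‖u‖`. -/
theorem linearization_error_aux {X : V → V} {X' : V → V →L[ℝ] V} {B : Set V} {L₁ L₂ : ℝ≥0}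
    (hB : Convex ℝ B) (hX : ∀ y ∈ B, HasFDerivAt X (X' y) y) (h1 : LipschitzOnWith L₁ X B)
    (h2 : LipschitzOnWith L₂ X' B) (h3 : ∀ y ∈ B, ‖X' y‖ ≤ L₁) {a b : ℝ → V}
    {A : ℝ → V →L[ℝ] V} {ε : ℝ} (ha : ∀ t ∈ Ico 0 ε, HasDerivAt a (X (a t)) t ∧ a t ∈ B)
    (hb : ∀ t ∈ Ico 0 ε, HasDerivAt b (X (b t)) t ∧ b t ∈ B)
    (hA : ∀ t ∈ Ico 0 ε, HasDerivAt A (X' (a t) ∘L A t) t) (hA0 : A 0 = .id ℝ V)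
    {t : ℝ} (ht : t ∈ Ico 0 ε) :
    ‖b t - a t - A t (b 0 - a 0)‖ ≤
      L₂ * Real.exp (L₁ * ε) ^ 2 * Real.exp ((L₁ + 1) * ε) * ‖b 0 - a 0‖ ^ 2 := by
  have hsub : Icc 0 t ⊆ Ico 0 ε := fun s hs => ⟨hs.1, hs.2.trans_lt ht.2⟩
  have hsub' : Ico 0 t ⊆ Ico 0 ε := Ico_subset_Icc_self.trans hsub
  set u := b 0 - a 0
  have hd : ∀ s ∈ Icc 0 t, ‖b s - a s‖ ≤ ‖u‖ * Real.exp (L₁ * ε) := by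
    intro s hs
    have h := dist_le_of_trajectories_ODE_of_mem (v := fun _ => X) (s := fun _ => B) (K := L₁)
      (f := b) (g := a) (a := 0) (b := t) (δ := ‖u‖) (fun _ _ => h1)
      (fun s hs => (hb s (hsub hs)).1.continuousAt.continuousWithinAt)
      (fun s hs => (hb s (hsub' hs)).1.hasDerivWithinAt) (fun s hs => (hb s (hsub' hs)).2)
      (fun s hs => (ha s (hsub hs)).1.continuousAt.continuousWithinAt)
      (fun s hs => (ha s (hsub' hs)).1.hasDerivWithinAt) (fun s hs => (ha s (hsub' hs)).2)
      (by rw [dist_eq_norm]) s hs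
    rw [dist_eq_norm, sub_zero] at h
    refine h.trans ?_
    gcongr
    exact hs.2.trans ht.2.le
  set e := L₂ * (‖u‖ * Real.exp (L₁ * ε)) ^ 2
  have hr : ∀ s ∈ Icc 0 t, HasDerivAt (fun s => b s - a s - A s u)
      (X (b s) - X (a s) - X' (a s) (A s u)) s := fun s hs => by
    have h4 := ((hA s (hsub hs)).clm_apply (hasDerivAt_const s u))
    simp only [map_zero, add_zero, ContinuousLinearMap.comp_apply] at h4
    exact ((hb s (hsub hs)).1.sub (ha s (hsub hs)).1).sub h4
  -- The rate `L₁ + 1` replaces `L₁` so that it is nonzero and the closed form of the Gronwall bound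
  -- applies.
  have hG := norm_le_gronwallBound_of_norm_deriv_right_le (f := fun s => b s - a s - A s u)
    (f' := fun s => X (b s) - X (a s) - X' (a s) (A s u)) (δ := 0) (K := L₁ + 1) (ε := e)
    (a := 0) (b := t) (fun s hs => (hr s hs).continuousAt.continuousWithinAt)
    (fun s hs => (hr s (Ico_subset_Icc_self hs)).hasDerivWithinAt) (by simp [hA0, u])
    (fun s hs => by
      have has := (ha s (hsub' hs)).2
      have hbs := (hb s (hsub' hs)).2
      have hseg : segment ℝ (a s) (b s) ⊆ B := hB.segment_subset has hbs
      have hq : ‖X (b s) - X (a s) - X' (a s) (b s - a s)‖ ≤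
          (L₂ * ‖b s - a s‖) * ‖b s - a s‖ :=
        (convex_segment (𝕜 := ℝ) (a s) (b s)).norm_image_sub_le_of_norm_hasFDerivWithin_le'
          (fun y hy => (hX y (hseg hy)).hasFDerivWithinAt) (fun y hy => by
            have h5 := h2.norm_sub_le (hseg hy) has
            refine h5.trans ?_
            exact mul_le_mul_of_nonneg_left (norm_sub_le_of_mem_segment hy) L₂.2)
          (left_mem_segment _ _ _) (right_mem_segment _ _ _)
      have heq : X (b s) - X (a s) - X' (a s) (A s u) =
          (X (b s) - X (a s) - X' (a s) (b s - a s)) + X' (a s) (b s - a s - A s u) := by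
        simp only [map_sub]; abel
      have hds := hd s (Ico_subset_Icc_self hs)
      have h6 : (L₂ * ‖b s - a s‖) * ‖b s - a s‖ ≤ e := by
        calc (L₂ * ‖b s - a s‖) * ‖b s - a s‖ = L₂ * ‖b s - a s‖ ^ 2 := by ring
          _ ≤ e := by simp only [e]; gcongr
      have h7 : ‖X' (a s) (b s - a s - A s u)‖ ≤ (L₁ + 1) * ‖b s - a s - A s u‖ :=
        (ContinuousLinearMap.le_opNorm _ _).trans (by gcongr; linarith [h3 _ has])
      rw [heq]
      exact (norm_add_le _ _).trans (by linarith))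
    t ⟨ht.1, le_rfl⟩
  have hK : (L₁ : ℝ) + 1 ≠ 0 := by positivity
  have he : 0 ≤ e := by positivity
  rw [gronwallBound_of_K_ne_0 hK] at hG
  simp only [zero_mul, zero_add, sub_zero] at hG
  refine hG.trans ?_
  have h8 : e / (L₁ + 1) ≤ e := div_le_self he (by simp)
  have h9 : Real.exp ((L₁ + 1) * t) - 1 ≤ Real.exp ((L₁ + 1) * ε) := by
    have : Real.exp ((L₁ + 1) * t) ≤ Real.exp ((L₁ + 1) * ε) := by
      gcongr
      exact ht.2.le
    linarith
  have h10 : 0 ≤ Real.exp ((L₁ + 1) * t) - 1 := by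
    have : 1 ≤ Real.exp ((L₁ + 1) * t) := Real.one_le_exp (by have := ht.1; positivity)
    linarith
  calc e / (L₁ + 1) * (Real.exp ((L₁ + 1) * t) - 1) ≤ e * Real.exp ((L₁ + 1) * ε) := by gcongr
    _ = _ := by simp only [e]; ring

theorem hasDerivAt_comp_neg {W : Type*} [NormedAddCommGroup W] [NormedSpace ℝ W] {γ : ℝ → W}
    {w : W} {t : ℝ} (h : HasDerivAt γ w (-t)) : HasDerivAt (fun s => γ (-s)) (-w) t := by
  have h1 : HasDerivAt (γ ∘ Neg.neg) _ t := h.scomp t (hasDerivAt_neg t)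
  rw [neg_one_smul] at h1
  exact h1

theorem linearization_error {X : V → V} {X' : V → V →L[ℝ] V} {B : Set V} {L₁ L₂ : ℝ≥0}
    (hB : Convex ℝ B) (hX : ∀ y ∈ B, HasFDerivAt X (X' y) y) (h1 : LipschitzOnWith L₁ X B)
    (h2 : LipschitzOnWith L₂ X' B) (h3 : ∀ y ∈ B, ‖X' y‖ ≤ L₁) {a b : ℝ → V}
    {A : ℝ → V →L[ℝ] V} {ε : ℝ} (ha : ∀ t ∈ Ioo (-ε) ε, HasDerivAt a (X (a t)) t ∧ a t ∈ B)
    (hb : ∀ t ∈ Ioo (-ε) ε, HasDerivAt b (X (b t)) t ∧ b t ∈ B)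
    (hA : ∀ t ∈ Ioo (-ε) ε, HasDerivAt A (X' (a t) ∘L A t) t) (hA0 : A 0 = .id ℝ V)
    {t : ℝ} (ht : t ∈ Ioo (-ε) ε) :
    ‖b t - a t - A t (b 0 - a 0)‖ ≤
      L₂ * Real.exp (L₁ * ε) ^ 2 * Real.exp ((L₁ + 1) * ε) * ‖b 0 - a 0‖ ^ 2 := by
  rcases le_total 0 t with h | h
  · have hsub : Ico 0 ε ⊆ Ioo (-ε) ε := fun s hs => ⟨by linarith [hs.1, hs.2], hs.2⟩
    exact linearization_error_aux hB hX h1 h2 h3 (fun s hs => ha s (hsub hs))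
      (fun s hs => hb s (hsub hs)) (fun s hs => hA s (hsub hs)) hA0 ⟨h, ht.2⟩
  · have hsub : ∀ s ∈ Ico 0 ε, -s ∈ Ioo (-ε) ε := fun s hs =>
      ⟨by linarith [hs.2], by linarith [hs.1, hs.2]⟩
    have := linearization_error_aux (X := fun y => -X y) (X' := fun y => -X' y) (a := fun s => a (-s))
      (b := fun s => b (-s)) (A := fun s => A (-s)) (ε := ε) (t := -t) hB (fun y hy => (hX y hy).neg)
      h1.neg h2.neg (by simpa using h3)
      (fun s hs => ⟨hasDerivAt_comp_neg (ha _ (hsub s hs)).1, (ha _ (hsub s hs)).2⟩)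
      (fun s hs => ⟨hasDerivAt_comp_neg (hb _ (hsub s hs)).1, (hb _ (hsub s hs)).2⟩)
      (fun s hs => by simpa using hasDerivAt_comp_neg (hA _ (hsub s hs))) (by simpa using hA0)
      ⟨by linarith, by linarith [ht.1]⟩
    simpa using this

/-- `Φ` is a local flow of `X` near `z`. -/
def IsFlowNear (X : V → V) (z : V) (Φ : ℝ → V → V) : Prop :=
  ∃ ε > 0, ∀ᶠ y in 𝓝 z, Φ 0 y = y ∧
    ∀ t ∈ Ioo (-ε) ε, HasDerivAt (fun s => Φ s y) (X (Φ t y)) t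

theorem isLocalFlow_iff {n : ℕ} {X : E n × E n → E n × E n} {z : E n × E n}
    {Φ : ℝ → E n × E n → E n × E n} : IsLocalFlow X z Φ ↔ IsFlowNear X z Φ := by
  simp only [IsLocalFlow, IsFlowNear, eventually_iff_exists_mem]

theorem exists_isFlowNear [CompleteSpace V] {X : V → V} {z : V} (hX : SmoothNear X z) :
    ∃ Φ, IsFlowNear X z Φ := by
  classical
  obtain ⟨r, hr, ε, hε, H⟩ :=
    (hX.contDiffAt.of_le (by simp) :
      ContDiffAt ℝ 1 X z).exists_forall_mem_closedBall_exists_eq_forall_mem_Ioo_hasDerivAt 0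
  choose α hα using H
  refine ⟨fun t y => if hy : y ∈ Metric.closedBall z r then α y hy t else 0, ε, hε, ?_⟩
  filter_upwards [Metric.closedBall_mem_nhds z hr] with y hy
  simp only [dif_pos hy]
  simpa using hα y hy

theorem IsFlowNear.integralCurve {X : V → V} {z : V} {Φ : ℝ → V → V} (hΦ : IsFlowNear X z Φ) :
    Φ 0 z = z ∧ ∀ᶠ t in 𝓝 (0 : ℝ), HasDerivAt (fun s => Φ s z) (X (Φ t z)) t := by
  obtain ⟨ε, hε, h⟩ := hΦ
  exact ⟨h.self_of_nhds.1, eventually_zero_iff_Ioo.2 ⟨ε, hε, h.self_of_nhds.2⟩⟩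

theorem IsFlowNear.smoothNear [CompleteSpace V] {X : V → V} {z : V} {Φ : ℝ → V → V}
    (hX : SmoothNear X z) (hΦ : IsFlowNear X z Φ) : SmoothNear (fun s => Φ s z) 0 :=
  smoothNear_integralCurve (by rw [hΦ.integralCurve.1]; exact hX) hΦ.integralCurve.2

theorem IsFlowNear.confined {X : V → V} {z : V} {Φ : ℝ → V → V}
    (hX : SmoothNear X z) (hΦ : IsFlowNear X z Φ) {p : V → Prop} (hp : ∀ᶠ y in 𝓝 z, p y) :
    ∃ ε > 0, ∀ᶠ y in 𝓝 z, ∀ t ∈ Ioo (-ε) ε, p (Φ t y) :=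
  flow_confined hX.continuousAt hΦ hp

theorem IsFlowNear.unique {X : V → V} {z : V} {Φ Ψ : ℝ → V → V}
    (hX : SmoothNear X z) (hΦ : IsFlowNear X z Φ) (hΨ : IsFlowNear X z Ψ) :
    ∃ ε > 0, ∀ᶠ y in 𝓝 z, ∀ t ∈ Ioo (-ε) ε, Φ t y = Ψ t y := by
  obtain ⟨K, s, hs, hL⟩ := hX.exists_lipschitzOnWith
  obtain ⟨ε₁, hε₁, h1⟩ := hΦ.confined hX hs
  obtain ⟨ε₂, hε₂, h2⟩ := hΨ.confined hX hs
  obtain ⟨ε₃, hε₃, h3⟩ := hΦ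
  obtain ⟨ε₄, hε₄, h4⟩ := hΨ
  refine ⟨min (min ε₁ ε₂) (min ε₃ ε₄), by positivity, ?_⟩
  filter_upwards [h1, h2, h3, h4] with y h1 h2 h3 h4 t ht
  refine ODE_solution_unique_of_mem_Ioo (v := fun _ => X) (s := fun _ => s)
    (a := -min (min ε₁ ε₂) (min ε₃ ε₄)) (b := min (min ε₁ ε₂) (min ε₃ ε₄)) (t₀ := 0)
    (f := fun t => Φ t y) (g := fun t => Ψ t y)
    (fun _ _ => hL) ⟨by simp [*], by simp [*]⟩ (fun s hs => ?_) (fun s hs => ?_)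
    (h3.1.trans h4.1.symm) ht
  all_goals simp only [mem_Ioo, neg_lt, lt_min_iff] at hs
  · exact ⟨h3.2 s ⟨by linarith, by linarith⟩, h1 s ⟨by linarith, by linarith⟩⟩
  · exact ⟨h4.2 s ⟨by linarith, by linarith⟩, h2 s ⟨by linarith, by linarith⟩⟩

/-- The linearization of a local flow along the orbit of `z`. -/
theorem IsFlowNear.exists_linearization [CompleteSpace V] {X : V → V} {z : V} {Φ : ℝ → V → V}
    (hX : SmoothNear X z) (hΦ : IsFlowNear X z Φ) :
    ∃ A : ℝ → V →L[ℝ] V, A 0 = .id ℝ V ∧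
      (∀ᶠ t in 𝓝 (0 : ℝ), HasDerivAt A (fderiv ℝ X (Φ t z) ∘L A t) t) ∧ SmoothNear A 0 ∧
      ∀ᶠ t in 𝓝 (0 : ℝ), HasFDerivAt (fun q : ℝ × V => Φ q.1 q.2)
        ((ContinuousLinearMap.toSpanSingleton ℝ (X (Φ t z))).coprod (A t)) (t, z) := by
  have hz := hΦ.integralCurve.1
  -- The candidate derivative solves the variational equation `A' = dX(Φ t z) ∘ A` with `A 0 = id`.
  obtain ⟨A, hA0, hA, hAs⟩ := exists_solution_along (γ := fun s => Φ s z) (X := X)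
    (Y := fun q : V × (V →L[ℝ] V) => fderiv ℝ X q.1 ∘L q.2) (w₀ := .id ℝ V)
    (by rw [hz]; exact hX) (by
      rw [hz]
      have h1 : SmoothNear (fun q : V × (V →L[ℝ] V) => fderiv ℝ X q.1) (z, .id ℝ V) :=
        SmoothNear.comp (g := fderiv ℝ X) (f := Prod.fst) hX.fderiv
          (smoothNear_of_contDiff contDiff_fst _)
      filter_upwards [h1] with q hq
      exact hq.clm_comp contDiffAt_snd) hΦ.integralCurve.2
  refine ⟨A, hA0, hA, hAs, ?_⟩
  obtain ⟨L, s, hs, hL⟩ := hX.exists_lipschitzOnWith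
  obtain ⟨L₂, s₂, hs₂, hL₂⟩ := hX.fderiv.exists_lipschitzOnWith
  obtain ⟨r, hr, hball⟩ := Metric.eventually_nhds_iff_ball.1 (hX.and
    ((eventually_mem_set.2 hs).and (eventually_mem_set.2 hs₂)))
  obtain ⟨ε₁, hε₁, h1⟩ := hΦ.confined hX (Metric.ball_mem_nhds z hr)
  obtain ⟨ε₂, hε₂, h2⟩ := hΦ
  obtain ⟨ε₃, hε₃, h3⟩ := eventually_zero_iff_Ioo.1 hA
  set ε := min ε₁ (min ε₂ ε₃)
  have hε : 0 < ε := by positivity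
  have e1 : Ioo (-ε) ε ⊆ Ioo (-ε₁) ε₁ := Ioo_subset_Ioo (by simp [ε]) (by simp [ε])
  have e2 : Ioo (-ε) ε ⊆ Ioo (-ε₂) ε₂ := Ioo_subset_Ioo (by simp [ε]) (by simp [ε])
  have e3 : Ioo (-ε) ε ⊆ Ioo (-ε₃) ε₃ := Ioo_subset_Ioo (by simp [ε]) (by simp [ε])
  have hdif : ∀ y ∈ Metric.ball z r, HasFDerivAt X (fderiv ℝ X y) y := fun y hy =>
    ((hball y hy).1.differentiableAt (by simp)).hasFDerivAt
  obtain ⟨C, hC⟩ : ∃ C : ℝ, ∀ᶠ y in 𝓝 z, ∀ t ∈ Ioo (-ε) ε,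
      ‖Φ t y - Φ t z - A t (y - z)‖ ≤ C * ‖y - z‖ ^ 2 := by
    refine ⟨L₂ * Real.exp (L * ε) ^ 2 * Real.exp ((L + 1) * ε), ?_⟩
    filter_upwards [h1, h2] with y hy1 hy2 t ht
    have := linearization_error (X := X) (X' := fderiv ℝ X) (B := Metric.ball z r) (L₁ := L)
      (L₂ := L₂) (a := fun s => Φ s z) (b := fun s => Φ s y) (A := A) (ε := ε)
      (convex_ball z r) hdif (hL.mono fun y hy => (hball y hy).2.1)
      (hL₂.mono fun y hy => (hball y hy).2.2)
      (fun y hy => norm_fderiv_le_of_lipschitzOn ℝ (Metric.isOpen_ball.mem_nhds hy)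
        (hL.mono fun y hy => (hball y hy).2.1))
      (fun s hs => ⟨h2.self_of_nhds.2 s (e2 hs), h1.self_of_nhds s (e1 hs)⟩)
      (fun s hs => ⟨hy2.2 s (e2 hs), hy1 s (e1 hs)⟩) (fun s hs => h3 s (e3 hs)) hA0 ht
    simpa [hy2.1, hz] using this
  filter_upwards [Ioo_mem_nhds (neg_lt_zero.2 hε) hε] with t ht
  -- Joint differentiability in time and point: `Φ s y` is the sum of this remainder, which is
  -- quadratically small uniformly in `s`, of `A s (y - z)`, and of `Φ s z`, which is governed by
  -- the equation alone.
  have hrem : HasFDerivAt (fun q : ℝ × V => Φ q.1 q.2 - Φ q.1 z - A q.1 (q.2 - z))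
      (0 : ℝ × V →L[ℝ] V) (t, z) := by
    have hO : (fun q : ℝ × V => Φ q.1 q.2 - Φ q.1 z - A q.1 (q.2 - z)) =O[𝓝 (t, z)]
        fun q => ‖q - (t, z)‖ ^ 2 := by
      refine Asymptotics.IsBigO.of_bound |C| ?_
      rw [nhds_prod_eq]
      filter_upwards [(eventually_mem_set.2 (isOpen_Ioo.mem_nhds ht)).prod_mk hC] with q hq
      have h4 : ‖q.2 - z‖ ≤ ‖q - (t, z)‖ := norm_snd_le (q - (t, z))
      refine (hq.2 q.1 hq.1).trans ?_
      rw [norm_pow, norm_norm]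
      gcongr
      exact le_abs_self C
    refine hasFDerivAt_iff_isLittleO.2 ?_
    have hlit : (fun q : ℝ × V => ‖q - (t, z)‖ ^ 2) =o[𝓝 (t, z)] fun q => q - (t, z) := by
      have : Tendsto (fun q : ℝ × V => q - (t, z)) (𝓝 (t, z)) (𝓝 0) :=
        tendsto_sub_nhds_zero_iff.2 tendsto_id
      exact (Asymptotics.isLittleO_norm_pow_id one_lt_two).comp_tendsto this
    simpa using hO.trans_isLittleO hlit
  have hAq : HasFDerivAt (fun q : ℝ × V => A q.1) _ (t, z) :=
    (h3 t (e3 ht)).hasFDerivAt.comp (t, z) hasFDerivAt_fst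
  have hAu := hAq.clm_apply ((hasFDerivAt_snd (𝕜 := ℝ) (E := ℝ) (F := V) (p := (t, z))).sub_const z)
  have hΦz : HasFDerivAt (fun q : ℝ × V => Φ q.1 z) _ (t, z) :=
    HasFDerivAt.comp (g := fun s => Φ s z) (t, z) (h2.self_of_nhds.2 t (e2 ht)).hasFDerivAt
      hasFDerivAt_fst
  have := (hrem.add hAu).add hΦz
  refine (this.congr_of_eventuallyEq (Eventually.of_forall fun q => ?_)).congr_fderiv ?_
  · simp
  · ext q <;> simp

end Linearization

theorem hasFDerivAt_slice {V : Type*} [NormedAddCommGroup V] [NormedSpace ℝ V]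
    {Φ : ℝ → V → V} {B : ℝ →L[ℝ] V} {A : V →L[ℝ] V} {t : ℝ} {z : V}
    (h : HasFDerivAt (fun q : ℝ × V => Φ q.1 q.2) (B.coprod A) (t, z)) :
    HasFDerivAt (Φ t) A z := by
  have := h.comp z ((hasFDerivAt_const t z).prodMk (hasFDerivAt_id z))
  exact this.congr_fderiv (ContinuousLinearMap.ext fun u => by simp)

/-! ### The symplectic form and Hamiltonian vector fields -/

section Symplectic

variable {n : ℕ}

theorem symp_eq_inner (u w : E n × E n) : symp u w = inner ℝ u.2 w.1 - inner ℝ u.1 w.2 := by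
  simp only [symp, PiLp.inner_apply, Real.inner_apply, ← Finset.sum_sub_distrib]
  exact Finset.sum_congr rfl fun i _ => by ring

theorem symp_swap (u w : E n × E n) : symp u w = -symp w u := by
  simp only [symp_eq_inner, real_inner_comm]
  ring

/-- The symplectic form as a bilinear map. -/
def sympBilin (n : ℕ) : LinearMap.BilinForm ℝ (E n × E n) :=
  LinearMap.mk₂ ℝ symp
    (fun u v w => by simp [symp_eq_inner, inner_add_left]; ring)
    (fun c u w => by simp [symp_eq_inner, inner_smul_left]; ring)
    (fun u v w => by simp [symp_eq_inner, inner_add_right]; ring)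
    (fun c u w => by simp [symp_eq_inner, inner_smul_right]; ring)

theorem sympBilin_apply (u w : E n × E n) : sympBilin n u w = symp u w := rfl

theorem symp_neg_left (u w : E n × E n) : symp (-u) w = -symp u w :=
  (sympBilin n).map_neg₂ u w

theorem symp_self (u : E n × E n) : symp u u = 0 := by
  simp only [symp_eq_inner, real_inner_comm, sub_self]

theorem symp_nondegenerate {u : E n × E n} (h : ∀ w, symp u w = 0) : u = 0 := by
  have h1 := h (u.2, 0)
  have h2 := h (0, u.1)
  simp only [symp_eq_inner, inner_zero_right, sub_zero, zero_sub, neg_eq_zero,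
    inner_self_eq_zero] at h1 h2
  exact Prod.ext h2 h1

theorem HasDerivAt.symp {u w : ℝ → E n × E n} {u' w' : E n × E n} {t : ℝ}
    (hu : HasDerivAt u u' t) (hw : HasDerivAt w w' t) :
    HasDerivAt (fun s => symp (u s) (w s)) (symp u' (w t) + symp (u t) w') t := by
  simp only [symp_eq_inner]
  have hu₁ : HasDerivAt (fun s => (u s).1) u'.1 t := hu.fst
  have hu₂ : HasDerivAt (fun s => (u s).2) u'.2 t := hu.snd
  have hw₁ : HasDerivAt (fun s => (w s).1) w'.1 t := hw.fst
  have hw₂ : HasDerivAt (fun s => (w s).2) w'.2 t := hw.snd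
  refine ((hu₂.inner ℝ hw₁).sub (hu₁.inner ℝ hw₂)).congr_deriv ?_
  ring

theorem mem_vertical {u : E n × E n} : u ∈ vertical n ↔ u.1 = 0 := by
  simp [vertical]

theorem symp_vertical {u w : E n × E n} (hu : u ∈ vertical n) (hw : w ∈ vertical n) :
    symp u w = 0 := by
  rw [mem_vertical] at hu hw
  simp [symp_eq_inner, hu, hw]

theorem finrank_vertical : Module.finrank ℝ (vertical n) = n := by
  have h := (LinearMap.fst ℝ (E n) (E n)).finrank_range_add_finrank_ker
  rw [LinearMap.range_eq_top.2 LinearMap.fst_surjective, finrank_top, Module.finrank_prod] at h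
  simp only [finrank_euclideanSpace, Fintype.card_fin] at h
  exact Nat.add_left_cancel h

theorem sum_smul_single (w : E n) : ∑ i, w i • EuclideanSpace.single i (1 : ℝ) = w := by
  ext j
  simp [Finset.sum_apply, Pi.single_apply]

theorem clm_fib_eq_sum {W : Type*} [NormedAddCommGroup W] [NormedSpace ℝ W]
    (A : E n × E n →L[ℝ] W) (w : E n) :
    A (0, w) = ∑ i, w i • A (0, EuclideanSpace.single i 1) := by
  have h := congrArg (fun v => A.comp (.inr ℝ (E n) (E n)) v) (sum_smul_single w)
  simpa using h.symm

theorem clm_base_eq_sum {W : Type*} [NormedAddCommGroup W] [NormedSpace ℝ W]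
    (A : E n × E n →L[ℝ] W) (w : E n) :
    A (w, 0) = ∑ i, w i • A (EuclideanSpace.single i 1, 0) := by
  have h := congrArg (fun v => A.comp (.inl ℝ (E n) (E n)) v) (sum_smul_single w)
  simpa using h.symm

theorem fderiv_eq_sum (f : E n × E n → ℝ) (z w : E n × E n) :
    fderiv ℝ f z w = ∑ i, w.1 i * dBase i f z + ∑ i, w.2 i * dFib i f z := by
  have h : w = (w.1, 0) + (0, w.2) := by simp
  conv_lhs => rw [h, map_add, clm_base_eq_sum, clm_fib_eq_sum]
  rfl

theorem symp_hamVec (K : E n × E n → ℝ) (z w : E n × E n) :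
    symp (hamVec K z) w = -fderiv ℝ K z w := by
  rw [fderiv_eq_sum, ← Finset.sum_add_distrib, symp, ← Finset.sum_neg_distrib]
  refine Finset.sum_congr rfl fun i _ => ?_
  simp only [hamVec]
  ring

theorem SmoothNear.isSymmSndFDerivAt {V : Type*} [NormedAddCommGroup V] [NormedSpace ℝ V]
    {f : V → ℝ} {z : V} (hf : SmoothNear f z) : IsSymmSndFDerivAt ℝ f z := by
  refine hf.contDiffAt.isSymmSndFDerivAt ?_
  simp only [minSmoothness_of_isRCLikeNormedField]
  exact WithTop.coe_le_coe.2 (le_top : (2 : ℕ∞) ≤ ⊤)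

theorem SmoothNear.dBase {f : E n × E n → ℝ} {z : E n × E n} (hf : SmoothNear f z) (i : Fin n) :
    SmoothNear (dBase i f) z := by
  filter_upwards [hf.fderiv] with y hy
  exact hy.clm_apply contDiffAt_const

theorem SmoothNear.dFib {f : E n × E n → ℝ} {z : E n × E n} (hf : SmoothNear f z) (i : Fin n) :
    SmoothNear (dFib i f) z := by
  filter_upwards [hf.fderiv] with y hy
  exact hy.clm_apply contDiffAt_const

theorem smoothNear_toLp {V : Type*} [NormedAddCommGroup V] [NormedSpace ℝ V]
    {f : V → Fin n → ℝ} {z : V} (hf : ∀ i, SmoothNear (fun y => f y i) z) :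
    SmoothNear (fun y => (WithLp.toLp 2 (f y) : E n)) z := by
  filter_upwards [eventually_all.2 hf] with y hy
  exact contDiffAt_piLp 2 |>.2 hy

theorem SmoothNear.hamVec {K : E n × E n → ℝ} {z : E n × E n} (hK : SmoothNear K z) :
    SmoothNear (hamVec K) z :=
  (smoothNear_toLp fun i => hK.dFib i).prodMk
    (smoothNear_toLp fun i => (hK.dBase i).mono fun _ h => h.neg)

/-- Differentiating `symp (hamVec K) w = -dK w` gives `symp (dX u) w = -d²K(u, w)`, which is
symmetric in `u` and `w`. This is the infinitesimal form of the invariance of `symp` under the flow.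
-/
theorem symp_fderiv_hamVec {K : E n × E n → ℝ} {z : E n × E n} (hK : SmoothNear K z)
    (u w : E n × E n) :
    symp (fderiv ℝ (hamVec K) z u) w + symp u (fderiv ℝ (hamVec K) z w) = 0 := by
  have key : ∀ u w, symp (fderiv ℝ (hamVec K) z u) w = -fderiv ℝ (fderiv ℝ K) z u w := by
    intro u w
    have h1 : HasFDerivAt (fun y => symp (hamVec K y) w)
        ((LinearMap.toContinuousLinearMap ((sympBilin n).flip w)).comp
          (fderiv ℝ (hamVec K) z)) z :=
      (LinearMap.toContinuousLinearMap ((sympBilin n).flip w)).hasFDerivAt.comp z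
        hK.hamVec.differentiableAt.hasFDerivAt
    have h2 : HasFDerivAt (fun y => symp (hamVec K y) w) _ z :=
      ((hK.fderiv.differentiableAt.hasFDerivAt.clm_apply (hasFDerivAt_const w z)).neg).congr_of_eventuallyEq
        (Eventually.of_forall fun y => symp_hamVec K y w)
    have := congrArg (fun A => A u) (h1.unique h2)
    simpa [sympBilin_apply] using this
  have hsymm : fderiv ℝ (fderiv ℝ K) z u w = fderiv ℝ (fderiv ℝ K) z w u :=
    hK.isSymmSndFDerivAt u w
  rw [symp_swap u, key, key, hsymm]
  ring

end Symplectic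

/-! ### Jacobi curves, canonical frames and uniqueness of the curvature operator -/

section JacobiCurve

variable {n : ℕ} {K : E n × E n → ℝ} {z : E n × E n}

theorem isFlowNear_hamFlow (hK : SmoothNear K z) :
    IsFlowNear (hamVec K) z (hamFlow K z) := by
  obtain ⟨Φ, hΦ⟩ := exists_isFlowNear hK.hamVec
  exact isLocalFlow_iff.1 (Classical.epsilon_spec ⟨Φ, isLocalFlow_iff.2 hΦ⟩)

/-- `hamFlow` is an unspecified choice of local flow. Two local flows agree near `z` for short times
and so have the same derivative there; any convenient flow may therefore be used to compute the
Jacobi curve. -/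
theorem jacobiCurve_eq_comap {Φ : ℝ → E n × E n → E n × E n} (hK : SmoothNear K z)
    (hΦ : IsFlowNear (hamVec K) z Φ) :
    ∀ᶠ t in 𝓝 (0 : ℝ), ∀ A : E n × E n →L[ℝ] E n × E n, HasFDerivAt (Φ t) A z →
      jacobiCurve K z t = (vertical n).comap A.toLinearMap := by
  obtain ⟨ε, hε, h⟩ := hΦ.unique hK.hamVec (isFlowNear_hamFlow hK)
  filter_upwards [Ioo_mem_nhds (neg_lt_zero.2 hε) hε] with t ht A hA
  have h1 : HasFDerivAt (hamFlow K z t) A z :=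
    hA.congr_of_eventuallyEq (h.mono fun y hy => (hy t ht).symm)
  rw [jacobiCurve, h1.fderiv]

theorem eventually_symp_linearization {A : ℝ → E n × E n →L[ℝ] E n × E n} {γ : ℝ → E n × E n}
    (hK : ∀ᶠ t in 𝓝 (0 : ℝ), SmoothNear K (γ t)) (hA0 : A 0 = .id ℝ _)
    (hA : ∀ᶠ t in 𝓝 (0 : ℝ), HasDerivAt A (fderiv ℝ (hamVec K) (γ t) ∘L A t) t)
    (u w : E n × E n) : ∀ᶠ t in 𝓝 (0 : ℝ), symp (A t u) (A t w) = symp u w := by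
  have h : ∀ᶠ t in 𝓝 (0 : ℝ), HasDerivAt (fun t => symp (A t u) (A t w)) 0 t := by
    filter_upwards [hK, hA] with t h1 h2
    have h3 : ∀ v, HasDerivAt (fun s => A s v) (fderiv ℝ (hamVec K) (γ t) (A t v)) t := fun v => by
      simpa using h2.clm_apply (hasDerivAt_const t v)
    exact ((h3 u).symp (h3 w)).congr_deriv (symp_fderiv_hamVec h1 _ _)
  simpa [hA0] using eventually_eq_of_hasDerivAt_zero h

/-- The time interval may depend on the two vectors; testing on a finite basis gives one interval
for all of them. -/
theorem eventually_forall_symp {A : ℝ → E n × E n →L[ℝ] E n × E n}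
    (h : ∀ u w, ∀ᶠ t in 𝓝 (0 : ℝ), symp (A t u) (A t w) = symp u w) :
    ∀ᶠ t in 𝓝 (0 : ℝ), ∀ u w, symp (A t u) (A t w) = symp u w := by
  let b := Module.finBasis ℝ (E n × E n)
  filter_upwards [eventually_all.2 fun i => eventually_all.2 fun j => h (b i) (b j)] with t ht u w
  have : ((sympBilin n).compl₁₂ (A t).toLinearMap (A t).toLinearMap) = sympBilin n :=
    LinearMap.BilinForm.ext_basis b fun i j => by simpa [sympBilin_apply] using ht i j
  exact congrArg (fun B : LinearMap.BilinForm ℝ (E n × E n) => B u w) this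

/-- The Jacobi curve of a smooth Hamiltonian consists of Lagrangian subspaces. -/
theorem jacobiCurve_lagrangian (hK : SmoothNear K z) :
    ∀ᶠ t in 𝓝 (0 : ℝ), (∀ u ∈ jacobiCurve K z t, ∀ w ∈ jacobiCurve K z t, symp u w = 0) ∧
      Module.finrank ℝ (jacobiCurve K z t) = n := by
  have hΦ := isFlowNear_hamFlow hK
  obtain ⟨A, hA0, hA, hAs, hd⟩ := hΦ.exists_linearization hK.hamVec
  have hγ : ∀ᶠ t in 𝓝 (0 : ℝ), SmoothNear K (hamFlow K z t z) := by
    have h := (hΦ.smoothNear hK.hamVec).continuousAt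
    rw [ContinuousAt, hΦ.integralCurve.1] at h
    exact h.eventually hK.eventually
  filter_upwards [eventually_forall_symp (eventually_symp_linearization hγ hA0 hA),
    jacobiCurve_eq_comap hK hΦ, hd] with t h1 h2 h3
  have h4 := hasFDerivAt_slice h3
  rw [h2 _ h4]
  refine ⟨fun u hu w hw => ?_, ?_⟩
  · rw [← h1]
    exact symp_vertical hu hw
  -- A map preserving a nondegenerate form is injective, hence invertible, so the preimage of the
  -- vertical space has its dimension.
  · have hinj : Function.Injective (A t) := (injective_iff_map_eq_zero (A t)).2 fun u hu =>
      symp_nondegenerate fun w => by rw [← h1, hu, symp_eq_inner]; simp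
    let e := LinearEquiv.ofInjectiveEndo (A t).toLinearMap hinj
    have h5 : (vertical n).comap (A t).toLinearMap = (vertical n).map e.symm.toLinearMap := by
      ext u
      simp only [Submodule.mem_comap, Submodule.mem_map]
      constructor
      · intro hu
        exact ⟨_, hu, e.symm_apply_apply u⟩
      · rintro ⟨v, hv, rfl⟩
        have : (A t).toLinearMap (e.symm.toLinearMap v) = v := e.apply_symm_apply v
        rwa [this]
    rw [h5, LinearEquiv.finrank_map_eq, finrank_vertical]

theorem jacobiCurve_zero (hK : SmoothNear K z) : jacobiCurve K z 0 = vertical n := by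
  have hΦ := isFlowNear_hamFlow hK
  have h1 : HasFDerivAt (hamFlow K z 0) (.id ℝ _) z := by
    obtain ⟨ε, hε, h⟩ := hΦ
    exact (hasFDerivAt_id z).congr_of_eventuallyEq (h.mono fun y hy => hy.1)
  rw [(jacobiCurve_eq_comap hK hΦ).self_of_nhds _ h1]
  rfl

theorem IsCanonicalFrame.eventually {e : Fin n → ℝ → E n × E n} (he : IsCanonicalFrame K z e) :
    ∀ᶠ t in 𝓝 (0 : ℝ), (∀ i, e i t ∈ jacobiCurve K z t) ∧
      (∀ i, deriv (deriv (e i)) t ∈ jacobiCurve K z t) ∧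
      (∀ i j, symp (deriv (e i) t) (e j t) = if i = j then 1 else 0) ∧
      (∀ i, HasDerivAt (e i) (deriv (e i) t) t) ∧
      ∀ i, HasDerivAt (deriv (e i)) (deriv (deriv (e i)) t) t := by
  obtain ⟨ε, hε, hs, h⟩ := he
  have hs' : ∀ i, SmoothNear (e i) 0 := fun i =>
    eventually_zero_iff_Ioo.2 ⟨ε, hε, fun t ht => (hs i).contDiffAt (isOpen_Ioo.mem_nhds ht)⟩
  have hd : ∀ i, ∀ᶠ t in 𝓝 (0 : ℝ), ContDiffAt ℝ ∞ (e i) t ∧ ContDiffAt ℝ ∞ (deriv (e i)) t :=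
    fun i => (hs' i).and (by
      filter_upwards [hs' i] with t ht
      exact (ht.fderiv_right (m := ∞) (by simp)).clm_apply contDiffAt_const)
  filter_upwards [eventually_zero_iff_Ioo.2 ⟨ε, hε, h⟩, eventually_all.2 hd] with t h1 h2
  exact ⟨fun i => (h1 i).1, fun i => (h1 i).2.1, fun i => (h1 i).2.2,
    fun i => ((h2 i).1.differentiableAt (by simp)).hasDerivAt,
    fun i => ((h2 i).2.differentiableAt (by simp)).hasDerivAt⟩

theorem linearIndependent_of_symp {v w : Fin n → E n × E n}
    (h : ∀ i j, symp (v i) (w j) = if i = j then 1 else 0) : LinearIndependent ℝ w := by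
  rw [Fintype.linearIndependent_iff]
  intro g hg i
  have h1 := congrArg (sympBilin n (v i)) hg
  rw [map_sum, map_zero] at h1
  simpa [sympBilin_apply, h] using h1

/-- The family `w` is independent because `v` is dual to it under `symp`; by dimension it is a basis
of `J`, and pairing with `v` reads off coefficients. -/
theorem eq_sum_symp {J : Submodule ℝ (E n × E n)} (hJ : Module.finrank ℝ J = n)
    {v w : Fin n → E n × E n} (hw : ∀ i, w i ∈ J)
    (h : ∀ i j, symp (v i) (w j) = if i = j then 1 else 0) {u : E n × E n} (hu : u ∈ J) :
    u = ∑ k, symp (v k) u • w k := by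
  have hspan : Submodule.span ℝ (Set.range w) = J := by
    refine Submodule.eq_of_le_of_finrank_eq (Submodule.span_le.2 (by rintro _ ⟨i, rfl⟩; exact hw i)) ?_
    rw [finrank_span_eq_card (linearIndependent_of_symp h), Fintype.card_fin, hJ]
  rw [← hspan] at hu
  obtain ⟨g, rfl⟩ := (Submodule.mem_span_range_iff_exists_fun ℝ).1 hu
  refine Finset.sum_congr rfl fun k _ => ?_
  congr 1
  rw [← sympBilin_apply, map_sum]
  simp [sympBilin_apply, h]

/-- Two canonical frames differ by a constant linear transformation. -/
theorem IsCanonicalFrame.exists_matrix (hK : SmoothNear K z) {e e' : Fin n → ℝ → E n × E n}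
    (he : IsCanonicalFrame K z e) (he' : IsCanonicalFrame K z e') :
    ∃ O : Fin n → Fin n → ℝ, ∀ i, ∀ᶠ t in 𝓝 (0 : ℝ), e' i t = ∑ k, O i k • e k t := by
  refine ⟨fun i k => symp (deriv (e k) 0) (e' i 0), fun i => ?_⟩
  have hJ := jacobiCurve_lagrangian hK
  -- These are the coefficients of `e'` in the frame `e`. Differentiating `symp (e' i) (e k) = 0`
  -- equates `symp (ė' i) (e k)` with `symp (ė k) (e' i)`. Differentiating again, the second
  -- derivatives drop out because the Jacobi curve is Lagrangian, which leaves `symp (ė' i) (ė k) =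
  -- symp (ė k) (ė' i)`. By antisymmetry both vanish, so the coefficients are constant.
  have key : ∀ k, ∀ᶠ t in 𝓝 (0 : ℝ),
      symp (deriv (e k) t) (e' i t) = symp (deriv (e k) 0) (e' i 0) := by
    intro k
    refine eventually_eq_of_hasDerivAt_zero (f := fun t => symp (deriv (e k) t) (e' i t)) ?_
    have h0 : ∀ᶠ t in 𝓝 (0 : ℝ), symp (e' i t) (e k t) = 0 := by
      filter_upwards [hJ, he.eventually, he'.eventually] with t h1 h2 h3
      exact h1.1 _ (h3.1 i) _ (h2.1 k)
    have h1 : ∀ᶠ t in 𝓝 (0 : ℝ), symp (deriv (e' i) t) (e k t) = symp (deriv (e k) t) (e' i t) := by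
      filter_upwards [h0.eventually_nhds, he.eventually, he'.eventually] with t h1 h2 h3
      have h4 := ((h3.2.2.2.1 i).symp (h2.2.2.2.1 k)).unique
        ((hasDerivAt_const t (0 : ℝ)).congr_of_eventuallyEq h1)
      rw [symp_swap (e' i t)] at h4
      linarith
    filter_upwards [h1.eventually_nhds, hJ, he.eventually, he'.eventually] with t h1 h4 h2 h3
    have d1 := (h3.2.2.2.2 i).symp (h2.2.2.2.1 k)
    have d2 := (h2.2.2.2.2 k).symp (h3.2.2.2.1 i)
    rw [h4.1 _ (h3.2.1 i) _ (h2.1 k), zero_add] at d1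
    rw [h4.1 _ (h2.2.1 k) _ (h3.1 i), zero_add] at d2
    have h5 := d2.unique (d1.congr_of_eventuallyEq (EventuallyEq.symm h1))
    rw [symp_swap (deriv (e' i) t)] at h5
    have h6 : symp (deriv (e k) t) (deriv (e' i) t) = 0 := by linarith
    rwa [h6] at d2
  filter_upwards [eventually_all.2 key, hJ, he.eventually, he'.eventually] with t h1 h4 h2 h3
  rw [eq_sum_symp h4.2 h2.1 h2.2.2.1 (h3.1 i)]
  exact Finset.sum_congr rfl fun k _ => by rw [h1 k]

/-- A constant change of frame also transforms the second derivatives, so both operators agree on a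
frame, which at time `0` spans the vertical space. -/
theorem IsCurvatureOperator.unique (hK : SmoothNear K z) {R R' : E n →ₗ[ℝ] E n}
    (h : IsCurvatureOperator K z R) (h' : IsCurvatureOperator K z R') : R = R' := by
  obtain ⟨e, he, hR⟩ := h
  obtain ⟨e', he', hR'⟩ := h'
  obtain ⟨O, hO⟩ := he.exists_matrix hK he'
  have hv : ∀ {e : Fin n → ℝ → E n × E n}, IsCanonicalFrame K z e → ∀ i, (e i 0).1 = 0 :=
    fun he i => by
      have := he.eventually.self_of_nhds.1 i
      rwa [jacobiCurve_zero hK, mem_vertical] at this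
  have h2 : ∀ i, R (e' i 0).2 = R' (e' i 0).2 := by
    intro i
    have d1 : ∀ᶠ t in 𝓝 (0 : ℝ), HasDerivAt (e' i) (∑ k, O i k • deriv (e k) t) t := by
      filter_upwards [(hO i).eventually_nhds, he.eventually] with t h1 h2
      exact (HasDerivAt.fun_sum fun k _ => (h2.2.2.2.1 k).const_smul (O i k)).congr_of_eventuallyEq h1
    have d2 : HasDerivAt (deriv (e' i)) (∑ k, O i k • deriv (deriv (e k)) 0) 0 :=
      (HasDerivAt.fun_sum fun k _ =>
        (he.eventually.self_of_nhds.2.2.2.2 k).const_smul (O i k)).congr_of_eventuallyEq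
          (d1.mono fun t ht => ht.deriv)
    have h3 := hR' i
    rw [d2.deriv] at h3
    have h4 := congrArg Prod.snd h3
    have h5 : ∀ k, R (e k 0).2 = (-deriv (deriv (e k)) 0).2 := fun k => congrArg Prod.snd (hR k)
    rw [(hO i).self_of_nhds] at h4 ⊢
    simp only [Prod.snd_sum, Prod.smul_snd, map_sum, map_smul, h5, Prod.snd_neg, smul_neg,
      Finset.sum_neg_distrib] at h4 ⊢
    exact h4.symm
  ext1 w
  have hJ := jacobiCurve_lagrangian hK
  have hw : ((0 : E n), w) ∈ jacobiCurve K z 0 := by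
    rw [jacobiCurve_zero hK, mem_vertical]
  have h6 := congrArg Prod.snd (eq_sum_symp hJ.self_of_nhds.2 he'.eventually.self_of_nhds.1
    he'.eventually.self_of_nhds.2.2.1 hw)
  simp only [Prod.snd_sum, Prod.smul_snd] at h6
  rw [h6]
  simp only [map_sum, map_smul, h2]

theorem exists_orthonormal_family {B : LinearMap.BilinForm ℝ (E n)} (hs : ∀ v w, B v w = B w v)
    (hp : ∀ v, v ≠ 0 → 0 < B v v) :
    ∃ w : Fin n → E n, ∀ i j, B (w i) (w j) = if i = j then 1 else 0 := by
  obtain ⟨b, hb⟩ := LinearMap.BilinForm.exists_orthogonal_basis (B := B)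
    ⟨fun v w => by simpa using hs v w⟩
  have hn : Module.finrank ℝ (E n) = n := by simp
  let b' := b.reindex (finCongr hn)
  have hb' : ∀ i j, i ≠ j → B (b' i) (b' j) = 0 := fun i j hij => by
    simp only [b', Module.Basis.reindex_apply]
    exact hb ((finCongr hn).symm.injective.ne hij)
  refine ⟨fun i => (√(B (b' i) (b' i)))⁻¹ • b' i, fun i j => ?_⟩
  have hpos := hp _ (b'.ne_zero i)
  split_ifs with h
  · subst h
    have h1 : √(B (b' i) (b' i)) ≠ 0 := (Real.sqrt_pos.2 hpos).ne'
    simp only [map_smul, LinearMap.smul_apply, smul_eq_mul]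
    field_simp
    exact (Real.sq_sqrt hpos.le).symm
  · simp [hb' i j h]

/-- A linear family of smooth curves in the Jacobi curve, with second derivatives in the Jacobi
curve. -/
structure IsJacobiFamily (K : E n × E n → ℝ) (z : E n × E n)
    (Γ Γ' Γ'' : ℝ → E n →L[ℝ] E n × E n) : Prop where
  smoothNear : SmoothNear Γ 0
  hasDerivAt : ∀ᶠ t in 𝓝 (0 : ℝ), HasDerivAt Γ (Γ' t) t
  hasDerivAt' : ∀ᶠ t in 𝓝 (0 : ℝ), HasDerivAt Γ' (Γ'' t) t
  mem : ∀ᶠ t in 𝓝 (0 : ℝ), ∀ w, Γ t w ∈ jacobiCurve K z t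
  mem'' : ∀ᶠ t in 𝓝 (0 : ℝ), ∀ w, Γ'' t w ∈ jacobiCurve K z t

namespace IsJacobiFamily

variable {Γ Γ' Γ'' : ℝ → E n →L[ℝ] E n × E n} (hΓ : IsJacobiFamily K z Γ Γ' Γ'')
include hΓ

theorem hasDerivAt_apply (w : E n) :
    ∀ᶠ t in 𝓝 (0 : ℝ), HasDerivAt (fun s => Γ s w) (Γ' t w) t := by
  filter_upwards [hΓ.hasDerivAt] with t ht
  simpa using ht.clm_apply (hasDerivAt_const t w)

theorem hasDerivAt_apply' (w : E n) :
    ∀ᶠ t in 𝓝 (0 : ℝ), HasDerivAt (fun s => Γ' s w) (Γ'' t w) t := by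
  filter_upwards [hΓ.hasDerivAt'] with t ht
  simpa using ht.clm_apply (hasDerivAt_const t w)

theorem symp_symm (hK : SmoothNear K z) (v w : E n) :
    ∀ᶠ t in 𝓝 (0 : ℝ), symp (Γ' t v) (Γ t w) = symp (Γ' t w) (Γ t v) := by
  have h0 : ∀ᶠ t in 𝓝 (0 : ℝ), symp (Γ t v) (Γ t w) = 0 := by
    filter_upwards [jacobiCurve_lagrangian hK, hΓ.mem] with t h1 h2
    exact h1.1 _ (h2 v) _ (h2 w)
  filter_upwards [h0.eventually_nhds, hΓ.hasDerivAt_apply v, hΓ.hasDerivAt_apply w] with t h1 h2 h3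
  have h4 := (h2.symp h3).unique ((hasDerivAt_const t (0 : ℝ)).congr_of_eventuallyEq h1)
  rw [symp_swap (Γ t v)] at h4
  linarith

/-- The Gram form of the family is a constant of motion: differentiate the symmetry relation; the
second derivatives lie in a Lagrangian subspace, and antisymmetry kills `symp (Γ' v) (Γ' w)`.
Orthonormality at time `0` therefore persists. -/
theorem symp_const (hK : SmoothNear K z) (v w : E n) :
    ∀ᶠ t in 𝓝 (0 : ℝ), symp (Γ' t v) (Γ t w) = symp (Γ' 0 v) (Γ 0 w) := by
  refine eventually_eq_of_hasDerivAt_zero (f := fun t => symp (Γ' t v) (Γ t w)) ?_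
  filter_upwards [(hΓ.symp_symm hK v w).eventually_nhds, jacobiCurve_lagrangian hK, hΓ.mem,
    hΓ.mem'', hΓ.hasDerivAt_apply v, hΓ.hasDerivAt_apply w, hΓ.hasDerivAt_apply' v,
    hΓ.hasDerivAt_apply' w] with t h1 h2 h3 h4 h5 h6 h7 h8
  have d1 := h7.symp h6
  have d2 := h8.symp h5
  rw [h2.1 _ (h4 v) _ (h3 w), zero_add] at d1
  rw [h2.1 _ (h4 w) _ (h3 v), zero_add] at d2
  have h9 := d1.unique (d2.congr_of_eventuallyEq h1)
  rw [symp_swap (Γ' t w)] at h9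
  have h10 : symp (Γ' t v) (Γ' t w) = 0 := by linarith
  rwa [h10] at d1

/-- A positive family determines the curvature operator. -/
theorem isCurvatureOperator (hK : SmoothNear K z)
    (hp : ∀ w, w ≠ 0 → 0 < symp (Γ' 0 w) (Γ 0 w)) {R : E n →ₗ[ℝ] E n}
    (hR : ∀ w, ((0 : E n), R (Γ 0 w).2) = -Γ'' 0 w) : IsCurvatureOperator K z R := by
  -- Vectors orthonormal for the Gram form at time `0`; their images under the family are the
  -- canonical frame.
  obtain ⟨w, hw⟩ := exists_orthonormal_family
    (B := (sympBilin n).compl₁₂ (Γ' 0).toLinearMap (Γ 0).toLinearMap)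
    (fun v w => (hΓ.symp_symm hK v w).self_of_nhds) hp
  have hw' : ∀ i j, symp (Γ' 0 (w i)) (Γ 0 (w j)) = if i = j then 1 else 0 := hw
  have hderiv : ∀ i, ∀ᶠ t in 𝓝 (0 : ℝ), deriv (fun s => Γ s (w i)) t = Γ' t (w i) := fun i =>
    (hΓ.hasDerivAt_apply (w i)).mono fun t ht => ht.deriv
  have hderiv' : ∀ i, ∀ᶠ t in 𝓝 (0 : ℝ),
      deriv (deriv (fun s => Γ s (w i))) t = Γ'' t (w i) := fun i => by
    filter_upwards [(hderiv i).eventually_nhds, hΓ.hasDerivAt_apply' (w i)] with t h1 h2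
    rw [EventuallyEq.deriv_eq h1, h2.deriv]
  refine ⟨fun i t => Γ t (w i), ?_, fun i => ?_⟩
  · obtain ⟨ε, hε, h⟩ := eventually_zero_iff_Ioo.1 (hΓ.smoothNear.and (hΓ.mem.and (hΓ.mem''.and
      ((eventually_all.2 fun i => eventually_all.2 fun j => hΓ.symp_const hK (w i) (w j)).and
      ((eventually_all.2 hderiv).and (eventually_all.2 hderiv'))))))
    refine ⟨ε, hε, fun i t ht => ?_, fun t ht i => ?_⟩
    · exact ((h t ht).1.clm_apply contDiffAt_const).contDiffWithinAt
    · obtain ⟨h1, h2, h3, h4, h5, h6⟩ := h t ht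
      refine ⟨h2 _, ?_, fun j => ?_⟩
      · rw [h6]
        exact h3 _
      · rw [h5, h4, hw']
  · rw [(hderiv' i).self_of_nhds]
    exact hR _

end IsJacobiFamily

end JacobiCurve

/-! ### Positive homogeneity in the fibres and Euler's identity -/

section Homogeneous

variable {n : ℕ} {U : Set (E n)}

/-- Positive homogeneity of degree `k` in the fibre variable, off the zero section. -/
def HomogOn (U : Set (E n)) (k : ℤ) (φ : E n × E n → ℝ) : Prop :=
  ∀ y ∈ U, ∀ v, v ≠ 0 → ∀ c : ℝ, 0 < c → φ (y, c • v) = c ^ k * φ (y, v)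

/-- Scaling of the fibres by `c`. -/
noncomputable def fibScale (n : ℕ) {c : ℝ} (hc : c ≠ 0) : (E n × E n) ≃L[ℝ] (E n × E n) :=
  (ContinuousLinearEquiv.refl ℝ (E n)).prodCongr
    (ContinuousLinearEquiv.smulLeft (Units.mk0 c hc))

theorem eventually_mem_slit (hU : IsOpen U) {y v : E n} (hy : y ∈ U) (hv : v ≠ 0) :
    ∀ᶠ z in 𝓝 (y, v), z.1 ∈ U ∧ z.2 ≠ 0 :=
  (continuousAt_fst.eventually_mem (hU.mem_nhds hy)).and
    (continuousAt_snd.eventually_ne hv)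

/-- Differentiate `φ ∘ fibScale = c ^ k • φ`. A fibre derivative loses one degree and a base
derivative keeps it, according to the component of `w` that is scaled. -/
theorem HomogOn.fderiv_fibScale {k : ℤ} {φ : E n × E n → ℝ} (hU : IsOpen U)
    (hφ : HomogOn U k φ) {y v : E n} (hy : y ∈ U) (hv : v ≠ 0) {c : ℝ} (hc : 0 < c)
    (w : E n × E n) :
    fderiv ℝ φ (y, c • v) (w.1, c • w.2) = c ^ k * fderiv ℝ φ (y, v) w := by
  have h1 : (φ ∘ fibScale n hc.ne') =ᶠ[𝓝 (y, v)] (c ^ k • φ) := by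
    filter_upwards [eventually_mem_slit hU hy hv] with z hz
    exact hφ z.1 hz.1 z.2 hz.2 c hc
  have h2 := h1.fderiv_eq (𝕜 := ℝ)
  rw [ContinuousLinearEquiv.comp_right_fderiv, fderiv_const_smul_field] at h2
  exact congrArg (fun A => A w) h2

theorem HomogOn.dFib {k : ℤ} {φ : E n × E n → ℝ} (hU : IsOpen U) (hφ : HomogOn U k φ)
    (i : Fin n) : HomogOn U (k - 1) (dFib i φ) := by
  intro y hy v hv c hc
  have h := hφ.fderiv_fibScale hU hy hv hc (0, EuclideanSpace.single i 1)
  have h2 : ((0 : E n), c • EuclideanSpace.single i (1 : ℝ)) =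
      c • ((0 : E n), EuclideanSpace.single i (1 : ℝ)) := by simp
  simp only [h2, map_smul, smul_eq_mul] at h
  simp only [FinslerHamiltonian.dFib]
  rw [zpow_sub_one₀ hc.ne']
  field_simp
  linarith

theorem HomogOn.dBase {k : ℤ} {φ : E n × E n → ℝ} (hU : IsOpen U) (hφ : HomogOn U k φ)
    (i : Fin n) : HomogOn U k (dBase i φ) := by
  intro y hy v hv c hc
  have h := hφ.fderiv_fibScale hU hy hv hc (EuclideanSpace.single i 1, 0)
  simpa [FinslerHamiltonian.dBase] using h

theorem HomogOn.euler {k : ℤ} {φ : E n × E n → ℝ} (hφ : HomogOn U k φ) {y v : E n} (hy : y ∈ U)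
    (hv : v ≠ 0) (hd : DifferentiableAt ℝ φ (y, v)) : fderiv ℝ φ (y, v) (0, v) = k * φ (y, v) := by
  have h1 : HasDerivAt (fun c : ℝ => ((y, c • v) : E n × E n)) (0, v) 1 := by
    simpa using (hasDerivAt_const (1 : ℝ) y).prodMk ((hasDerivAt_id (1 : ℝ)).smul_const v)
  have hd' : HasFDerivAt φ (fderiv ℝ φ (y, v)) ((y, (1 : ℝ) • v) : E n × E n) := by
    simpa using hd.hasFDerivAt
  have h2 : HasDerivAt (fun c : ℝ => φ (y, c • v)) (fderiv ℝ φ (y, v) (0, v)) 1 :=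
    hd'.comp_hasDerivAt 1 h1
  have h3 : HasDerivAt (fun c : ℝ => c ^ k * φ (y, v)) (k * φ (y, v)) 1 := by
    simpa using (hasDerivAt_zpow k (1 : ℝ) (Or.inl one_ne_zero)).mul_const (φ (y, v))
  refine h2.unique (h3.congr_of_eventuallyEq ?_)
  filter_upwards [lt_mem_nhds (one_pos : (0 : ℝ) < 1)] with c hc
  exact hφ y hy v hv c hc

theorem HomogOn.sum {k : ℤ} {ι : Type*} {s : Finset ι} {φ : ι → E n × E n → ℝ}
    (h : ∀ i ∈ s, HomogOn U k (φ i)) : HomogOn U k (fun z => ∑ i ∈ s, φ i z) := by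
  intro y hy v hv c hc
  rw [Finset.mul_sum]
  exact Finset.sum_congr rfl fun i hi => h i hi y hy v hv c hc

theorem HomogOn.mul {k l m : ℤ} {φ χ : E n × E n → ℝ} (hφ : HomogOn U k φ) (hχ : HomogOn U l χ)
    (hm : k + l = m) : HomogOn U m (fun z => φ z * χ z) := by
  intro y hy v hv c hc
  simp only [hφ y hy v hv c hc, hχ y hy v hv c hc, ← hm, zpow_add₀ hc.ne']
  ring

theorem HomogOn.sub {k : ℤ} {φ χ : E n × E n → ℝ} (hφ : HomogOn U k φ) (hχ : HomogOn U k χ) :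
    HomogOn U k (fun z => φ z - χ z) := by
  intro y hy v hv c hc
  simp only [hφ y hy v hv c hc, hχ y hy v hv c hc]
  ring

theorem homogOn_coord (i : Fin n) : HomogOn U 1 (fun z => z.2 i) := by
  intro y hy v hv c hc
  simp

theorem homogOn_fibHessian {φ : E n × E n → ℝ} (hU : IsOpen U) (hφ : HomogOn U 2 φ) {y v : E n}
    (hy : y ∈ U) (hv : v ≠ 0) {c : ℝ} (hc : 0 < c) :
    fibHessian φ (y, c • v) = fibHessian φ (y, v) := by
  ext i j
  have := (hφ.dFib hU j).dFib hU i y hy v hv c hc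
  simpa [fibHessian] using this

theorem homogOn_spray {φ : E n × E n → ℝ} (hU : IsOpen U) (hφ : HomogOn U 2 φ) (i : Fin n) :
    HomogOn U 2 (spray φ i) := by
  have h0 : HomogOn U 0 (fun _ => (1 / 2 : ℝ)) := fun y hy v hv c hc => by simp
  refine h0.mul (l := 2) (HomogOn.sum fun l _ => HomogOn.mul (k := 0) (l := 2) ?_ ?_ rfl) rfl
  · intro y hy v hv c hc
    simp [homogOn_fibHessian hU hφ hy hv hc]
  · exact (HomogOn.sum fun k _ => ((hφ.dFib hU l).dBase hU k).mul (homogOn_coord k) (by norm_num)).sub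
      (hφ.dBase hU l)

end Homogeneous

/-! ### Convexity of the energy and Minkowski duality in a fibre -/

section Fibre

variable {n : ℕ}

/-- The energy `f² / 2`. -/
noncomputable def energy (f : E n × E n → ℝ) (z : E n × E n) : ℝ := f z ^ 2 / 2

/-- The fibre derivative of `L`, as a vector. -/
noncomputable def fibGrad (L : E n × E n → ℝ) (z : E n × E n) : E n := WithLp.toLp 2 fun i => dFib i L z

/-- The base derivative of `L`, as a vector. -/
noncomputable def baseGrad (L : E n × E n → ℝ) (z : E n × E n) : E n := WithLp.toLp 2 fun i => dBase i L z

/-- The fibrewise Hessian of `L`, as an operator. -/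
noncomputable def fibHess (L : E n × E n → ℝ) (z : E n × E n) : E n →L[ℝ] E n :=
  fderiv ℝ (fibGrad L) z ∘L .inr ℝ (E n) (E n)

theorem inner_fibGrad (L : E n × E n → ℝ) (z : E n × E n) (b : E n) :
    inner ℝ (fibGrad L z) b = fderiv ℝ L z (0, b) := by
  simp [fderiv_eq_sum, fibGrad, PiLp.inner_apply]

theorem inner_baseGrad (L : E n × E n → ℝ) (z : E n × E n) (b : E n) :
    inner ℝ (baseGrad L z) b = fderiv ℝ L z (b, 0) := by
  simp [fderiv_eq_sum, baseGrad, PiLp.inner_apply]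

theorem SmoothNear.fibGrad {L : E n × E n → ℝ} {z : E n × E n} (hL : SmoothNear L z) :
    SmoothNear (fibGrad L) z :=
  smoothNear_toLp fun i => hL.dFib i

theorem SmoothNear.baseGrad {L : E n × E n → ℝ} {z : E n × E n} (hL : SmoothNear L z) :
    SmoothNear (baseGrad L) z :=
  smoothNear_toLp fun i => hL.dBase i

theorem fderiv_toLp_apply {V : Type*} [NormedAddCommGroup V] [NormedSpace ℝ V]
    {f : V → Fin n → ℝ} {z : V} (hf : ∀ i, DifferentiableAt ℝ (fun y => f y i) z) (w : V)
    (i : Fin n) :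
    fderiv ℝ (fun y => (WithLp.toLp 2 (f y) : E n)) z w i = fderiv ℝ (fun y => f y i) z w := by
  have h : DifferentiableAt ℝ (fun y => (WithLp.toLp 2 (f y) : E n)) z :=
    (differentiableAt_piLp 2).2 hf
  have h2 : HasFDerivAt (fun y => f y i)
      ((EuclideanSpace.proj i : E n →L[ℝ] ℝ).comp _) z :=
    (EuclideanSpace.proj i : E n →L[ℝ] ℝ).hasFDerivAt.comp z h.hasFDerivAt
  rw [h2.fderiv]
  rfl

theorem fderiv_fibGrad_apply {L : E n × E n → ℝ} {z : E n × E n} (hL : SmoothNear L z)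
    (w : E n × E n) (i : Fin n) :
    fderiv ℝ (fibGrad L) z w i = fderiv ℝ (dFib i L) z w :=
  fderiv_toLp_apply (fun i => (hL.dFib i).differentiableAt) w i

theorem fibHess_apply {L : E n × E n → ℝ} {z : E n × E n} (hL : SmoothNear L z)
    (b : E n) (i : Fin n) : fibHess L z b i = ∑ j, b j * fibHessian L z j i := by
  simp only [fibHess, ContinuousLinearMap.comp_apply, ContinuousLinearMap.inr_apply]
  rw [fderiv_fibGrad_apply hL, fderiv_eq_sum]
  simp [fibHessian]

theorem inner_fibHess {L : E n × E n → ℝ} {z : E n × E n} (hL : SmoothNear L z)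
    (a b : E n) : inner ℝ (fibHess L z a) b = fderiv ℝ (fderiv ℝ L) z (0, a) (0, b) := by
  have h1 : HasFDerivAt (fun y => inner ℝ (fibGrad L y) b) _ z :=
    hL.fibGrad.differentiableAt.hasFDerivAt.inner ℝ (hasFDerivAt_const b z)
  have h2 : HasFDerivAt (fun y => inner ℝ (fibGrad L y) b) _ z :=
    (hL.fderiv.differentiableAt.hasFDerivAt.clm_apply
      (hasFDerivAt_const ((0 : E n), b) z)).congr_of_eventuallyEq
        (Eventually.of_forall fun y => inner_fibGrad L y b)
  have := congrArg (fun A => A (0, a)) (h1.unique h2)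
  simpa [fibHess] using this

theorem inner_fibHess_comm {L : E n × E n → ℝ} {z : E n × E n} (hL : SmoothNear L z)
    (a b : E n) : inner ℝ (fibHess L z a) b = inner ℝ (fibHess L z b) a := by
  rw [inner_fibHess hL, inner_fibHess hL]
  exact hL.isSymmSndFDerivAt _ _

theorem fibHessian_symm {L : E n × E n → ℝ} {z : E n × E n} (hL : SmoothNear L z) (i j : Fin n) :
    fibHessian L z i j = fibHessian L z j i := by
  have h : ∀ i j, fibHessian L z i j =
      fderiv ℝ (fderiv ℝ L) z (0, EuclideanSpace.single i 1) (0, EuclideanSpace.single j 1) := by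
    intro i j
    have h2 : HasFDerivAt (dFib j L) _ z :=
      hL.fderiv.differentiableAt.hasFDerivAt.clm_apply
        (hasFDerivAt_const ((0 : E n), EuclideanSpace.single j (1 : ℝ)) z)
    simp only [fibHessian, Matrix.of_apply]
    rw [dFib, h2.fderiv]
    simp
  rw [h, h]
  exact hL.isSymmSndFDerivAt _ _

/-- A Finsler structure on an open subset of `ℝⁿ`. -/
structure ChartFinsler (U : Set (E n)) (f : E n × E n → ℝ) : Prop where
  isOpen : IsOpen U
  nonneg : ∀ y ∈ U, ∀ v, 0 ≤ f (y, v)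
  smooth : ∀ y ∈ U, ∀ v, v ≠ 0 → ContDiffAt ℝ ∞ f (y, v)
  homogeneous : ∀ y ∈ U, ∀ v, ∀ c : ℝ, 0 < c → f (y, c • v) = c * f (y, v)
  posDef : ∀ y ∈ U, ∀ v, v ≠ 0 → (fibHessian (energy f) (y, v)).PosDef

namespace ChartFinsler

variable {U : Set (E n)} {f : E n × E n → ℝ} (hf : ChartFinsler U f) {y v w p : E n}
include hf

theorem smoothNear (hy : y ∈ U) (hv : v ≠ 0) : SmoothNear f (y, v) :=
  (eventually_mem_slit hf.isOpen hy hv).mono fun z hz => hf.smooth z.1 hz.1 z.2 hz.2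

theorem smoothNear_energy (hy : y ∈ U) (hv : v ≠ 0) : SmoothNear (energy f) (y, v) :=
  (hf.smoothNear hy hv).mono fun _ hz => (hz.pow 2).div_const 2

theorem homogOn_energy : HomogOn U 2 (energy f) := by
  intro y hy v _ c hc
  simp only [energy, hf.homogeneous y hy v c hc]
  norm_cast
  ring

theorem apply_zero (hy : y ∈ U) : f (y, 0) = 0 := by
  have := hf.homogeneous y hy 0 2 two_pos
  rw [smul_zero] at this
  linarith

theorem inner_fibGrad_self (hy : y ∈ U) (hv : v ≠ 0) :
    inner ℝ (fibGrad (energy f) (y, v)) v = f (y, v) ^ 2 := by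
  rw [inner_fibGrad, hf.homogOn_energy.euler hy hv (hf.smoothNear_energy hy hv).differentiableAt]
  simp only [energy]
  norm_num
  ring

theorem fibGrad_smul (hy : y ∈ U) (hv : v ≠ 0) {c : ℝ} (hc : 0 < c) :
    fibGrad (energy f) (y, c • v) = c • fibGrad (energy f) (y, v) := by
  ext i
  have := hf.homogOn_energy.dFib hf.isOpen i y hy v hv c hc
  norm_num at this
  simpa [fibGrad] using this

/-- Euler's identity for the fibre gradient, which is homogeneous of degree one. -/
theorem fibHess_self (hy : y ∈ U) (hv : v ≠ 0) :
    fibHess (energy f) (y, v) v = fibGrad (energy f) (y, v) := by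
  ext i
  have hL := hf.smoothNear_energy hy hv
  simp only [fibHess, ContinuousLinearMap.comp_apply, ContinuousLinearMap.inr_apply]
  rw [fderiv_fibGrad_apply hL, (hf.homogOn_energy.dFib hf.isOpen i).euler hy hv
    (hL.dFib i).differentiableAt]
  norm_num [fibGrad]

theorem fibHess_pos (hy : y ∈ U) (hv : v ≠ 0) (hw : w ≠ 0) :
    0 < inner ℝ (fibHess (energy f) (y, v) w) w := by
  have h := (hf.posDef y hy v hv).dotProduct_mulVec_pos (x := w.ofLp) (by simpa using hw)
  have h2 : inner ℝ (fibHess (energy f) (y, v) w) w =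
      star w.ofLp ⬝ᵥ (fibHessian (energy f) (y, v)).mulVec w.ofLp := by
    simp only [PiLp.inner_apply, fibHess_apply (hf.smoothNear_energy hy hv), Real.inner_apply,
      star_trivial, dotProduct, Matrix.mulVec]
    refine Finset.sum_congr rfl fun i _ => ?_
    rw [mul_comm]
    congr 1
    refine Finset.sum_congr rfl fun j _ => ?_
    rw [fibHessian_symm (hf.smoothNear_energy hy hv), mul_comm]
  rwa [h2]

/-- Positivity off the zero section comes from strong convexity, since `g_v(v, v) = F(v)²`. -/
theorem pos (hy : y ∈ U) (hv : v ≠ 0) : 0 < f (y, v) := by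
  have h := hf.fibHess_pos hy hv hv
  rw [hf.fibHess_self hy hv, hf.inner_fibGrad_self hy hv] at h
  exact lt_of_le_of_ne (hf.nonneg y hy v) fun h0 => by simp [← h0] at h

theorem fibGrad_ne_zero (hy : y ∈ U) (hv : v ≠ 0) : fibGrad (energy f) (y, v) ≠ 0 := by
  intro h
  have h1 := hf.inner_fibGrad_self hy hv
  rw [h, inner_zero_left] at h1
  exact (pow_pos (hf.pos hy hv) 2).ne h1

/-- Strict convexity of the energy in the fibres. -/
theorem energy_lt (hy : y ∈ U) (hv : v ≠ 0) (hwv : w ≠ v) :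
    energy f (y, v) + inner ℝ (fibGrad (energy f) (y, v)) (w - v) < energy f (y, w) := by
  set L := energy f
  set d := w - v
  have hd : d ≠ 0 := sub_ne_zero.2 hwv
  -- The energy is smooth only off the zero section, so a segment through the origin is treated
  -- apart. In that case `d = -t⁻¹ v` with `t⁻¹ ≥ 1`, and the left side is at most `-F(v)² / 2`.
  by_cases hz : ∃ t ∈ Icc (0 : ℝ) 1, v + t • d = 0
  · obtain ⟨t, ht, h0⟩ := hz
    have ht0 : 0 < t := lt_of_le_of_ne ht.1 fun h => hv (by simpa [← h] using h0)
    have hd' : d = -(t⁻¹ • v) := by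
      have : t • d = -v := by rw [eq_neg_iff_add_eq_zero, add_comm]; exact h0
      rw [← smul_neg, ← this, smul_smul, inv_mul_cancel₀ ht0.ne', one_smul]
    rw [hd', inner_neg_right, inner_smul_right, hf.inner_fibGrad_self hy hv]
    have h1 : 1 ≤ t⁻¹ := (one_le_inv₀ ht0).2 ht.2
    have h2 := pow_pos (hf.pos hy hv) 2
    have h3 : 0 ≤ L (y, w) := by simp only [L, energy]; positivity
    have h4 : L (y, v) = f (y, v) ^ 2 / 2 := rfl
    nlinarith
  · push Not at hz
    have hγ : ∀ t, HasDerivAt (fun t : ℝ => ((y, v + t • d) : E n × E n)) (0, d) t := fun t =>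
      (hasDerivAt_const t y).prodMk
        (by simpa using ((hasDerivAt_id t).smul_const d).const_add v)
    have h1 : ∀ t ∈ Icc (0 : ℝ) 1, HasDerivAt (fun t : ℝ => L (y, v + t • d))
        (inner ℝ (fibGrad L (y, v + t • d)) d) t := fun t ht => by
      rw [inner_fibGrad]
      exact (hf.smoothNear_energy hy (hz t ht)).differentiableAt.hasFDerivAt.comp_hasDerivAt t (hγ t)
    have h2 : ∀ t ∈ Icc (0 : ℝ) 1, HasDerivAt (fun t : ℝ => inner ℝ (fibGrad L (y, v + t • d)) d)
        (inner ℝ (fibHess L (y, v + t • d) d) d) t := fun t ht => by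
      have h3 : HasDerivAt (fun t : ℝ => fibGrad L (y, v + t • d)) (fibHess L (y, v + t • d) d) t :=
        HasFDerivAt.comp_hasDerivAt (l := fibGrad L) t
          (hf.smoothNear_energy hy (hz t ht)).fibGrad.differentiableAt.hasFDerivAt (hγ t)
      simpa using h3.inner ℝ (hasDerivAt_const t d)
    -- The mean value theorem twice: for the energy on `[0, 1]`, then for its derivative on `[0,
    -- s]`.
    obtain ⟨s, hs, hs'⟩ := exists_hasDerivAt_eq_slope _ _ (zero_lt_one' ℝ)
      (fun t ht => (h1 t ht).continuousAt.continuousWithinAt)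
      (fun t ht => h1 t (Ioo_subset_Icc_self ht))
    obtain ⟨r, hr, hr'⟩ := exists_hasDerivAt_eq_slope _ _ hs.1
      (fun t ht => (h2 t ⟨ht.1, ht.2.trans hs.2.le⟩).continuousAt.continuousWithinAt)
      (fun t ht => h2 t ⟨ht.1.le, ht.2.le.trans hs.2.le⟩)
    have hpos := hf.fibHess_pos hy (hz r ⟨hr.1.le, hr.2.le.trans hs.2.le⟩) hd
    rw [hr', sub_zero] at hpos
    have h3 := (div_pos_iff_of_pos_right hs.1).1 hpos
    have h4 : v + (1 : ℝ) • d = w := by simp [d]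
    rw [hs', h4] at h3
    simp only [zero_smul, add_zero, sub_zero, div_one] at h3
    linarith

theorem energy_le (hy : y ∈ U) (hv : v ≠ 0) (w : E n) :
    energy f (y, v) + inner ℝ (fibGrad (energy f) (y, v)) (w - v) ≤ energy f (y, w) := by
  rcases eq_or_ne w v with rfl | h
  · simp
  · exact (hf.energy_lt hy hv h).le

/-- The fundamental inequality of Minkowski norms. -/
theorem inner_fibGrad_le (hy : y ∈ U) (hv : v ≠ 0) (w : E n) :
    inner ℝ (fibGrad (energy f) (y, v)) w ≤ f (y, v) * f (y, w) := by
  rcases eq_or_ne w 0 with rfl | hw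
  · simp [hf.apply_zero hy]
  have h1 := hf.pos hy hv
  have h2 := hf.pos hy hw
  -- Rescaling `w` to the norm of `v` makes the energies equal, and convexity becomes the
  -- fundamental inequality.
  have h := hf.energy_le hy hv ((f (y, v) / f (y, w)) • w)
  rw [inner_sub_right, hf.inner_fibGrad_self hy hv, inner_smul_right] at h
  simp only [energy, hf.homogeneous y hy w _ (div_pos h1 h2), div_mul_cancel₀ _ h2.ne'] at h
  have h3 : f (y, v) / f (y, w) * inner ℝ (fibGrad (energy f) (y, v)) w ≤ f (y, v) ^ 2 := by
    linarith
  have h4 : f (y, v) * inner ℝ (fibGrad (energy f) (y, v)) w ≤ f (y, v) * (f (y, v) * f (y, w)) := by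
    rw [div_mul_eq_mul_div, div_le_iff₀ h2] at h3
    linarith
  exact le_of_mul_le_mul_left h4 h1

/-- Maximize `p / F` over the unit sphere; by homogeneity the maximizer `v` is maximal among all
nonzero vectors. The maximum `q` is positive, as testing on `p` itself shows. The function `q F - p`
has a minimum at `v`, so `p = q dF(v)`, and scaling `v` by `q / F(v)` makes the gradient of the
energy equal to `p`. -/
theorem exists_fibGrad_eq (hy : y ∈ U) (hp : p ≠ 0) :
    ∃ v, v ≠ 0 ∧ fibGrad (energy f) (y, v) = p := by
  have hne : ∀ v ∈ Metric.sphere (0 : E n) 1, v ≠ 0 := fun v hv h => by simp [h] at hv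
  have hp' : 0 < ‖p‖ := norm_pos_iff.2 hp
  have hp1 : ‖p‖⁻¹ • p ∈ Metric.sphere (0 : E n) 1 := by
    simp [norm_smul, hp'.ne']
  have hc : ContinuousOn (fun v => inner ℝ p v / f (y, v)) (Metric.sphere (0 : E n) 1) :=
    fun v hv => ContinuousAt.continuousWithinAt <|
      (continuousAt_const.inner continuousAt_id).div
        (ContinuousAt.comp (f := fun v => (y, v)) (hf.smooth y hy v (hne v hv)).continuousAt
          (continuousAt_const.prodMk continuousAt_id)) (hf.pos hy (hne v hv)).ne'
  obtain ⟨v, hv, hmax⟩ := (isCompact_sphere (0 : E n) 1).exists_isMaxOn ⟨_, hp1⟩ hc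
  have hv0 := hne v hv
  have hfv := hf.pos hy hv0
  set q := inner ℝ p v / f (y, v)
  have hq : 0 < q := by
    have h1 : inner ℝ p (‖p‖⁻¹ • p) / f (y, ‖p‖⁻¹ • p) ≤ q := hmax hp1
    refine lt_of_lt_of_le (div_pos ?_ (hf.pos hy (hne _ hp1))) h1
    rw [inner_smul_right, real_inner_self_eq_norm_sq]
    positivity
  have hle : ∀ w, w ≠ 0 → inner ℝ p w ≤ q * f (y, w) := by
    intro w hw
    have hw' : 0 < ‖w‖ := norm_pos_iff.2 hw
    have h1 : ‖w‖⁻¹ • w ∈ Metric.sphere (0 : E n) 1 := by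
      simp [norm_smul, hw'.ne']
    have h2 : inner ℝ p (‖w‖⁻¹ • w) / f (y, ‖w‖⁻¹ • w) ≤ q := hmax h1
    rw [inner_smul_right, hf.homogeneous y hy w _ (inv_pos.2 hw'),
      mul_div_mul_left _ _ (inv_pos.2 hw').ne', div_le_iff₀ (hf.pos hy hw)] at h2
    exact h2
  have hinr : HasFDerivAt (fun w : E n => (y, w)) (.inr ℝ (E n) (E n)) v :=
    hasFDerivAt_prodMk_right y v
  have hfd : HasFDerivAt (fun w => f (y, w)) _ v :=
    ((hf.smooth y hy v hv0).differentiableAt (by simp)).hasFDerivAt.comp v hinr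
  have hd : HasFDerivAt (fun w => q * f (y, w) - inner ℝ p w) _ v :=
    (hfd.const_mul q).sub (innerSL ℝ p).hasFDerivAt
  have hmin : IsLocalMin (fun w => q * f (y, w) - inner ℝ p w) v := by
    filter_upwards [isOpen_ne.mem_nhds hv0] with w hw
    have h1 : q * f (y, v) = inner ℝ p v := div_mul_cancel₀ _ hfv.ne'
    have := hle w hw
    linarith
  have h0 := hmin.hasFDerivAt_eq_zero hd
  have hgrad : ∀ b, inner ℝ (fibGrad (energy f) (y, v)) b =
      f (y, v) * fderiv ℝ f (y, v) (0, b) := by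
    intro b
    rw [inner_fibGrad]
    have : HasFDerivAt (fun z => f z ^ 2 * (1 / 2)) _ (y, v) :=
      (((hf.smooth y hy v hv0).differentiableAt (by simp)).hasFDerivAt.pow 2).mul_const (1 / 2)
    rw [show energy f = fun z => f z ^ 2 * (1 / 2) by ext z; simp [energy]; ring, this.fderiv]
    simp
    ring
  refine ⟨(q / f (y, v)) • v, smul_ne_zero (div_pos hq hfv).ne' hv0, ?_⟩
  rw [hf.fibGrad_smul hy hv0 (div_pos hq hfv)]
  refine ext_inner_right ℝ fun b => ?_
  rw [inner_smul_left, hgrad]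
  have h1 := congrArg (fun A => A b) h0
  simp only [sub_apply, smul_apply,
    ContinuousLinearMap.comp_apply, ContinuousLinearMap.inr_apply, innerSL_apply_apply,
    zero_apply, smul_eq_mul] at h1
  simp only [conj_trivial]
  field_simp
  linarith

theorem iSup_fibGrad (hy : y ∈ U) (hv : v ≠ 0) :
    ⨆ w : E n, (inner ℝ (fibGrad (energy f) (y, v)) w - energy f (y, w)) = energy f (y, v) := by
  have h1 : ∀ w, inner ℝ (fibGrad (energy f) (y, v)) w - energy f (y, w) ≤ energy f (y, v) := by
    intro w
    have h := hf.energy_le hy hv w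
    rw [inner_sub_right, hf.inner_fibGrad_self hy hv] at h
    simp only [energy] at h ⊢
    linarith
  refine le_antisymm (ciSup_le h1) ?_
  refine le_ciSup_of_le ⟨_, forall_mem_range.2 h1⟩ v ?_
  rw [hf.inner_fibGrad_self hy hv]
  simp only [energy]
  linarith

/-- The dual norm, evaluated at the Legendre transform of `v`. -/
theorem sSup_fibGrad (hy : y ∈ U) (hv : v ≠ 0) :
    sSup ((fun w => inner ℝ (fibGrad (energy f) (y, v)) w) '' {w | f (y, w) ≤ 1}) = f (y, v) := by
  have hfv := hf.pos hy hv
  refine IsGreatest.csSup_eq ⟨⟨(f (y, v))⁻¹ • v, ?_, ?_⟩, ?_⟩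
  · simp only [mem_ofPred_eq]
    rw [hf.homogeneous y hy v _ (inv_pos.2 hfv), inv_mul_cancel₀ hfv.ne']
  · simp only [inner_smul_right, hf.inner_fibGrad_self hy hv]
    field_simp
  · rintro _ ⟨w, hw, rfl⟩
    exact (hf.inner_fibGrad_le hy hv w).trans (mul_le_of_le_one_right hfv.le hw)

end ChartFinsler

end Fibre

/-! ### The Legendre map, the geodesic spray and the Hamiltonian vector field -/

section Legendre

variable {n : ℕ}

/-- The Legendre map `(x, v) ↦ (x, L_v(x, v))`. -/
noncomputable def legendreMap (L : E n × E n → ℝ) (z : E n × E n) : E n × E n := (z.1, fibGrad L z)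

/-- The spray coefficients, as a vector. -/
noncomputable def sprayCoeff (L : E n × E n → ℝ) (z : E n × E n) : E n :=
  WithLp.toLp 2 fun i => spray L i z

/-- The geodesic spray `(v, -2 G)`. -/
noncomputable def sprayVec (L : E n × E n → ℝ) (z : E n × E n) : E n × E n :=
  (z.2, (-2 : ℝ) • sprayCoeff L z)

theorem SmoothNear.legendreMap {L : E n × E n → ℝ} {z : E n × E n} (hL : SmoothNear L z) :
    SmoothNear (legendreMap L) z :=
  (smoothNear_of_contDiff contDiff_fst z).prodMk hL.fibGrad

theorem hasFDerivAt_legendreMap {L : E n × E n → ℝ} {z : E n × E n} (hL : SmoothNear L z) :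
    HasFDerivAt (legendreMap L)
      ((ContinuousLinearMap.fst ℝ (E n) (E n)).prod (fderiv ℝ (fibGrad L) z)) z :=
  hasFDerivAt_fst.prodMk hL.fibGrad.differentiableAt.hasFDerivAt

theorem fderiv_legendreMap_fib {L : E n × E n → ℝ} {z : E n × E n} (hL : SmoothNear L z)
    (w : E n) : fderiv ℝ (legendreMap L) z (0, w) = (0, fibHess L z w) := by
  rw [(hasFDerivAt_legendreMap hL).fderiv]
  rfl

theorem fderiv_inverse_legendreMap {σ : E n × E n → E n × E n} {z : E n × E n}
    {L : E n × E n → ℝ}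
    (hL : SmoothNear L z)
    (hσ : SmoothNear σ (legendreMap L z))
    (hl : ∀ᶠ z' in 𝓝 z, σ (legendreMap L z') = z') (u : E n × E n) :
    fderiv ℝ σ (legendreMap L z) (fderiv ℝ (legendreMap L) z u) = u := by
  have h1 : HasFDerivAt (fun z' => σ (legendreMap L z')) _ z :=
    hσ.differentiableAt.hasFDerivAt.comp z hL.legendreMap.differentiableAt.hasFDerivAt
  have h2 := h1.unique ((hasFDerivAt_id z).congr_of_eventuallyEq hl)
  exact congrArg (fun A => A u) h2

namespace ChartFinsler

variable {U : Set (E n)} {f : E n × E n → ℝ} (hf : ChartFinsler U f) {y v w p : E n}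
include hf

/-- The derivative is block triangular with diagonal blocks the identity and `g`. -/
theorem fderiv_legendreMap_injective (hy : y ∈ U) (hv : v ≠ 0) :
    Function.Injective (fderiv ℝ (legendreMap (energy f)) (y, v)) := by
  have hL := hf.smoothNear_energy hy hv
  refine (injective_iff_map_eq_zero _).2 ?_
  rintro ⟨a, b⟩ h
  have ha : a = 0 := by
    rw [(hasFDerivAt_legendreMap hL).fderiv] at h
    exact congrArg Prod.fst h
  subst ha
  rw [fderiv_legendreMap_fib hL] at h
  by_contra hb
  have hb' : b ≠ 0 := fun h0 => hb (by rw [h0]; rfl)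
  have := hf.fibHess_pos hy hv hb'
  have h0 : fibHess (energy f) (y, v) b = 0 := congrArg Prod.snd h
  rw [h0, inner_zero_left] at this
  exact lt_irrefl _ this

theorem exists_hasFDerivAt_legendreMap (hy : y ∈ U) (hv : v ≠ 0) :
    ∃ A : (E n × E n) ≃L[ℝ] (E n × E n),
      HasFDerivAt (legendreMap (energy f)) (A : E n × E n →L[ℝ] E n × E n) (y, v) := by
  let A := LinearEquiv.ofInjectiveEndo (fderiv ℝ (legendreMap (energy f)) (y, v)).toLinearMap
    (hf.fderiv_legendreMap_injective hy hv)
  refine ⟨A.toContinuousLinearEquiv, ?_⟩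
  exact (hf.smoothNear_energy hy hv).legendreMap.differentiableAt.hasFDerivAt

/-- The Legendre map is a local diffeomorphism. -/
theorem exists_legendre_inverse (hy : y ∈ U) (hv : v ≠ 0) :
    ∃ σ : E n × E n → E n × E n, SmoothNear σ (legendreMap (energy f) (y, v)) ∧
      (∀ᶠ z in 𝓝 (y, v), σ (legendreMap (energy f) z) = z) ∧
      ∀ᶠ q in 𝓝 (legendreMap (energy f) (y, v)), legendreMap (energy f) (σ q) = q := by
  obtain ⟨A, hA⟩ := hf.exists_hasFDerivAt_legendreMap hy hv
  have hs := (hf.smoothNear_energy hy hv).legendreMap.contDiffAt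
  let P := hs.toOpenPartialHomeomorph (legendreMap (energy f)) hA (by simp)
  have hP : ⇑P = legendreMap (energy f) := rfl
  have hsrc : (y, v) ∈ P.source := hs.mem_toOpenPartialHomeomorph_source hA (by simp)
  have htgt : legendreMap (energy f) (y, v) ∈ P.target := P.map_source hsrc
  have hz : P.symm (legendreMap (energy f) (y, v)) = (y, v) := P.left_inv hsrc
  refine ⟨P.symm, ?_, ?_, ?_⟩
  · have hcont : ContinuousAt P.symm (legendreMap (energy f) (y, v)) :=
      P.continuousAt_symm htgt
    have hcont' := hcont
    rw [ContinuousAt, hz] at hcont'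
    -- `SmoothNear` asks for smoothness at all nearby points, so invertibility of the derivative is
    -- invoked at each of them.
    filter_upwards [P.open_target.mem_nhds htgt,
      hcont'.eventually (eventually_mem_slit hf.isOpen hy hv)] with q hq hslit
    obtain ⟨B, hB⟩ := hf.exists_hasFDerivAt_legendreMap hslit.1 hslit.2
    exact P.contDiffAt_symm hq hB (hf.smoothNear_energy hslit.1 hslit.2).legendreMap.contDiffAt
  · filter_upwards [P.open_source.mem_nhds hsrc] with z hz using P.left_inv hz
  · filter_upwards [P.open_target.mem_nhds htgt] with q hq using P.right_inv hq

/-- This is the Euler-Lagrange equation `d/dt L_v = L_x`; the spray coefficients are its solution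
for the acceleration, obtained by inverting `g`. -/
theorem fderiv_fibGrad_sprayVec (hy : y ∈ U) (hv : v ≠ 0) :
    fderiv ℝ (fibGrad (energy f)) (y, v) (sprayVec (energy f) (y, v)) =
      baseGrad (energy f) (y, v) := by
  have hL := hf.smoothNear_energy hy hv
  set L := energy f
  set z := (y, v)
  set g := fibHessian L z
  set S : Fin n → ℝ := fun l => (∑ k, dBase k (dFib l L) z * z.2 k) - dBase l L z
  have hg : g * g⁻¹ = 1 :=
    Matrix.mul_nonsing_inv _ ((Matrix.isUnit_iff_isUnit_det _).1 (hf.posDef y hy v hv).isUnit)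
  have hspray : ∀ i, 2 * spray L i z = ∑ l, g⁻¹ i l * S l := fun i => by
    simp only [spray, S, g]
    ring
  have hS : ∀ l, ∑ j, (2 * spray L j z) * g j l = S l := by
    intro l
    have h2 : g.mulVec (g⁻¹.mulVec S) = S := by rw [Matrix.mulVec_mulVec, hg, Matrix.one_mulVec]
    have h3 := congrFun h2 l
    simp only [Matrix.mulVec, dotProduct] at h3
    rw [← h3]
    refine Finset.sum_congr rfl fun j _ => ?_
    rw [hspray, mul_comm, show g j l = g l j from fibHessian_symm hL j l]
  ext l
  rw [fderiv_fibGrad_apply hL, fderiv_eq_sum]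
  have h4 : ∑ i, (sprayVec L z).2 i * dFib i (dFib l L) z = -S l := by
    rw [← hS, ← Finset.sum_neg_distrib]
    refine Finset.sum_congr rfl fun j _ => ?_
    simp only [sprayVec, sprayCoeff, PiLp.smul_apply, smul_eq_mul, g, fibHessian, Matrix.of_apply]
    ring
  rw [h4]
  simp only [S, sprayVec, baseGrad]
  rw [neg_sub, ← add_sub_assoc, sub_eq_iff_eq_add, add_comm]
  congr 1
  exact Finset.sum_congr rfl fun i _ => mul_comm _ _

theorem fderiv_legendreMap_sprayVec (hy : y ∈ U) (hv : v ≠ 0) :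
    fderiv ℝ (legendreMap (energy f)) (y, v) (sprayVec (energy f) (y, v)) =
      (v, baseGrad (energy f) (y, v)) := by
  rw [(hasFDerivAt_legendreMap (hf.smoothNear_energy hy hv)).fderiv,
    ← hf.fderiv_fibGrad_sprayVec hy hv]
  rfl

/-- The spray is the pullback of `(v, L_x)` by the Legendre map, so its smoothness follows from that
of the local inverse, without handling the inverse matrix. -/
theorem smoothNear_sprayVec (hy : y ∈ U) (hv : v ≠ 0) :
    SmoothNear (sprayVec (energy f)) (y, v) := by
  obtain ⟨σ, hσ, hl, -⟩ := hf.exists_legendre_inverse hy hv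
  have hL := hf.smoothNear_energy hy hv
  have h1 : SmoothNear (fun z : E n × E n => (z.2, baseGrad (energy f) z)) (y, v) :=
    (smoothNear_of_contDiff contDiff_snd _).prodMk hL.baseGrad
  have h2 : SmoothNear (fun z => fderiv ℝ σ (legendreMap (energy f) z)) (y, v) :=
    hσ.fderiv.comp hL.legendreMap
  have h3 : SmoothNear (fun z : E n × E n =>
      fderiv ℝ σ (legendreMap (energy f) z) (z.2, baseGrad (energy f) z)) (y, v) := by
    filter_upwards [h1, h2] with z h1 h2 using h2.clm_apply h1
  refine h3.congr ?_
  filter_upwards [eventually_mem_slit hf.isOpen hy hv, hl.eventually_nhds,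
    hL.legendreMap.continuousAt.eventually hσ.eventually] with z hz hl hσ
  have := hf.fderiv_legendreMap_sprayVec hz.1 hz.2
  rw [← this]
  exact (fderiv_inverse_legendreMap (hf.smoothNear_energy hz.1 hz.2) hσ hl _).symm

theorem smoothNear_sprayCoeff (hy : y ∈ U) (hv : v ≠ 0) :
    SmoothNear (sprayCoeff (energy f)) (y, v) := by
  have h : SmoothNear (fun z => (-1 / 2 : ℝ) • (sprayVec (energy f) z).2) (y, v) := by
    filter_upwards [hf.smoothNear_sprayVec hy hv] with z hz
    exact hz.snd.const_smul (-1 / 2 : ℝ)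
  refine h.congr (Eventually.of_forall fun z => ?_)
  simp [sprayVec, smul_smul]

theorem smoothNear_spray (hy : y ∈ U) (hv : v ≠ 0) (i : Fin n) :
    SmoothNear (spray (energy f) i) (y, v) :=
  SmoothNear.comp (g := fun w : E n => w i)
    (smoothNear_of_contDiff (EuclideanSpace.proj i : E n →L[ℝ] ℝ).contDiff _)
    (hf.smoothNear_sprayCoeff hy hv)

end ChartFinsler

/-- `K` is the Hamiltonian of the energy of `f` over `U`. -/
def IsChartHamiltonian (U : Set (E n)) (f K : E n × E n → ℝ) : Prop :=
  ∀ y ∈ U, ∀ p : E n, K (y, p) = ⨆ w : E n, (inner ℝ p w - energy f (y, w))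

namespace ChartFinsler

variable {U : Set (E n)} {f K : E n × E n → ℝ} (hf : ChartFinsler U f)
  (hK : IsChartHamiltonian U f K) {y v w p : E n}
include hf hK

theorem hamiltonian_legendreMap (hy : y ∈ U) (hv : v ≠ 0) :
    K (legendreMap (energy f) (y, v)) = energy f (y, v) :=
  (hK y hy _).trans (hf.iSup_fibGrad hy hv)

theorem le_hamiltonian (hy : y ∈ U) (hp : p ≠ 0) (w : E n) :
    inner ℝ p w - energy f (y, w) ≤ K (y, p) := by
  obtain ⟨v, hv, rfl⟩ := hf.exists_fibGrad_eq hy hp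
  have h1 := hf.hamiltonian_legendreMap hK hy hv
  simp only [legendreMap] at h1
  rw [h1]
  have h := hf.energy_le hy hv w
  rw [inner_sub_right, hf.inner_fibGrad_self hy hv] at h
  simp only [energy] at h ⊢
  linarith

theorem smoothNear_hamiltonian (hy : y ∈ U) (hv : v ≠ 0) :
    SmoothNear K (legendreMap (energy f) (y, v)) := by
  obtain ⟨σ, hσ, hl, hr⟩ := hf.exists_legendre_inverse hy hv
  have hz : σ (legendreMap (energy f) (y, v)) = (y, v) := hl.self_of_nhds
  have h1 : SmoothNear (fun q => energy f (σ q)) (legendreMap (energy f) (y, v)) :=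
    SmoothNear.comp (by rw [hz]; exact hf.smoothNear_energy hy hv) hσ
  refine h1.congr ?_
  have hc := hσ.continuousAt
  rw [ContinuousAt, hz] at hc
  filter_upwards [hr, hc.eventually (eventually_mem_slit hf.isOpen hy hv)] with q h2 h3
  conv_lhs => rw [← h2]
  exact hf.hamiltonian_legendreMap hK h3.1 h3.2

/-- An envelope argument: with `v` frozen, `K(x, p) - (p · v - L(x, v))` is nonnegative near the
given covector and vanishes there, so its derivative is zero. The local inverse of the Legendre map
need not be differentiated. -/
theorem fderiv_hamiltonian (hy : y ∈ U) (hv : v ≠ 0) (u : E n × E n) :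
    fderiv ℝ K (legendreMap (energy f) (y, v)) u =
      inner ℝ u.2 v - inner ℝ (baseGrad (energy f) (y, v)) u.1 := by
  set q := legendreMap (energy f) (y, v)
  have hq : q.2 ≠ 0 := hf.fibGrad_ne_zero hy hv
  have hL := hf.smoothNear_energy hy hv
  have h1 : HasFDerivAt (fun q' : E n × E n => ((q'.1, v) : E n × E n))
      ((ContinuousLinearMap.inl ℝ (E n) (E n)).comp (.fst ℝ (E n) (E n))) q :=
    HasFDerivAt.comp (g := fun y' : E n => (y', v)) q (hasFDerivAt_prodMk_left q.1 v) hasFDerivAt_fst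
  have h2 : HasFDerivAt (fun q' : E n × E n => energy f (q'.1, v)) _ q :=
    HasFDerivAt.comp (g := energy f) q hL.differentiableAt.hasFDerivAt h1
  have h3 : HasFDerivAt (fun q' : E n × E n => inner ℝ q'.2 v) _ q :=
    (hasFDerivAt_snd (𝕜 := ℝ) (p := q)).inner ℝ (hasFDerivAt_const v q)
  have h4 : HasFDerivAt (fun q' : E n × E n => K q' - (inner ℝ q'.2 v - energy f (q'.1, v))) _ q :=
    (hf.smoothNear_hamiltonian hK hy hv).differentiableAt.hasFDerivAt.sub (h3.sub h2)
  have hmin : IsLocalMin (fun q' : E n × E n => K q' - (inner ℝ q'.2 v - energy f (q'.1, v))) q := by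
    filter_upwards [eventually_mem_slit hf.isOpen (y := q.1) hy hq] with q' hq'
    have h5 := hf.le_hamiltonian hK hq'.1 hq'.2 v
    have h6 := hf.hamiltonian_legendreMap hK hy hv
    have h7 : inner ℝ q.2 v = f (y, v) ^ 2 := hf.inner_fibGrad_self hy hv
    have h8 : K q - (inner ℝ q.2 v - energy f (q.1, v)) = 0 := by
      rw [h7, h6, show q.1 = y from rfl]
      simp only [energy]
      ring
    rw [h8]
    linarith
  have h9 := congrArg (fun A => A u) (hmin.hasFDerivAt_eq_zero h4)
  rw [inner_baseGrad]
  simp only [sub_apply, ContinuousLinearMap.comp_apply, ContinuousLinearMap.inl_apply,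
    ContinuousLinearMap.coe_fst', zero_apply] at h9
  simp at h9
  linarith

theorem hamVec_legendreMap (hy : y ∈ U) (hv : v ≠ 0) :
    hamVec K (legendreMap (energy f) (y, v)) = (v, baseGrad (energy f) (y, v)) := by
  refine Prod.ext ?_ ?_
  · ext i
    simp only [hamVec, dFib]
    rw [hf.fderiv_hamiltonian hK hy hv]
    simp [PiLp.inner_apply]
  · ext i
    simp only [hamVec, dBase]
    rw [hf.fderiv_hamiltonian hK hy hv]
    simp [PiLp.inner_apply]

/-- The Legendre map conjugates the geodesic spray and the Hamiltonian vector field. -/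
theorem isFlowNear_conj {Ψ : ℝ → E n × E n → E n × E n} {σ : E n × E n → E n × E n}
    (hy : y ∈ U) (hv : v ≠ 0) (hΨ : IsFlowNear (sprayVec (energy f)) (y, v) Ψ)
    (hσ : SmoothNear σ (legendreMap (energy f) (y, v)))
    (hl : ∀ᶠ z in 𝓝 (y, v), σ (legendreMap (energy f) z) = z)
    (hr : ∀ᶠ q in 𝓝 (legendreMap (energy f) (y, v)), legendreMap (energy f) (σ q) = q) :
    IsFlowNear (hamVec K) (legendreMap (energy f) (y, v))
      (fun t q => legendreMap (energy f) (Ψ t (σ q))) := by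
  have hc := hσ.continuousAt
  rw [ContinuousAt, hl.self_of_nhds] at hc
  obtain ⟨ε₁, hε₁, h1⟩ := hΨ.confined (hf.smoothNear_sprayVec hy hv)
    (eventually_mem_slit hf.isOpen hy hv)
  obtain ⟨ε₂, hε₂, h2⟩ := hΨ
  refine ⟨min ε₁ ε₂, by positivity, ?_⟩
  filter_upwards [hr, hc.eventually h1, hc.eventually h2] with q h3 h4 h5
  refine ⟨by rw [h5.1, h3], fun t ht => ?_⟩
  simp only [mem_Ioo, neg_lt, lt_min_iff] at ht
  have h6 := h4 t ⟨by linarith, by linarith⟩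
  have h7 := h5.2 t ⟨by linarith, by linarith⟩
  have h8 := HasFDerivAt.comp_hasDerivAt (l := legendreMap (energy f)) t
    (hf.smoothNear_energy h6.1 h6.2).legendreMap.differentiableAt.hasFDerivAt h7
  refine h8.congr_deriv ?_
  exact (hf.fderiv_legendreMap_sprayVec h6.1 h6.2).trans
    (hf.hamVec_legendreMap hK h6.1 h6.2).symm

end ChartFinsler

end Legendre

/-! ### The explicit Jacobi family of `F*² / 2` -/

section JacobiFamily

variable {n : ℕ}

/-- The nonlinear connection `∂G/∂v`. -/
noncomputable def sprayConn (L : E n × E n → ℝ) (z : E n × E n) : E n →L[ℝ] E n :=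
  fderiv ℝ (sprayCoeff L) z ∘L .inr ℝ (E n) (E n)

/-- The Finsler curvature operator, as a continuous linear map. -/
noncomputable def sprayCurv (L : E n × E n → ℝ) (z : E n × E n) : E n →L[ℝ] E n :=
  (2 : ℝ) • (fderiv ℝ (sprayCoeff L) z ∘L .inl ℝ (E n) (E n))
    - fderiv ℝ (sprayConn L) z (sprayVec L z) - sprayConn L z ∘L sprayConn L z

theorem smoothNear_sprayConn {L : E n × E n → ℝ} {z : E n × E n}
    (hG : SmoothNear (sprayCoeff L) z) : SmoothNear (sprayConn L) z := by
  filter_upwards [hG.fderiv] with y hy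
  exact hy.clm_comp contDiffAt_const

theorem fderiv_sprayVec {L : E n × E n → ℝ} {z : E n × E n}
    (hG : SmoothNear (sprayCoeff L) z) (u : E n × E n) :
    fderiv ℝ (sprayVec L) z u = (u.2, (-2 : ℝ) • fderiv ℝ (sprayCoeff L) z u) := by
  have h : HasFDerivAt (sprayVec L) _ z :=
    hasFDerivAt_snd.prodMk (hG.differentiableAt.hasFDerivAt.const_smul (-2 : ℝ))
  rw [h.fderiv]
  rfl

theorem fderiv_sprayCoeff_apply {L : E n × E n → ℝ} {z : E n × E n}
    (hG : ∀ i, SmoothNear (spray L i) z) (u : E n × E n) (i : Fin n) :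
    fderiv ℝ (sprayCoeff L) z u i = fderiv ℝ (spray L i) z u :=
  fderiv_toLp_apply (fun i => (hG i).differentiableAt) u i

theorem sprayConn_apply {L : E n × E n → ℝ} {z : E n × E n}
    (hG : ∀ i, SmoothNear (spray L i) z) (w : E n) (i : Fin n) :
    sprayConn L z w i = ∑ k, w k * dFib k (spray L i) z := by
  simp only [sprayConn, ContinuousLinearMap.comp_apply, ContinuousLinearMap.inr_apply]
  rw [fderiv_sprayCoeff_apply hG, fderiv_eq_sum]
  simp

/-- The derivative of the connection along the spray `(v, -2G)` produces both second-order terms of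
the coordinate formula. -/
theorem sprayCurv_eq {L : E n × E n → ℝ} {z : E n × E n}
    (hG : ∀ i, SmoothNear (spray L i) z) (w : E n) :
    sprayCurv L z w = WithLp.toLp 2 ((finslerCurvature L z).mulVec w.ofLp) := by
  have hGv : SmoothNear (sprayCoeff L) z := smoothNear_toLp hG
  ext i
  have hN : fderiv ℝ (sprayConn L) z (sprayVec L z) w i =
      ∑ k, w k * (∑ j, z.2 j * dBase j (dFib k (spray L i)) z
        - 2 * ∑ j, spray L j z * dFib j (dFib k (spray L i)) z) := by
    have h1 : HasFDerivAt (fun y => sprayConn L y w i)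
        ((EuclideanSpace.proj i : E n →L[ℝ] ℝ).comp
          ((fderiv ℝ (sprayConn L) z).flip w)) z := by
      have h0 : HasFDerivAt (fun y => sprayConn L y w) _ z :=
        (smoothNear_sprayConn hGv).differentiableAt.hasFDerivAt.clm_apply (hasFDerivAt_const w z)
      exact ((EuclideanSpace.proj i : E n →L[ℝ] ℝ).hasFDerivAt.comp z h0).congr_fderiv
        (by ext <;> simp)
    have h2 : HasFDerivAt (fun y => ∑ k, w k * dFib k (spray L i) y)
        (∑ k, w k • fderiv ℝ (dFib k (spray L i)) z) z :=
      HasFDerivAt.fun_sum fun k _ => ((hG i).dFib k).differentiableAt.hasFDerivAt.const_mul (w k)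
    have h3 := h1.unique (h2.congr_of_eventuallyEq (by
      filter_upwards [eventually_all.2 fun i => (hG i).eventually] with y hy
      exact sprayConn_apply hy w i))
    have h4 := congrArg (fun A => A (sprayVec L z)) h3
    refine Eq.trans h4 ?_
    simp only [sum_apply, smul_apply, smul_eq_mul]
    refine Finset.sum_congr rfl fun k _ => ?_
    rw [fderiv_eq_sum]
    congr 1
    simp only [sprayVec, sprayCoeff, PiLp.smul_apply, smul_eq_mul, sub_eq_add_neg,
      Finset.mul_sum, ← Finset.sum_neg_distrib]
    congr 1
    exact Finset.sum_congr rfl fun j _ => by ring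
  have hNN : sprayConn L z (sprayConn L z w) i =
      ∑ k, w k * ∑ j, dFib j (spray L i) z * dFib k (spray L j) z := by
    simp only [sprayConn_apply hG, Finset.mul_sum, Finset.sum_mul]
    rw [Finset.sum_comm]
    exact Finset.sum_congr rfl fun _ _ => Finset.sum_congr rfl fun _ _ => by ring
  have hB : fderiv ℝ (sprayCoeff L) z (w, 0) i = ∑ k, w k * dBase k (spray L i) z := by
    rw [fderiv_sprayCoeff_apply hG, fderiv_eq_sum]
    simp
  simp only [sprayCurv, sub_apply, smul_apply, ContinuousLinearMap.comp_apply,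
    ContinuousLinearMap.inl_apply, PiLp.sub_apply, PiLp.smul_apply, smul_eq_mul, hN, hNN, hB,
    Matrix.mulVec, dotProduct, finslerCurvature, Matrix.of_apply]
  rw [Finset.mul_sum, ← Finset.sum_sub_distrib, ← Finset.sum_sub_distrib]
  exact Finset.sum_congr rfl fun k _ => by ring

namespace ChartFinsler

variable {U : Set (E n)} {f K : E n × E n → ℝ} (hf : ChartFinsler U f) {y v w p : E n}
include hf

theorem sprayConn_self (hy : y ∈ U) (hv : v ≠ 0) :
    sprayConn (energy f) (y, v) v = (2 : ℝ) • sprayCoeff (energy f) (y, v) := by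
  have hG := hf.smoothNear_spray hy hv
  ext i
  simp only [sprayConn, ContinuousLinearMap.comp_apply, ContinuousLinearMap.inr_apply]
  rw [fderiv_sprayCoeff_apply hG,
    (homogOn_spray hf.isOpen hf.homogOn_energy i).euler hy hv (hG i).differentiableAt]
  simp [sprayCoeff]

/-- The family is `D (C t (0, P t w))`, with `C` the inverse of the linearized spray flow, `P`
parallel transport and `D` the derivative of the Legendre map at `(y, v)`. Since `C' = -C ∘ dX` for
the spray `X`, differentiating `C t u` replaces `u` by `u' - dX u`. Starting from `(0, P w)` this
gives `(-P w, N P w)`: the coefficient `-2` in the spray and the `-1` in the transport equation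
combine. The next derivative has zero horizontal part and fibre part minus the Finsler curvature. -/
theorem exists_jacobiFamily (hK : IsChartHamiltonian U f K) (hy : y ∈ U) (hv : v ≠ 0) :
    ∃ Γ Γ' Γ'' : ℝ → E n →L[ℝ] E n × E n,
      IsJacobiFamily K (legendreMap (energy f) (y, v)) Γ Γ' Γ'' ∧
      (∀ w, Γ 0 w = (0, fibHess (energy f) (y, v) w)) ∧
      (∀ w, (Γ' 0 w).1 = -w) ∧
      (∀ w, Γ'' 0 w = -(0, fibHess (energy f) (y, v) (sprayCurv (energy f) (y, v) w))) ∧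
      ∀ᶠ t in 𝓝 (0 : ℝ), Γ' t v = -hamVec K (legendreMap (energy f) (y, v)) := by
  set L := energy f
  set q := legendreMap L (y, v)
  have hL : SmoothNear L (y, v) := hf.smoothNear_energy hy hv
  have hG : SmoothNear (sprayCoeff L) (y, v) := hf.smoothNear_sprayCoeff hy hv
  have hX : SmoothNear (sprayVec L) (y, v) := hf.smoothNear_sprayVec hy hv
  have hN := smoothNear_sprayConn hG
  obtain ⟨Ψ, hΨ⟩ := exists_isFlowNear hX
  have hΨs := hΨ.smoothNear hX
  obtain ⟨hΨ0, hγ⟩ := hΨ.integralCurve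
  set γ : ℝ → E n × E n := fun s => Ψ s (y, v)
  have hγc : Tendsto γ (𝓝 0) (𝓝 (y, v)) := by
    have := hΨs.continuousAt.tendsto
    rwa [show γ 0 = (y, v) from hΨ0] at this
  have hγ0 : γ 0 = (y, v) := hΨ0
  have hslit := hγc.eventually (eventually_mem_slit hf.isOpen hy hv)
  obtain ⟨A, hA0, hA, hAs, hAd⟩ := hΨ.exists_linearization hX
  -- The inverse of the linearized flow.
  obtain ⟨C, hC0, hC, hCs⟩ := exists_solution_along (γ := γ) (X := sprayVec L)
    (Y := fun r : (E n × E n) × (E n × E n →L[ℝ] E n × E n) =>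
      -(r.2 ∘L fderiv ℝ (sprayVec L) r.1)) (w₀ := .id ℝ _)
    (by rw [hγ0]; exact hX) (by
      rw [hγ0]
      have h1 : SmoothNear (fun r : (E n × E n) × (E n × E n →L[ℝ] E n × E n) =>
          fderiv ℝ (sprayVec L) r.1) ((y, v), .id ℝ _) :=
        SmoothNear.comp (g := fderiv ℝ (sprayVec L)) (f := Prod.fst) hX.fderiv
          (smoothNear_of_contDiff contDiff_fst _)
      filter_upwards [h1] with r hr
      exact (contDiffAt_snd.clm_comp hr).neg) hγ
  -- The product `C t ∘ A t` is constant, so `C t` is a left inverse; in finite dimension it is also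
  -- a right inverse.
  have hCA : ∀ᶠ t in 𝓝 (0 : ℝ), ∀ u, A t (C t u) = u := by
    have h : ∀ᶠ t in 𝓝 (0 : ℝ), HasDerivAt (fun t => C t ∘L A t) 0 t := by
      filter_upwards [hA, hC] with t h1 h2
      exact (h2.clm_comp h1).congr_deriv (ContinuousLinearMap.ext fun u => by simp [γ])
    filter_upwards [eventually_eq_of_hasDerivAt_zero h] with t ht u
    have h3 : (C t).toLinearMap * (A t).toLinearMap = 1 := LinearMap.ext fun x => by
      simpa [hC0, hA0] using congrArg (fun B => B x) ht
    have h5 := mul_eq_one_comm.1 h3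
    exact congrArg (fun B : E n × E n →ₗ[ℝ] E n × E n => B u) h5
  have hCX : ∀ᶠ t in 𝓝 (0 : ℝ), C t (sprayVec L (γ t)) = sprayVec L (y, v) := by
    have h : ∀ᶠ t in 𝓝 (0 : ℝ), HasDerivAt (fun t => C t (sprayVec L (γ t))) 0 t := by
      filter_upwards [hC, hγ, hγc.eventually hX.eventually] with t h1 h2 h3
      have h4 := HasFDerivAt.comp_hasDerivAt (l := sprayVec L) t
        h3.differentiableAt.hasFDerivAt h2
      exact (h1.clm_apply h4).congr_deriv (by simp [γ])
    simpa [hC0, hγ0] using eventually_eq_of_hasDerivAt_zero h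
  -- Parallel transport for the nonlinear connection.
  obtain ⟨P, hP0, hP, hPs⟩ := exists_solution_along (γ := γ) (X := sprayVec L)
    (Y := fun r : (E n × E n) × (E n →L[ℝ] E n) => -(sprayConn L r.1 ∘L r.2)) (w₀ := .id ℝ _)
    (by rw [hγ0]; exact hX) (by
      rw [hγ0]
      have h1 : SmoothNear (fun r : (E n × E n) × (E n →L[ℝ] E n) => sprayConn L r.1)
          ((y, v), .id ℝ _) :=
        SmoothNear.comp (g := sprayConn L) (f := Prod.fst) hN
          (smoothNear_of_contDiff contDiff_fst _)
      filter_upwards [h1] with r hr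
      exact (hr.clm_comp contDiffAt_snd).neg) hγ
  -- The velocity is parallel: by Euler's identity `N γ̇ = 2G`, so `γ̈ = -2G = -N γ̇`, the equation
  -- solved by `P t v`.
  have hPv : ∀ᶠ t in 𝓝 (0 : ℝ), P t v = (γ t).2 := by
    have hY : SmoothNear (fun r : (E n × E n) × E n => (sprayVec L r.1, -(sprayConn L r.1 r.2)))
        (γ 0, P 0 v) := by
      rw [hγ0]
      have h1 : SmoothNear (fun r : (E n × E n) × E n => sprayConn L r.1) ((y, v), P 0 v) :=
        SmoothNear.comp (g := sprayConn L) (f := Prod.fst) hN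
          (smoothNear_of_contDiff contDiff_fst _)
      have h2 : SmoothNear (fun r : (E n × E n) × E n => sprayVec L r.1) ((y, v), P 0 v) :=
        SmoothNear.comp (g := sprayVec L) (f := Prod.fst) hX
          (smoothNear_of_contDiff contDiff_fst _)
      filter_upwards [h1, h2] with r h1 h2
      exact h2.prodMk (h1.clm_apply contDiffAt_snd).neg
    have h3 := integralCurve_unique (γ := fun t => (γ t, P t v)) (δ := fun t => (γ t, (γ t).2)) hY
      (by
        filter_upwards [hγ, hP] with t h1 h2
        refine h1.prodMk ?_
        simpa using h2.clm_apply (hasDerivAt_const t v))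
      (by
        filter_upwards [hγ, hslit] with t h1 h2
        refine h1.prodMk ?_
        have h4 : HasDerivAt (fun t => (γ t).2) (sprayVec L (γ t)).2 t := h1.snd
        refine h4.congr_deriv ?_
        have := hf.sprayConn_self h2.1 h2.2
        simp only [Prod.mk.eta] at this
        rw [this, sprayVec, neg_smul])
      (by simp [hP0, hγ0])
    filter_upwards [h3] with t ht
    exact congrArg Prod.snd ht
  obtain ⟨σ, hσ, hl, hr⟩ := hf.exists_legendre_inverse hy hv
  have hσq : σ q = (y, v) := hl.self_of_nhds
  have hKq : SmoothNear K q := hf.smoothNear_hamiltonian hK hy hv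
  set D := fderiv ℝ (legendreMap L) (y, v)
  -- Through the conjugated flow, this vector is carried to the image of `(0, u)` under the
  -- derivative of the Legendre map at `γ t`, and that derivative preserves verticality.
  have hmem : ∀ᶠ t in 𝓝 (0 : ℝ), ∀ u, D (C t (0, u)) ∈ jacobiCurve K q t := by
    filter_upwards [jacobiCurve_eq_comap hKq (hf.isFlowNear_conj hK hy hv hΨ hσ hl hr), hAd,
      hCA, hslit] with t h1 h2 h3 h4 u
    have h5 := hasFDerivAt_slice h2
    have hLt : SmoothNear L (γ t) := hf.smoothNear_energy h4.1 h4.2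
    have h6 : HasFDerivAt (fun q' => legendreMap L (Ψ t (σ q'))) _ q :=
      HasFDerivAt.comp (g := legendreMap L) q
        (by rw [hσq]; exact hLt.legendreMap.differentiableAt.hasFDerivAt)
        (HasFDerivAt.comp (g := Ψ t) q (by rw [hσq]; exact h5) hσ.differentiableAt.hasFDerivAt)
    rw [h1 _ h6, Submodule.mem_comap, mem_vertical]
    have h7 := fderiv_inverse_legendreMap hL hσ hl (C t (0, u))
    have h8 : fderiv ℝ (legendreMap L) (Ψ t (σ q)) (A t (fderiv ℝ σ q (D (C t (0, u))))) =
        (0, fibHess L (γ t) u) := by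
      rw [h7, h3, hσq]
      exact fderiv_legendreMap_fib hLt u
    have h9 := congrArg Prod.fst h8
    rw [hσq] at h9
    exact h9
  refine ⟨fun t => D ∘L (C t ∘L (.inr ℝ (E n) (E n) ∘L P t)),
    fun t => D ∘L (C t ∘L (.inr ℝ (E n) (E n) ∘L (sprayConn L (γ t) ∘L P t)
      - .inl ℝ (E n) (E n) ∘L P t)),
    fun t => D ∘L (C t ∘L (.inr ℝ (E n) (E n) ∘L (-(sprayCurv L (γ t) ∘L P t)))),
    ⟨?_, ?_, ?_, ?_, ?_⟩, ?_, ?_, ?_, ?_⟩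
  · filter_upwards [hCs, hPs] with t h1 h2
    exact contDiffAt_const.clm_comp (h1.clm_comp (contDiffAt_const.clm_comp h2))
  · filter_upwards [hC, hP, hγc.eventually hG.eventually] with t h1 h2 h3
    refine ((hasDerivAt_const t D).clm_comp (h1.clm_comp
      ((hasDerivAt_const t (ContinuousLinearMap.inr ℝ (E n) (E n))).clm_comp h2))).congr_deriv ?_
    refine ContinuousLinearMap.ext fun w => ?_
    have h4 : fderiv ℝ (sprayVec L) (γ t) (0, P t w) = (P t w, (-2 : ℝ) • sprayConn L (γ t) (P t w)) :=
      fderiv_sprayVec h3 _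
    have h5 : ((0, sprayConn L (γ t) (P t w)) - (P t w, 0) : E n × E n) =
        -(P t w, (-2 : ℝ) • sprayConn L (γ t) (P t w)) - (0, sprayConn L (γ t) (P t w)) := by
      refine Prod.ext ?_ ?_
      · simp
      · simp only [Prod.snd_sub, Prod.snd_neg, sub_zero]
        module
    simp only [ContinuousLinearMap.comp_apply, add_apply, sub_apply, neg_apply,
      ContinuousLinearMap.inr_apply, ContinuousLinearMap.inl_apply, h4, h5,
      ContinuousLinearMap.zero_comp, ContinuousLinearMap.comp_neg, zero_add]
    simp only [map_sub, map_neg, ← sub_eq_add_neg]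
  · filter_upwards [hC, hP, hγ, hγc.eventually hG.eventually] with t h1 h2 h2' h3
    have hNt : HasDerivAt (fun t => sprayConn L (γ t))
        (fderiv ℝ (sprayConn L) (γ t) (sprayVec L (γ t))) t :=
      HasFDerivAt.comp_hasDerivAt (l := sprayConn L) t
        (smoothNear_sprayConn h3).differentiableAt.hasFDerivAt h2'
    refine ((hasDerivAt_const t D).clm_comp (h1.clm_comp
      (((hasDerivAt_const t (ContinuousLinearMap.inr ℝ (E n) (E n))).clm_comp
        (hNt.clm_comp h2)).sub
      ((hasDerivAt_const t (ContinuousLinearMap.inl ℝ (E n) (E n))).clm_comp h2)))).congr_deriv ?_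
    refine ContinuousLinearMap.ext fun w => ?_
    have h4 := fderiv_sprayVec h3 (-(P t w), sprayConn L (γ t) (P t w))
    have h5 : fderiv ℝ (sprayCoeff L) (γ t) (-(P t w), sprayConn L (γ t) (P t w)) =
        -fderiv ℝ (sprayCoeff L) (γ t) (P t w, 0) +
          sprayConn L (γ t) (sprayConn L (γ t) (P t w)) := by
      have : ((-(P t w), sprayConn L (γ t) (P t w)) : E n × E n) =
        -(P t w, 0) + (0, sprayConn L (γ t) (P t w)) := by simp
      rw [this, map_add, map_neg]
      rfl
    have h6 : ((0, sprayConn L (γ t) (P t w)) - (P t w, 0) : E n × E n) =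
      (-(P t w), sprayConn L (γ t) (P t w)) := by simp
    simp only [ContinuousLinearMap.comp_apply, add_apply, sub_apply, neg_apply, Pi.sub_apply,
      ContinuousLinearMap.inr_apply, ContinuousLinearMap.inl_apply, h6, h4, h5,
      ContinuousLinearMap.zero_comp, ContinuousLinearMap.comp_neg, zero_add, sprayCurv,
      smul_apply]
    have h7 : ∀ a b c : E n × E n, -a + b = -c →
        D (-(C t a) + C t b) = -D (C t c) := by
      intro a b c hc
      rw [← map_neg, ← map_add, hc, map_neg, map_neg]
    refine h7 _ _ _ ?_
    refine Prod.ext ?_ ?_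
    · simp
    · simp only [Prod.snd_add, Prod.snd_neg, Prod.snd_sub]
      module
  · filter_upwards [hmem] with t h w using h _
  · filter_upwards [hmem] with t h w using h _
  · intro w
    simp only [ContinuousLinearMap.comp_apply, hC0, hP0, ContinuousLinearMap.inr_apply,
      ContinuousLinearMap.id_apply]
    exact fderiv_legendreMap_fib hL w
  · intro w
    simp only [ContinuousLinearMap.comp_apply, hC0, hP0, ContinuousLinearMap.inr_apply,
      ContinuousLinearMap.inl_apply, sub_apply, ContinuousLinearMap.id_apply]
    simp only [D]
    rw [(hasFDerivAt_legendreMap hL).fderiv]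
    simp
  · intro w
    simp only [ContinuousLinearMap.comp_apply, hC0, hP0, hγ0, ContinuousLinearMap.inr_apply,
      ContinuousLinearMap.id_apply, neg_apply]
    refine (fderiv_legendreMap_fib hL _).trans ?_
    rw [map_neg]
    simp
  · filter_upwards [hPv, hCX, hslit] with t h1 h2 h3
    have h4 := hf.sprayConn_self h3.1 h3.2
    simp only [Prod.mk.eta] at h4
    simp only [ContinuousLinearMap.comp_apply, ContinuousLinearMap.inr_apply,
      ContinuousLinearMap.inl_apply, sub_apply, h1]
    rw [h4]
    have h5 : ((0, (2 : ℝ) • sprayCoeff (energy f) (γ t)) - ((γ t).2, 0) : E n × E n) =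
        -sprayVec L (γ t) := by
      simp [sprayVec, L]
    rw [h5, map_neg, h2, map_neg, hf.fderiv_legendreMap_sprayVec hy hv,
      hf.hamVec_legendreMap hK hy hv]

end ChartFinsler

end JacobiFamily

/-! ### Jacobi families under a change of time -/

section Deformation

variable {n : ℕ} {K H c : E n × E n → ℝ} {q : E n × E n}

theorem eventually_mul_zero {p : ℝ → Prop} (h : ∀ᶠ t in 𝓝 (0 : ℝ), p t) (a : ℝ) :
    ∀ᶠ t in 𝓝 (0 : ℝ), p (a * t) := by
  have h1 : Tendsto (fun t : ℝ => a * t) (𝓝 0) (𝓝 0) := by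
    simpa using (continuous_const_mul a).tendsto 0
  exact h1.eventually h

theorem hasDerivAt_comp_const_mul {W : Type*} [NormedAddCommGroup W] [NormedSpace ℝ W]
    {γ : ℝ → W} {w : W} {a t : ℝ} (h : HasDerivAt γ w (a * t)) :
    HasDerivAt (fun s => γ (a * s)) (a • w) t := by
  have h1 : HasDerivAt (fun s : ℝ => a * s) a t := by
    simpa using (hasDerivAt_id t).const_mul a
  exact HasDerivAt.scomp (g₁ := γ) t h h1

/-- If `H` has the Hamiltonian vector field `c X` where `X` is that of `K` and `c` is constant along
its flow, then the flow of `H` is obtained by a change of time. -/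
theorem isFlowNear_timeChange (hK : SmoothNear K q) (hc : SmoothNear c q)
    (hcX : ∀ᶠ z in 𝓝 q, fderiv ℝ c z (hamVec K z) = 0)
    (hH : ∀ᶠ z in 𝓝 q, hamVec H z = c z • hamVec K z) {Φ : ℝ → E n × E n → E n × E n}
    (hΦ : IsFlowNear (hamVec K) q Φ) :
    IsFlowNear (hamVec H) q (fun t z => Φ (c z * t) z) := by
  obtain ⟨ε₁, hε₁, h1⟩ := hΦ.confined hK.hamVec (hc.and (hcX.and hH))
  obtain ⟨ε₂, hε₂, h2⟩ := hΦ
  have hb : ∀ᶠ z in 𝓝 q, |c z| < |c q| + 1 :=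
    hc.continuousAt.abs.eventually (gt_mem_nhds (lt_add_one _))
  set ε := min ε₁ ε₂
  have hε : 0 < ε := by positivity
  have e1 : Ioo (-ε) ε ⊆ Ioo (-ε₁) ε₁ := Ioo_subset_Ioo (by simp [ε]) (by simp [ε])
  have e2 : Ioo (-ε) ε ⊆ Ioo (-ε₂) ε₂ := Ioo_subset_Ioo (by simp [ε]) (by simp [ε])
  refine ⟨ε / (|c q| + 1), by positivity, ?_⟩
  filter_upwards [h1, h2, hb] with z h1 h2 hb
  refine ⟨by simpa using h2.1, fun t ht => ?_⟩
  have hct : c z * t ∈ Ioo (-ε) ε := by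
    rw [mem_Ioo, ← abs_lt, abs_mul]
    have ht' : |t| < ε / (|c q| + 1) := abs_lt.2 ht
    calc |c z| * |t| ≤ (|c q| + 1) * |t| := by gcongr
      _ < (|c q| + 1) * (ε / (|c q| + 1)) := by gcongr
      _ = ε := by field_simp
  -- Conservation of `c` along the orbit makes the reparametrization linear, with rate `c z`.
  have hconst : c (Φ (c z * t) z) = c z := by
    have hd : ∀ s ∈ Ioo (-ε) ε, HasDerivAt (fun s => c (Φ s z)) 0 s := fun s hs => by
      have h3 := HasFDerivAt.comp_hasDerivAt (l := c) s
        ((h1 s (e1 hs)).1.differentiableAt (by simp)).hasFDerivAt (h2.2 s (e2 hs))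
      rwa [(h1 s (e1 hs)).2.1] at h3
    have h0 : (0 : ℝ) ∈ Ioo (-ε) ε := ⟨by linarith, hε⟩
    have := (convex_Ioo (-ε) ε).is_const_of_fderivWithin_eq_zero (𝕜 := ℝ)
      (fun s hs => (hd s hs).differentiableAt.differentiableWithinAt) (fun s hs => by
        rw [fderivWithin_of_isOpen isOpen_Ioo hs]
        simpa using (hd s hs).hasFDerivAt.fderiv) hct h0
    rwa [h2.1] at this
  rw [(h1 _ (e1 hct)).2.2, hconst]
  exact hasDerivAt_comp_const_mul (h2.2 _ (e2 hct))

/-- The field along the orbit and the transported initial value solve the same variational equation.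
-/
theorem linearization_apply_field {X : E n × E n → E n × E n} {γ : ℝ → E n × E n}
    {A : ℝ → E n × E n →L[ℝ] E n × E n} (hX : SmoothNear X (γ 0))
    (hγ : ∀ᶠ t in 𝓝 (0 : ℝ), HasDerivAt γ (X (γ t)) t) (hA0 : A 0 = .id ℝ _)
    (hA : ∀ᶠ t in 𝓝 (0 : ℝ), HasDerivAt A (fderiv ℝ X (γ t) ∘L A t) t) :
    ∀ᶠ t in 𝓝 (0 : ℝ), A t (X (γ 0)) = X (γ t) := by
  have hY : SmoothNear (fun r : (E n × E n) × (E n × E n) => (X r.1, fderiv ℝ X r.1 r.2))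
      (γ 0, A 0 (X (γ 0))) := by
    have h1 : SmoothNear (fun r : (E n × E n) × (E n × E n) => fderiv ℝ X r.1)
        (γ 0, A 0 (X (γ 0))) :=
      SmoothNear.comp (g := fderiv ℝ X) (f := Prod.fst) hX.fderiv
        (smoothNear_of_contDiff contDiff_fst _)
    have h2 : SmoothNear (fun r : (E n × E n) × (E n × E n) => X r.1) (γ 0, A 0 (X (γ 0))) :=
      SmoothNear.comp (g := X) (f := Prod.fst) hX (smoothNear_of_contDiff contDiff_fst _)
    filter_upwards [h1, h2] with r h1 h2
    exact h2.prodMk (h1.clm_apply contDiffAt_snd)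
  have h3 := integralCurve_unique (γ := fun t => (γ t, A t (X (γ 0))))
    (δ := fun t => (γ t, X (γ t))) hY
    (by
      filter_upwards [hγ, hA] with t h1 h2
      refine h1.prodMk ?_
      simpa using h2.clm_apply (hasDerivAt_const t (X (γ 0))))
    (by
      filter_upwards [hγ, hγ.self_of_nhds.continuousAt.eventually hX] with t h1 h2
      exact h1.prodMk (HasFDerivAt.comp_hasDerivAt (l := X) t
        (h2.differentiableAt (by simp)).hasFDerivAt h1))
    (by simp [hA0])
  filter_upwards [h3] with t ht
  exact congrArg Prod.snd ht

/-- The Jacobi family of a Hamiltonian obtained by a change of time. -/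
theorem IsJacobiFamily.timeChange (hK : SmoothNear K q) (hHs : SmoothNear H q)
    (hc : SmoothNear c q)
    (hcX : ∀ᶠ z in 𝓝 q, fderiv ℝ c z (hamVec K z) = 0)
    (hH : ∀ᶠ z in 𝓝 q, hamVec H z = c z • hamVec K z) {κ : ℝ}
    (hκ : ∀ u, fderiv ℝ c q u = κ * fderiv ℝ K q u) {Γ Γ' Γ'' : ℝ → E n →L[ℝ] E n × E n}
    (hΓ : IsJacobiFamily K q Γ Γ' Γ'') {v : E n}
    (hv : ∀ᶠ t in 𝓝 (0 : ℝ), Γ' t v = -hamVec K q) :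
    IsJacobiFamily H q (fun t => Γ (c q * t) - t • (fderiv ℝ c q ∘L Γ 0).smulRight (hamVec K q))
      (fun t => c q • Γ' (c q * t) - (fderiv ℝ c q ∘L Γ 0).smulRight (hamVec K q))
      (fun t => c q • c q • Γ'' (c q * t)) := by
  have hΦ := isFlowNear_hamFlow hK
  set Φ := hamFlow K q
  obtain ⟨A, hA0, hA, hAs, hd⟩ := hΦ.exists_linearization hK.hamVec
  obtain ⟨hΦ0, hγ⟩ := hΦ.integralCurve
  have hAX := linearization_apply_field (γ := fun s => Φ s q) (by rw [hΦ0]; exact hK.hamVec) hγ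
    hA0 hA
  rw [hΦ0] at hAX
  -- Up to the factor `κ` this is `dK(Γ t w) = -symp X_K (Γ t w) = symp (Γ' t v) (Γ t w)`, an entry
  -- of the constant Gram form.
  have hconst : ∀ w, ∀ᶠ t in 𝓝 (0 : ℝ), fderiv ℝ c q (Γ t w) = fderiv ℝ c q (Γ 0 w) := by
    intro w
    filter_upwards [hΓ.symp_const hK v w, hv] with t h1 h2
    rw [h2, hv.self_of_nhds, symp_neg_left, symp_neg_left, symp_hamVec, symp_hamVec] at h1
    rw [hκ, hκ]
    linear_combination κ * h1
  have hconst' : ∀ w, ∀ᶠ t in 𝓝 (0 : ℝ), fderiv ℝ c q (Γ' t w) = 0 := by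
    intro w
    filter_upwards [(hconst w).eventually_nhds, hΓ.hasDerivAt_apply w] with t h1 h2
    exact (HasFDerivAt.comp_hasDerivAt (l := fderiv ℝ c q) t (fderiv ℝ c q).hasFDerivAt h2).unique
      ((hasDerivAt_const t _).congr_of_eventuallyEq h1)
  have hconst'' : ∀ w, ∀ᶠ t in 𝓝 (0 : ℝ), fderiv ℝ c q (Γ'' t w) = 0 := by
    intro w
    filter_upwards [(hconst' w).eventually_nhds, hΓ.hasDerivAt_apply' w] with t h1 h2
    exact (HasFDerivAt.comp_hasDerivAt (l := fderiv ℝ c q) t (fderiv ℝ c q).hasFDerivAt h2).unique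
      ((hasDerivAt_const t _).congr_of_eventuallyEq h1)
  have hall : ∀ {B : ℝ → E n →L[ℝ] ℝ} {B₀ : E n →L[ℝ] ℝ},
      (∀ w, ∀ᶠ t in 𝓝 (0 : ℝ), B t w = B₀ w) → ∀ᶠ t in 𝓝 (0 : ℝ), ∀ w, B t w = B₀ w := by
    intro B B₀ h
    let b := Module.finBasis ℝ (E n)
    filter_upwards [eventually_all.2 fun i => h (b i)] with t ht w
    exact congrArg (fun l : E n →ₗ[ℝ] ℝ => l w)
      (b.ext (f₁ := (B t).toLinearMap) (f₂ := B₀.toLinearMap) ht)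
  have hconst₁ := hall (B := fun t => fderiv ℝ c q ∘L Γ t) (B₀ := fderiv ℝ c q ∘L Γ 0) hconst
  have hconst₂ := hall (B := fun t => fderiv ℝ c q ∘L Γ'' t) (B₀ := 0) hconst''
  have hcXq : fderiv ℝ c q (hamVec K q) = 0 := hcX.self_of_nhds
  -- Vectors of the Jacobi curve of `K` give vectors of the Jacobi curve of `H`.
  have hmem : ∀ᶠ t in 𝓝 (0 : ℝ), ∀ u ∈ jacobiCurve K q (c q * t),
      u - (t * fderiv ℝ c q u) • hamVec K q ∈ jacobiCurve H q t := by
    filter_upwards [jacobiCurve_eq_comap hHs (isFlowNear_timeChange hK hc hcX hH hΦ),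
      eventually_mul_zero (jacobiCurve_eq_comap hK hΦ) (c q), eventually_mul_zero hd (c q),
      eventually_mul_zero hAX (c q)] with t h1 h2 h3 h4 u hu
    rw [h2 _ (hasFDerivAt_slice h3), Submodule.mem_comap, mem_vertical] at hu
    have h5 : HasFDerivAt (fun z => (c z * t, z)) _ q :=
      (hc.differentiableAt.hasFDerivAt.mul_const t).prodMk (hasFDerivAt_id q)
    -- The derivative is `u ↦ A u + t dc(u) X_K`, with `A` and `X_K` taken at time `c q * t`. As
    -- `dc(X_K) = 0` and `A` transports the field, subtracting `t dc(u) X_K(q)` from `u` cancels the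
    -- second term.
    have h6 : HasFDerivAt (fun z => Φ (c z * t) z) _ q :=
      HasFDerivAt.comp (g := fun r : ℝ × (E n × E n) => Φ r.1 r.2) (f := fun z => (c z * t, z))
        q h3 h5
    rw [h1 _ h6, Submodule.mem_comap, mem_vertical]
    have h7 : (A (c q * t) u).1 = 0 := hu
    simp [hcXq, h4, h7]
  refine ⟨?_, ?_, ?_, ?_, ?_⟩
  · have h1 : SmoothNear (fun t : ℝ => Γ (c q * t)) 0 :=
      SmoothNear.comp (g := Γ) (f := fun t : ℝ => c q * t) (by simpa using hΓ.smoothNear)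
        (smoothNear_of_contDiff (contDiff_const.mul contDiff_id) 0)
    filter_upwards [h1] with t h1
    exact h1.sub (contDiffAt_id.smul contDiffAt_const)
  · filter_upwards [eventually_mul_zero hΓ.hasDerivAt (c q)] with t h1
    have := (hasDerivAt_comp_const_mul h1).sub
      ((hasDerivAt_id t).smul_const ((fderiv ℝ c q ∘L Γ 0).smulRight (hamVec K q)))
    rw [one_smul] at this
    exact this
  · filter_upwards [eventually_mul_zero hΓ.hasDerivAt' (c q)] with t h1
    exact ((hasDerivAt_comp_const_mul h1).const_smul (c q)).sub_const _
  · filter_upwards [hmem, eventually_mul_zero hΓ.mem (c q), eventually_mul_zero hconst₁ (c q)]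
      with t h1 h2 h3 w
    have h4 := h1 _ (h2 w)
    have h5 : fderiv ℝ c q (Γ (c q * t) w) = fderiv ℝ c q (Γ 0 w) := h3 w
    rw [h5] at h4
    simpa [smul_smul] using h4
  · filter_upwards [hmem, eventually_mul_zero hΓ.mem'' (c q), eventually_mul_zero hconst₂ (c q)]
      with t h1 h2 h3 w
    have h4 := h1 _ (h2 w)
    have h5 : fderiv ℝ c q (Γ'' (c q * t) w) = 0 := h3 w
    rw [h5, mul_zero, zero_smul, sub_zero] at h4
    exact Submodule.smul_mem _ _ (Submodule.smul_mem _ _ h4)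

end Deformation

/-! ### The Hamiltonian `h(F*)` near a nonzero covector -/

section DualNorm

variable {n : ℕ}

/-- The dual norm of `f`. -/
noncomputable def chartDual (f : E n × E n → ℝ) (z : E n × E n) : ℝ :=
  sSup ((fun w => inner ℝ z.2 w) '' {w | f (z.1, w) ≤ 1})

theorem IsConvexDeformation.deriv_pos {h : ℝ → ℝ} (hh : IsConvexDeformation h) {s : ℝ}
    (hs : 0 < s) : 0 < deriv h s := by
  have hd : ContDiff ℝ ∞ (deriv h) := (contDiff_infty_iff_deriv.1 hh.smooth).2
  have := strictMonoOn_of_deriv_pos (convex_Ici (0 : ℝ)) hd.continuous.continuousOn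
    (fun x hx => hh.deriv_deriv_pos x (by simpa using hx)) self_mem_Ici (mem_Ici.2 hs.le) hs
  rwa [hh.deriv_zero] at this

theorem IsConvexDeformation.hasDerivAt {h : ℝ → ℝ} (hh : IsConvexDeformation h) (s : ℝ) :
    HasDerivAt h (deriv h s) s :=
  (hh.smooth.differentiable (by simp) s).hasDerivAt

theorem IsConvexDeformation.hasDerivAt_deriv {h : ℝ → ℝ} (hh : IsConvexDeformation h) (s : ℝ) :
    HasDerivAt (deriv h) (deriv (deriv h) s) s :=
  ((contDiff_infty_iff_deriv.1 hh.smooth).2.differentiable (by simp) s).hasDerivAt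

namespace ChartFinsler

variable {U : Set (E n)} {f K H : E n × E n → ℝ} (hf : ChartFinsler U f) {y v w p : E n}
include hf

theorem chartDual_legendreMap (hy : y ∈ U) (hv : v ≠ 0) :
    chartDual f (legendreMap (energy f) (y, v)) = f (y, v) :=
  hf.sSup_fibGrad hy hv

variable (hK : IsChartHamiltonian U f K) {h : ℝ → ℝ} (hh : IsConvexDeformation h)
  (hH : ∀ y ∈ U, ∀ p : E n, H (y, p) = h (chartDual f (y, p)))
include hK

/-- Near a nonzero covector, the Hamiltonian is half of the square of the dual norm. -/
theorem eventually_chartDual (hy : y ∈ U) (hv : v ≠ 0) :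
    ∀ᶠ z in 𝓝 (legendreMap (energy f) (y, v)),
      z.1 ∈ U ∧ 0 < K z ∧ chartDual f z = √(2 * K z) ∧ SmoothNear K z := by
  obtain ⟨σ, hσ, hl, hr⟩ := hf.exists_legendre_inverse hy hv
  have hc := hσ.continuousAt
  rw [ContinuousAt, hl.self_of_nhds] at hc
  filter_upwards [hr, hc.eventually (eventually_mem_slit hf.isOpen hy hv)] with z h2 h3
  have hpos := hf.pos h3.1 h3.2
  have h4 : K z = f (σ z) ^ 2 / 2 := by
    conv_lhs => rw [← h2]
    exact hf.hamiltonian_legendreMap hK h3.1 h3.2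
  have h5 : chartDual f z = f (σ z) := by
    conv_lhs => rw [← h2]
    exact hf.chartDual_legendreMap h3.1 h3.2
  refine ⟨by rw [← h2]; exact h3.1, ?_, ?_, ?_⟩
  · rw [h4]
    exact div_pos (pow_pos hpos 2) two_pos
  · rw [h4, h5, mul_div_cancel₀ _ two_ne_zero]
    exact (Real.sqrt_sq hpos.le).symm
  · rw [← h2]
    exact hf.smoothNear_hamiltonian hK h3.1 h3.2

include hh hH

/-- Near the covector `H = h(√(2K))`, and the chain rule through the smooth positive function `K`
gives the factor `h'(F*) / F*`. -/
theorem eventually_fderiv_deformed (hy : y ∈ U) (hv : v ≠ 0) :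
    ∀ᶠ z in 𝓝 (legendreMap (energy f) (y, v)), ∀ u,
      fderiv ℝ H z u = deriv h √(2 * K z) / √(2 * K z) * fderiv ℝ K z u := by
  filter_upwards [(hf.eventually_chartDual hK hy hv).eventually_nhds] with z hz u
  obtain ⟨h1, h2, h3, h4⟩ := hz.self_of_nhds
  have h5 : H =ᶠ[𝓝 z] fun z => h √(2 * K z) := hz.mono fun z' hz' => by
    show H z' = h √(2 * K z')
    rw [← hz'.2.2.1]
    exact hH _ hz'.1 _
  have h6 : 0 < √(2 * K z) := Real.sqrt_pos.2 (by positivity)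
  have h7 : HasFDerivAt (fun z => √(2 * K z)) _ z :=
    (h4.differentiableAt.hasFDerivAt.const_mul 2).sqrt (by positivity)
  have h8 : HasFDerivAt (fun z => h √(2 * K z)) _ z :=
    (hh.hasDerivAt _).comp_hasFDerivAt z h7
  rw [h5.fderiv_eq, h8.fderiv]
  simp only [smul_apply, smul_eq_mul]
  field_simp

theorem smoothNear_deformed (hy : y ∈ U) (hv : v ≠ 0) :
    SmoothNear H (legendreMap (energy f) (y, v)) := by
  filter_upwards [(hf.eventually_chartDual hK hy hv).eventually_nhds] with z hz
  obtain ⟨h1, h2, h3, h4⟩ := hz.self_of_nhds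
  have h5 : H =ᶠ[𝓝 z] fun z => h √(2 * K z) := hz.mono fun z' hz' => by
    show H z' = h √(2 * K z')
    rw [← hz'.2.2.1]
    exact hH _ hz'.1 _
  refine ContDiffAt.congr_of_eventuallyEq ?_ h5
  exact hh.smooth.contDiffAt.comp z ((contDiffAt_const.mul h4.contDiffAt).sqrt (by positivity))

omit hH in
theorem smoothNear_speed (hy : y ∈ U) (hv : v ≠ 0) :
    SmoothNear (fun z => deriv h √(2 * K z) / √(2 * K z)) (legendreMap (energy f) (y, v)) := by
  filter_upwards [hf.eventually_chartDual hK hy hv] with z hz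
  obtain ⟨h1, h2, h3, h4⟩ := hz
  have h5 : ContDiffAt ℝ ∞ (fun z => √(2 * K z)) z :=
    (contDiffAt_const.mul h4.contDiffAt).sqrt (by positivity)
  exact ((contDiff_infty_iff_deriv.1 hh.smooth).2.contDiffAt.comp z h5).div h5
    (Real.sqrt_pos.2 (by positivity)).ne'

omit hH in
-- Gives the multiplier `κ` with `dc = κ dK` that the change of time requires; conservation of `c`
-- along the flow of `K` also follows.
theorem eventually_fderiv_speed (hy : y ∈ U) (hv : v ≠ 0) :
    ∀ᶠ z in 𝓝 (legendreMap (energy f) (y, v)), ∀ u,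
      fderiv ℝ (fun z => deriv h √(2 * K z) / √(2 * K z)) z u =
        (deriv (deriv h) √(2 * K z) / √(2 * K z) - deriv h √(2 * K z) / √(2 * K z) ^ 2)
          / √(2 * K z) * fderiv ℝ K z u := by
  filter_upwards [hf.eventually_chartDual hK hy hv] with z hz u
  obtain ⟨h1, h2, h3, h4⟩ := hz
  have h6 : 0 < √(2 * K z) := Real.sqrt_pos.2 (by positivity)
  have h7 : HasFDerivAt (fun z => √(2 * K z)) _ z :=
    (h4.differentiableAt.hasFDerivAt.const_mul 2).sqrt (by positivity)
  have h8 : HasFDerivAt (fun z => deriv h √(2 * K z) / √(2 * K z)) _ z :=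
    HasDerivAt.comp_hasFDerivAt (f := fun z => √(2 * K z)) (h₂ := fun s => deriv h s / s) z
      ((hh.hasDerivAt_deriv _).div (hasDerivAt_id _) h6.ne') h7
  rw [h8.fderiv]
  simp only [smul_apply, smul_eq_mul]
  field_simp

theorem eventually_hamVec_deformed (hy : y ∈ U) (hv : v ≠ 0) :
    ∀ᶠ z in 𝓝 (legendreMap (energy f) (y, v)),
      hamVec H z = (deriv h √(2 * K z) / √(2 * K z)) • hamVec K z := by
  filter_upwards [hf.eventually_fderiv_deformed hK hh hH hy hv] with z hz
  refine Prod.ext ?_ ?_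
  · ext i
    simp [hamVec, dFib, hz]
  · ext i
    simp [hamVec, dBase, hz]

end ChartFinsler

end DualNorm

/-! ### The two curvature operators -/

section Curvature

variable {n : ℕ}

theorem trace_of_mulVec {S : E n →ₗ[ℝ] E n} {M : Matrix (Fin n) (Fin n) ℝ}
    (h : ∀ w, S w = WithLp.toLp 2 (M.mulVec w.ofLp)) : LinearMap.trace ℝ (E n) S = M.trace := by
  have h1 : S = Matrix.toLin (EuclideanSpace.basisFun (Fin n) ℝ).toBasis
      (EuclideanSpace.basisFun (Fin n) ℝ).toBasis M := by
    rw [← Matrix.toEuclideanLin_eq_toLin_orthonormal]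
    exact LinearMap.ext h
  rw [h1, LinearMap.trace_eq_matrix_trace ℝ (EuclideanSpace.basisFun (Fin n) ℝ).toBasis,
    LinearMap.toMatrix_toLin]

namespace ChartFinsler

variable {U : Set (E n)} {f K H : E n × E n → ℝ} (hf : ChartFinsler U f) {y v w p : E n}
include hf

theorem fibHess_injective (hy : y ∈ U) (hv : v ≠ 0) :
    Function.Injective (fibHess (energy f) (y, v)) := by
  refine (injective_iff_map_eq_zero _).2 fun w hw => ?_
  by_contra h
  have := hf.fibHess_pos hy hv h
  rw [hw, inner_zero_left] at this
  exact lt_irrefl _ this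

/-- The Finsler curvature operator, acting on covectors. -/
theorem exists_dual_curvature (hy : y ∈ U) (hv : v ≠ 0) :
    ∃ R : E n →ₗ[ℝ] E n, (∀ w, R (fibHess (energy f) (y, v) w) =
      fibHess (energy f) (y, v) (sprayCurv (energy f) (y, v) w)) ∧
      LinearMap.trace ℝ (E n) R = (finslerCurvature (energy f) (y, v)).trace := by
  let g := LinearEquiv.ofInjectiveEndo (fibHess (energy f) (y, v)).toLinearMap
    (hf.fibHess_injective hy hv)
  refine ⟨g.conj (sprayCurv (energy f) (y, v)).toLinearMap, fun w => ?_, ?_⟩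
  · have h1 : g w = fibHess (energy f) (y, v) w := rfl
    rw [← h1, LinearEquiv.conj_apply_apply, LinearEquiv.symm_apply_apply]
    rfl
  · rw [LinearMap.trace_conj']
    exact trace_of_mulVec (sprayCurv_eq fun i => hf.smoothNear_spray hy hv i)

/-- The Cauchy-Schwarz inequality for the fibrewise Hessian. -/
theorem inner_fibGrad_sq_le (hy : y ∈ U) (hv : v ≠ 0) :
    inner ℝ (fibGrad (energy f) (y, v)) w ^ 2 ≤
      f (y, v) ^ 2 * inner ℝ (fibHess (energy f) (y, v) w) w := by
  set g := fibHess (energy f) (y, v)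
  set l := fibGrad (energy f) (y, v)
  have hL := hf.smoothNear_energy hy hv
  have hs := hf.pos hy hv
  set s := f (y, v)
  have h1 : g v = l := hf.fibHess_self hy hv
  have h2 : inner ℝ l v = s ^ 2 := hf.inner_fibGrad_self hy hv
  have h3 : inner ℝ (g w) v = inner ℝ l w := by rw [inner_fibHess_comm hL, h1]
  -- The tested vector is `s²` times the component of `w` that is `g`-orthogonal to `v`.
  have h4 : 0 ≤ inner ℝ (g (s ^ 2 • w - inner ℝ l w • v)) (s ^ 2 • w - inner ℝ l w • v) := by
    rcases eq_or_ne (s ^ 2 • w - inner ℝ l w • v) 0 with h | h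
    · rw [h, inner_zero_right]
    · exact (hf.fibHess_pos hy hv h).le
  rw [map_sub, map_smul, map_smul, h1] at h4
  simp only [inner_sub_left, inner_sub_right, real_inner_smul_left, real_inner_smul_right, h2,
    h3] at h4
  have h5 : 0 ≤ s ^ 2 * (s ^ 2 * inner ℝ (g w) w - inner ℝ l w ^ 2) := by linarith
  linarith [nonneg_of_mul_nonneg_right h5 (by positivity)]

/-- The curvature operators of the Hamiltonians `½ F*²` and `h(F*)`. -/
theorem exists_isCurvatureOperator (hK : IsChartHamiltonian U f K) {h : ℝ → ℝ}
    (hh : IsConvexDeformation h) (hH : ∀ y ∈ U, ∀ p : E n, H (y, p) = h (chartDual f (y, p)))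
    (hy : y ∈ U) (hv : v ≠ 0) :
    ∃ R : E n →ₗ[ℝ] E n, IsCurvatureOperator K (legendreMap (energy f) (y, v)) R ∧
      LinearMap.trace ℝ (E n) R = (finslerCurvature (energy f) (y, v)).trace ∧
      IsCurvatureOperator H (legendreMap (energy f) (y, v))
        ((deriv h (f (y, v)) / f (y, v)) ^ 2 • R) := by
  obtain ⟨R, hR, htr⟩ := hf.exists_dual_curvature hy hv
  obtain ⟨Γ, Γ', Γ'', hΓ, hΓ0, hΓ1, hΓ2, hΓv⟩ := hf.exists_jacobiFamily hK hy hv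
  have hX := hf.hamVec_legendreMap hK hy hv
  have hKs := hf.smoothNear_hamiltonian hK hy hv
  have hHs := hf.smoothNear_deformed hK hh hH hy hv
  have hq := (hf.eventually_chartDual hK hy hv).self_of_nhds
  have hc := hf.eventually_fderiv_speed hK hh hy hv
  have hs := hf.pos hy hv
  have hsq : √(2 * K (legendreMap (energy f) (y, v))) = f (y, v) := by
    rw [← hq.2.2.1, hf.chartDual_legendreMap hy hv]
  set q := legendreMap (energy f) (y, v)
  have hcq := hc.self_of_nhds
  have hT := hΓ.timeChange hKs hHs (hf.smoothNear_speed hK hh hy hv)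
    (hc.mono fun z hz => by
      have h1 := symp_hamVec K z (hamVec K z)
      rw [symp_self] at h1
      rw [hz, ← neg_eq_zero, ← mul_neg, ← h1, mul_zero])
    (hf.eventually_hamVec_deformed hK hh hH hy hv) hcq hΓv
  rw [hsq] at hcq
  refine ⟨R, hΓ.isCurvatureOperator hKs (fun w hw => ?_) fun w => ?_, htr,
    hT.isCurvatureOperator hHs (fun w hw => ?_) fun w => ?_⟩
  · simpa [symp_eq_inner, hΓ0, hΓ1, real_inner_comm] using hf.fibHess_pos hy hv hw
  · rw [hΓ2, neg_neg, hΓ0, hR]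
  · have hG := hf.fibHess_pos hy hv hw
    have hb : fderiv ℝ K q (Γ 0 w) = inner ℝ (fibGrad (energy f) (y, v)) w := by
      rw [← neg_neg (fderiv ℝ K q (Γ 0 w)), ← symp_hamVec, hX, hΓ0, symp_eq_inner,
        ← hf.fibHess_self hy hv, inner_fibHess_comm (hf.smoothNear_energy hy hv)]
      simp [real_inner_comm]
    have h1 : (inner ℝ (fibHess (energy f) (y, v) w) v : ℝ)
        = inner ℝ (fibGrad (energy f) (y, v)) w := by
      rw [inner_fibHess_comm (hf.smoothNear_energy hy hv), hf.fibHess_self hy hv]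
    have hCS := hf.inner_fibGrad_sq_le (w := w) hy hv
    simp only [hsq, mul_zero, zero_smul, sub_zero, symp_eq_inner, hΓ0, inner_zero_right, zero_sub,
      Prod.fst_sub, Prod.smul_fst, hΓ1, ContinuousLinearMap.smulRight_apply,
      ContinuousLinearMap.comp_apply, sub_apply, smul_apply]
    rw [← hΓ0, hcq, hb, hX]
    simp only [inner_sub_left, real_inner_smul_left, inner_neg_left, real_inner_comm _ w,
      real_inner_comm _ v, h1]
    set b := inner ℝ (fibGrad (energy f) (y, v)) w
    set G := inner ℝ (fibHess (energy f) (y, v) w) w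
    set s := f (y, v)
    have h2 := hh.deriv_pos hs
    have h3 := hh.deriv_deriv_pos s hs
    -- The Gram form of the deformed family is `c G + κ b²`, regrouped here into a Cauchy-Schwarz
    -- defect weighted by `h'` and a square weighted by `h''`. When `b = 0` the first term is
    -- positive, otherwise the second is.
    have h4 : 0 < deriv h s / s ^ 3 * (s ^ 2 * G - b ^ 2) + deriv (deriv h) s * b ^ 2 / s ^ 2 := by
      rcases eq_or_ne b 0 with hb0 | hb0
      · rw [hb0]
        have : 0 < deriv h s / s ^ 3 * (s ^ 2 * G) := by positivity
        simpa using this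
      · have h5 : 0 ≤ deriv h s / s ^ 3 * (s ^ 2 * G - b ^ 2) :=
          mul_nonneg (by positivity) (by linarith)
        have h6 : 0 < deriv (deriv h) s * b ^ 2 / s ^ 2 := by positivity
        linarith
    refine h4.trans_eq ?_
    field_simp
    ring
  -- At time `0` the correction vanishes, so the initial vectors are those of `Γ` while the second
  -- derivatives carry the factor `c²`.
  · simp only [hsq, mul_zero, smul_apply, hΓ2, LinearMap.smul_apply]
    refine Prod.ext ?_ ?_ <;> simp [smul_smul, pow_two, hΓ0, hR]

end ChartFinsler

end Curvature

/-! ### Geodesics and the projected flow of `h(F*)` -/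

section Geodesic

variable {n : ℕ}

namespace ChartFinsler

variable {U : Set (E n)} {f K H : E n × E n → ℝ} (hf : ChartFinsler U f) {y v w p : E n}
include hf

/-- The equation says that `d(L_v)` maps `(v, a)` to `L_x`. The spray is one solution, two solutions
differ by a fibre vector, and `g` is injective. -/
theorem eulerLagrange_iff (hy : y ∈ U) (hv : v ≠ 0) (a : E n) :
    (∀ i, dBase i (energy f) (y, v) - ∑ j, (dBase j (dFib i (energy f)) (y, v) * v j
      + dFib j (dFib i (energy f)) (y, v) * a j) = 0) ↔
      (v, a) = sprayVec (energy f) (y, v) := by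
  have hL := hf.smoothNear_energy hy hv
  have h1 : (∀ i, dBase i (energy f) (y, v) - ∑ j, (dBase j (dFib i (energy f)) (y, v) * v j
      + dFib j (dFib i (energy f)) (y, v) * a j) = 0) ↔
      fderiv ℝ (fibGrad (energy f)) (y, v) (v, a) = baseGrad (energy f) (y, v) := by
    rw [PiLp.ext_iff]
    refine forall_congr' fun i => ?_
    rw [sub_eq_zero, eq_comm, fderiv_fibGrad_apply hL, fderiv_eq_sum, Finset.sum_add_distrib]
    simp only [baseGrad, mul_comm]
  rw [h1, ← hf.fderiv_fibGrad_sprayVec hy hv, ← sub_eq_zero, ← map_sub]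
  have h2 : (v, a) - sprayVec (energy f) (y, v) = (0, a - (sprayVec (energy f) (y, v)).2) :=
    Prod.ext (sub_self v) rfl
  have h3 : fderiv ℝ (fibGrad (energy f)) (y, v) (0, a - (sprayVec (energy f) (y, v)).2) =
      fibHess (energy f) (y, v) (a - (sprayVec (energy f) (y, v)).2) := rfl
  rw [h2, h3, map_eq_zero_iff _ (hf.fibHess_injective hy hv), sub_eq_zero, Prod.ext_iff]
  exact ⟨fun h => ⟨rfl, h⟩, fun h => h.2⟩

/-- The geodesics are the projections of the integral curves of the spray. -/
theorem elCurve_eventuallyEq (hy : y ∈ U) (hv : v ≠ 0) {γ : ℝ → E n × E n} (h0 : γ 0 = (y, v))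
    (hγ : ∀ᶠ t in 𝓝 (0 : ℝ), HasDerivAt γ (sprayVec (energy f) (γ t)) t) :
    elCurve (energy f) (y, v) =ᶠ[𝓝 0] fun t => (γ t).1 := by
  have hX := hf.smoothNear_sprayVec hy hv
  rw [← h0] at hX
  have hd : ∀ᶠ t in 𝓝 (0 : ℝ), HasDerivAt (fun t => (γ t).1) (γ t).2 t :=
    hγ.mono fun t ht => ht.fst
  have hd' : ∀ᶠ t in 𝓝 (0 : ℝ), deriv (fun t => (γ t).1) t = (γ t).2 := hd.mono fun t ht => ht.deriv
  have hd'' : ∀ᶠ t in 𝓝 (0 : ℝ),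
      deriv (deriv fun t => (γ t).1) t = (sprayVec (energy f) (γ t)).2 := by
    filter_upwards [hd'.eventually_nhds, hγ] with t h1 h2
    rw [EventuallyEq.deriv_eq h1]
    exact HasDerivAt.deriv (f := fun t => (γ t).2) h2.snd
  have hslit : ∀ᶠ t in 𝓝 (0 : ℝ), (γ t).1 ∈ U ∧ (γ t).2 ≠ 0 := by
    have h1 := hγ.self_of_nhds.continuousAt
    rw [ContinuousAt, h0] at h1
    exact h1.eventually (eventually_mem_slit hf.isOpen hy hv)
  have hex : IsEulerLagrange (energy f) (y, v) (fun t => (γ t).1) := by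
    refine ⟨?_, congrArg Prod.fst h0, by rw [hd'.self_of_nhds, h0], ?_⟩
    · exact contDiffAt_infty.1 (smoothNear_integralCurve hX hγ).contDiffAt.fst 2
    · filter_upwards [hd', hd'', hslit] with t h1 h2 h3
      rw [h1, h2]
      exact (hf.eulerLagrange_iff h3.1 h3.2 _).2 rfl
  -- The chosen curve is only known to solve the equation; its lift is an integral curve of the
  -- spray, so uniqueness identifies it.
  obtain ⟨h1, h2, h3, h4⟩ : IsEulerLagrange (energy f) (y, v) (elCurve (energy f) (y, v)) :=
    Classical.epsilon_spec ⟨_, hex⟩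
  set η := elCurve (energy f) (y, v)
  have h5 : ∀ᶠ t in 𝓝 (0 : ℝ), HasDerivAt (fun s => (η s, deriv η s))
      (deriv η t, deriv (deriv η) t) t := by
    filter_upwards [h1.eventually (by simp)] with t ht
    have h6 : ContDiffAt ℝ 1 (deriv η) t := (ht.fderiv_right (by norm_num)).clm_apply contDiffAt_const
    exact (ht.differentiableAt (by simp)).hasDerivAt.prodMk
      (h6.differentiableAt (by simp)).hasDerivAt
  have h7 : ∀ᶠ t in 𝓝 (0 : ℝ), η t ∈ U ∧ deriv η t ≠ 0 := by
    have h8 := h5.self_of_nhds.continuousAt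
    rw [ContinuousAt, h2, h3] at h8
    exact h8.eventually (eventually_mem_slit hf.isOpen hy hv)
  have h9 := integralCurve_unique (γ := γ) (δ := fun s => (η s, deriv η s)) hX hγ
    (by
      filter_upwards [h4, h5, h7] with t h4 h5 h7
      rwa [(hf.eulerLagrange_iff h7.1 h7.2 _).1 h4] at h5)
    (by rw [h0, h2, h3])
  filter_upwards [h9] with t ht
  rw [ht]

/-- The speed of a geodesic is constant. -/
theorem eventually_speed_eq (hK : IsChartHamiltonian U f K) (hy : y ∈ U) (hv : v ≠ 0)
    {γ : ℝ → E n × E n} (h0 : γ 0 = (y, v))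
    (hγ : ∀ᶠ t in 𝓝 (0 : ℝ), HasDerivAt γ (sprayVec (energy f) (γ t)) t) :
    ∀ᶠ t in 𝓝 (0 : ℝ), (γ t).1 ∈ U ∧ (γ t).2 ≠ 0 ∧ f (γ t) = f (y, v) := by
  have hslit : ∀ᶠ t in 𝓝 (0 : ℝ), (γ t).1 ∈ U ∧ (γ t).2 ≠ 0 := by
    have h1 := hγ.self_of_nhds.continuousAt
    rw [ContinuousAt, h0] at h1
    exact h1.eventually (eventually_mem_slit hf.isOpen hy hv)
  -- Conservation of energy: `dK(X_K) = -symp X_K X_K = 0`, and `K` composed with the Legendre map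
  -- is `F² / 2`.
  have h1 := eventually_eq_of_hasDerivAt_zero (f := fun t => K (legendreMap (energy f) (γ t))) (by
    filter_upwards [hslit, hγ] with t h1 h2
    have h3 := (hf.smoothNear_hamiltonian hK h1.1 h1.2).differentiableAt.hasFDerivAt
    have h4 := (hf.smoothNear_energy h1.1 h1.2).legendreMap.differentiableAt.hasFDerivAt
    have h5 := h3.comp_hasDerivAt t (h4.comp_hasDerivAt t h2)
    refine h5.congr_deriv ?_
    have h6 := hf.fderiv_legendreMap_sprayVec h1.1 h1.2
    have h7 := hf.hamVec_legendreMap hK h1.1 h1.2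
    change fderiv ℝ K _ (fderiv ℝ (legendreMap (energy f)) ((γ t).1, (γ t).2)
      (sprayVec (energy f) ((γ t).1, (γ t).2))) = 0
    rw [h6, ← h7, ← neg_eq_zero, ← symp_hamVec, symp_self])
  filter_upwards [hslit, h1] with t h2 h3
  refine ⟨h2.1, h2.2, ?_⟩
  rw [h0, hf.hamiltonian_legendreMap hK hy hv] at h3
  have h4 : energy f (γ t) = energy f (y, v) :=
    (hf.hamiltonian_legendreMap hK h2.1 h2.2).symm.trans h3
  have h5 : f (γ t) ^ 2 = f (y, v) ^ 2 := by simpa [energy] using h4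
  exact (pow_left_inj₀ (hf.nonneg _ h2.1 _) (hf.nonneg y hy v) two_ne_zero).1 h5

/-- The projections of the flow lines of `h(F*)` are geodesics, up to a linear change of time. -/
theorem hamFlow_deformed (hK : IsChartHamiltonian U f K) {h : ℝ → ℝ} (hh : IsConvexDeformation h)
    (hH : ∀ y ∈ U, ∀ p : E n, H (y, p) = h (chartDual f (y, p))) (hy : y ∈ U) (hv : v ≠ 0) :
    ∃ γ : ℝ → E n × E n, γ 0 = (y, v) ∧
      (∀ᶠ t in 𝓝 (0 : ℝ), HasDerivAt γ (sprayVec (energy f) (γ t)) t) ∧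
      ∀ᶠ t in 𝓝 (0 : ℝ),
        (hamFlow H (legendreMap (energy f) (y, v)) t (legendreMap (energy f) (y, v))).1 =
          (γ (deriv h (f (y, v)) / f (y, v) * t)).1 := by
  obtain ⟨Ψ, hΨ⟩ := exists_isFlowNear (hf.smoothNear_sprayVec hy hv)
  obtain ⟨σ, hσ, hl, hr⟩ := hf.exists_legendre_inverse hy hv
  have hHs := hf.smoothNear_deformed hK hh hH hy hv
  refine ⟨fun t => Ψ t (y, v), hΨ.integralCurve.1, hΨ.integralCurve.2, ?_⟩
  have h1 := isFlowNear_timeChange (hf.smoothNear_hamiltonian hK hy hv)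
    (hf.smoothNear_speed hK hh hy hv)
    ((hf.eventually_fderiv_speed hK hh hy hv).mono fun z hz => by
      rw [hz, ← neg_eq_zero, ← mul_neg, ← symp_hamVec, symp_self, mul_zero])
    (hf.eventually_hamVec_deformed hK hh hH hy hv) (hf.isFlowNear_conj hK hy hv hΨ hσ hl hr)
  obtain ⟨ε, hε, h2⟩ := (isFlowNear_hamFlow hHs).unique hHs.hamVec h1
  have hq := (hf.eventually_chartDual hK hy hv).self_of_nhds
  have hsq : √(2 * K (legendreMap (energy f) (y, v))) = f (y, v) := by
    rw [← hq.2.2.1, hf.chartDual_legendreMap hy hv]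
  filter_upwards [Ioo_mem_nhds (neg_lt_zero.2 hε) hε] with t ht
  rw [h2.self_of_nhds t ht]
  simp only [hsq, hl.self_of_nhds]
  rfl

end ChartFinsler

end Geodesic

/-! ### The Lagrangian of `h(F*)` and its fibre Hessian -/

section Conjugate

variable {n : ℕ} {h : ℝ → ℝ} (hh : IsConvexDeformation h)
include hh

/-- The tangent line lies below `h`; convexity is available on `[0, ∞)` only, where `h'` is
increasing. -/
theorem IsConvexDeformation.tangent_le {r s : ℝ} (hs : 0 ≤ s) (hr : 0 ≤ r) :
    h s + deriv h s * (r - s) ≤ h r := by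
  have hd : ContDiff ℝ ∞ (deriv h) := (contDiff_infty_iff_deriv.1 hh.smooth).2
  have hc : ConvexOn ℝ (Ici 0) h := by
    refine MonotoneOn.convexOn_of_deriv (convex_Ici 0) hh.smooth.continuous.continuousOn
      (fun x _ => (hh.hasDerivAt x).differentiableAt.differentiableWithinAt) ?_
    exact ((strictMonoOn_of_deriv_pos (convex_Ici (0 : ℝ)) hd.continuous.continuousOn
      (fun x hx => hh.deriv_deriv_pos x (by simpa using hx))).monotoneOn).mono interior_subset
  rcases lt_trichotomy r s with hlt | rfl | hlt
  · have h1 := hc.slope_le_of_hasDerivAt (mem_Ici.2 hr) (mem_Ici.2 hs) hlt (hh.hasDerivAt s)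
    rw [slope_def_field, div_le_iff₀ (by linarith)] at h1
    linarith
  · simp
  · have h1 := hc.le_slope_of_hasDerivAt (mem_Ici.2 hs) (mem_Ici.2 hr) hlt (hh.hasDerivAt s)
    rw [slope_def_field, le_div_iff₀ (by linarith)] at h1
    linarith

/-- The local inverse of `h'`. -/
theorem IsConvexDeformation.exists_inverse {s : ℝ} (hs : 0 < s) :
    ∃ σ : ℝ → ℝ, σ (deriv h s) = s ∧ 0 < deriv σ (deriv h s) ∧
      ∀ᶠ t in 𝓝 (deriv h s), 0 < σ t ∧ deriv h (σ t) = t ∧ DifferentiableAt ℝ σ t := by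
  have hd : ContDiff ℝ ∞ (deriv h) := (contDiff_infty_iff_deriv.1 hh.smooth).2
  have h1 : ContDiffAt ℝ 1 (deriv h) s := hd.contDiffAt.of_le (by simp)
  have h2 := (hh.hasDerivAt_deriv s).hasFDerivAt_equiv (hh.deriv_deriv_pos s hs).ne'
  have hi : ContDiffAt ℝ 1 (h1.localInverse h2 (by simp)) (deriv h s) :=
    h1.to_localInverse h2 (by simp)
  have hv : h1.localInverse h2 (by simp) (deriv h s) = s := h1.localInverse_apply_image h2 (by simp)
  have hr : ∀ᶠ t in 𝓝 (deriv h s), deriv h (h1.localInverse h2 (by simp) t) = t :=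
    (h1.hasStrictFDerivAt' h2 (by simp)).eventually_right_inverse
  set σ := h1.localInverse h2 (by simp)
  have hc := hi.continuousAt
  rw [ContinuousAt, hv] at hc
  refine ⟨σ, hv, ?_, ?_⟩
  · have h3 : HasDerivAt (deriv h) (deriv (deriv h) s) (σ (deriv h s)) := by
      rw [hv]; exact hh.hasDerivAt_deriv s
    have h4 := (h3.comp (deriv h s) (hi.differentiableAt (by simp)).hasDerivAt).unique
      ((hasDerivAt_id _).congr_of_eventuallyEq hr)
    have h5 := hh.deriv_deriv_pos s hs
    exact pos_of_mul_pos_right (h4 ▸ one_pos) h5.le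
  · filter_upwards [hc.eventually (lt_mem_nhds hs), hr, hi.eventually (by simp)] with t h3 h4 h5
    exact ⟨h3, h4, h5.differentiableAt (by simp)⟩

namespace ChartFinsler

variable {U : Set (E n)} {f H L : E n × E n → ℝ} (hf : ChartFinsler U f)
  (hH : ∀ y ∈ U, ∀ p : E n, H (y, p) = h (chartDual f (y, p))) {y v : E n}
include hf hH

/-- Since `p · v ≤ F*(p) F(v)`, the supremum reduces to the scalar Legendre transform of `h` at
`F(v)`, whose maximizer is `r`. It is attained at the Legendre transform of `(r / F(v)) v`, a
covector of dual norm `r`. -/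
theorem iSup_deformed (hy : y ∈ U) (hv : v ≠ 0) {r : ℝ} (hr : 0 < r)
    (hrv : deriv h r = f (y, v)) :
    ⨆ p : E n, (inner ℝ p v - H (y, p)) = f (y, v) * r - h r := by
  have hfv := hf.pos hy hv
  have h1 : ∀ p : E n, inner ℝ p v - H (y, p) ≤ f (y, v) * r - h r := by
    intro p
    rw [hH y hy]
    rcases eq_or_ne p 0 with rfl | hp
    · have h2 : chartDual f (y, (0 : E n)) = 0 := by
        have h3 : (fun w : E n => inner ℝ (0 : E n) w) '' {w | f (y, w) ≤ 1} = {(0 : ℝ)} := by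
          simp only [inner_zero_left]
          exact Nonempty.image_const ⟨0, by simp [hf.apply_zero hy]⟩ 0
        rw [chartDual]
        exact (congrArg sSup h3).trans (csSup_singleton 0)
      have h4 := hh.tangent_le hr.le le_rfl
      rw [h2, inner_zero_left]
      rw [hrv] at h4
      linarith
    · obtain ⟨w, hw, rfl⟩ := hf.exists_fibGrad_eq hy hp
      have h2 : chartDual f (y, fibGrad (energy f) (y, w)) = f (y, w) :=
        hf.chartDual_legendreMap hy hw
      have h3 := hf.inner_fibGrad_le hy hw v
      have h4 := hh.tangent_le hr.le (hf.pos hy hw).le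
      rw [h2]
      rw [hrv] at h4
      linarith
  refine le_antisymm (ciSup_le h1) ?_
  have hc : 0 < r / f (y, v) := by positivity
  have hcv : (r / f (y, v)) • v ≠ 0 := smul_ne_zero hc.ne' hv
  have h2 : chartDual f (y, fibGrad (energy f) (y, (r / f (y, v)) • v)) =
      f (y, (r / f (y, v)) • v) := hf.chartDual_legendreMap hy hcv
  refine (le_of_eq ?_).trans (le_ciSup ⟨_, forall_mem_range.2 h1⟩
    (fibGrad (energy f) (y, (r / f (y, v)) • v)))
  rw [hH y hy, h2, hf.homogeneous y hy v _ hc, hf.fibGrad_smul hy hv hc, real_inner_smul_left,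
    hf.inner_fibGrad_self hy hv]
  field_simp

/-- The fibrewise Hessian of the Lagrangian of `h(F*)`, up to a factor that depends on the norm
only, has the determinant of `g`. -/
theorem exists_det_fibHessian (hL : ∀ y ∈ U, ∀ v : E n, L (y, v) =
      ⨆ p : E n, (inner ℝ p v - H (y, p))) {s : ℝ} (hs : 0 < s) :
    ∃ C > 0, ∀ y ∈ U, ∀ v : E n, v ≠ 0 → f (y, v) = deriv h s →
      (fibHessian L (y, v)).det = C * (fibHessian (energy f) (y, v)).det := by
  obtain ⟨σ, hσ, hσ', hev⟩ := hh.exists_inverse hs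
  set t := deriv h s
  have ht : 0 < t := hh.deriv_pos hs
  set a := deriv (fun r => σ r / r) t / t
  have hσt : HasDerivAt (fun r => σ r / r) ((deriv σ t * t - σ t * 1) / t ^ 2) t :=
    (hev.self_of_nhds.2.2.hasDerivAt).div (hasDerivAt_id t) ht.ne'
  have ha : a = (deriv σ t * t - s) / t ^ 2 / t := by
    simp only [a, hσt.deriv, hσ, mul_one]
  -- With `σ` the local inverse of `h'`, the Lagrangian is a function of `F` with derivative `σ(F)`,
  -- and its Hessian at norm `t` is `(s / t) g + a ℓ ⊗ ℓ`, where `ℓ = g v`. Factoring out `g` leaves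
  -- a rank-one perturbation of the identity with determinant `1 + a t³ / s = σ'(t) t / s`.
  refine ⟨(s / t) ^ n * (deriv σ t * t / s), by positivity, fun y hy v hv hfv => ?_⟩
  have hE := hf.smoothNear_energy hy hv
  -- The terms containing `σ'` cancel because `h'(σ r) = r`.
  have hk : ∀ᶠ r in 𝓝 t, HasDerivAt (fun r => r * σ r - h (σ r)) (σ r) r := by
    filter_upwards [hev] with r hr
    have h1 := hr.2.2.hasDerivAt
    refine (((hasDerivAt_id r).mul h1).sub ((hh.hasDerivAt (σ r)).comp r h1)).congr_deriv ?_
    rw [hr.2.1]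
    simp
  have hft : Tendsto f (𝓝 (y, v)) (𝓝 t) := by
    rw [← hfv]
    exact (hf.smoothNear hy hv).continuousAt
  have hLf : ∀ᶠ z in 𝓝 (y, v), L z = f z * σ (f z) - h (σ (f z)) := by
    filter_upwards [eventually_mem_slit hf.isOpen hy hv, hft.eventually hev] with z hz h1
    exact (hL z.1 hz.1 z.2).trans (hf.iSup_deformed hh hH hz.1 hz.2 h1.1 h1.2.1)
  have hdL : ∀ j, ∀ᶠ z in 𝓝 (y, v), dFib j L z = σ (f z) / f z * dFib j (energy f) z := by
    intro j
    filter_upwards [hLf.eventually_nhds, eventually_mem_slit hf.isOpen hy hv,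
      hft.eventually hk, hf.smoothNear hy hv] with z h1 h2 h3 h4
    have h5 := (h4.differentiableAt (by simp)).hasFDerivAt
    have h6 : HasFDerivAt (fun z => f z * σ (f z) - h (σ (f z))) (σ (f z) • fderiv ℝ f z) z :=
      h3.comp_hasFDerivAt z h5
    have h7 : HasFDerivAt (energy f) (f z • fderiv ℝ f z) z := by
      have h8 := (hasDerivAt_pow 2 (f z)).div_const 2
      refine (h8.comp_hasFDerivAt z h5).congr_fderiv ?_
      simp
    have h9 : 0 < f z := hf.pos h2.1 h2.2
    rw [dFib, dFib, EventuallyEq.fderiv_eq h1, h6.fderiv, h7.fderiv]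
    simp only [smul_apply, smul_eq_mul]
    field_simp
  set ℓ : Fin n → ℝ := fun i => dFib i (energy f) (y, v)
  set g := fibHessian (energy f) (y, v)
  have hgv : ∀ i, ∑ j, g i j * v j = ℓ i := by
    intro i
    have h1 := congrArg (fun w : E n => w i) (hf.fibHess_self hy hv)
    simp only [fibHess_apply hE] at h1
    refine Eq.trans (Finset.sum_congr rfl fun j _ => ?_) h1
    rw [mul_comm, show g i j = g j i from fibHessian_symm hE i j]
  have hℓv : ∑ i, ℓ i * v i = t ^ 2 := by
    have h1 := hf.inner_fibGrad_self hy hv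
    rw [hfv, PiLp.inner_apply] at h1
    rw [← h1]
    exact Finset.sum_congr rfl fun i _ => mul_comm _ _
  have hH' : fibHessian L (y, v) = (s / t) • (g * (1 + Matrix.replicateCol Unit v.ofLp *
      Matrix.replicateRow Unit ((a * t / s) • ℓ))) := by
    ext i j
    have h1 : HasFDerivAt f (fderiv ℝ f (y, v)) (y, v) :=
      (hf.smoothNear hy hv).differentiableAt.hasFDerivAt
    have hσt' : HasDerivAt (fun r => σ r / r) (a * t) (f (y, v)) := by
      rw [hfv]
      exact hσt.congr_deriv (by rw [ha, hσ]; field_simp)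
    have h2 := (hσt'.comp_hasFDerivAt (y, v) h1).mul (hE.dFib j).differentiableAt.hasFDerivAt
    have h3 : HasFDerivAt (energy f) (f (y, v) • fderiv ℝ f (y, v)) (y, v) := by
      have h8 := (hasDerivAt_pow 2 (f (y, v))).div_const 2
      refine (h8.comp_hasFDerivAt (y, v) h1).congr_fderiv ?_
      simp
    have h4 : ℓ i = t * fderiv ℝ f (y, v) (0, EuclideanSpace.single i 1) := by
      simp only [ℓ, dFib, h3.fderiv, hfv]
      rfl
    have h5 : fibHessian L (y, v) i j = s / t * g i j + ℓ j * (a * ℓ i) := by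
      rw [fibHessian, Matrix.of_apply, dFib, EventuallyEq.fderiv_eq (hdL j)]
      refine (congrArg (fun A => A (0, EuclideanSpace.single i 1)) h2.fderiv).trans ?_
      simp only [add_apply, smul_apply, smul_eq_mul, Function.comp_apply, hfv, hσ]
      rw [h4, ← mul_assoc a]
      rfl
    rw [h5, mul_add, mul_one, ← Matrix.mul_assoc, Matrix.smul_apply, Matrix.add_apply,
      Matrix.mul_apply]
    simp only [Finset.univ_unique, Finset.sum_singleton, Matrix.mul_apply,
      Matrix.replicateCol_apply, Matrix.replicateRow_apply, hgv, Pi.smul_apply, smul_eq_mul]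
    field_simp
  rw [hH', Matrix.det_smul, Matrix.det_mul, Matrix.det_one_add_replicateCol_mul_replicateRow,
    smul_dotProduct, dotProduct, hℓv, Fintype.card_fin, smul_eq_mul, ha]
  field_simp
  ring

end ChartFinsler

end Conjugate

/-! ### Scaling of the weighted Ricci curvature -/

section Weight

variable {n : ℕ}

/-- The first derivative of the weight scales by `c`, the second by `c²`. Positivity of `c` makes
both first derivatives vanish together and keeps the value `⊥` at `⊥`. -/
theorem weightedRicci_comp_mul {ψ φ : ℝ → ℝ} {A c : ℝ} (hc : 0 < c) (ric : ℝ) (N : ℝ≥0∞)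
    (h : ψ =ᶠ[𝓝 0] fun t => A + φ (c * t)) :
    weightedRicci n (c ^ 2 * ric) ψ N = ((c ^ 2 : ℝ) : EReal) * weightedRicci n ric φ N := by
  have h1 : deriv ψ =ᶠ[𝓝 0] fun t => c * deriv φ (c * t) := by
    refine h.deriv.trans (Eventually.of_forall fun t => ?_)
    change deriv (fun t => A + φ (c * t)) t = c * deriv φ (c * t)
    rw [deriv_const_add, deriv_comp_mul_left, smul_eq_mul]
  have h2 : deriv ψ 0 = c * deriv φ 0 := by simpa using h1.self_of_nhds
  have h3 : deriv (deriv ψ) 0 = c ^ 2 * deriv (deriv φ) 0 := by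
    rw [h1.deriv_eq, deriv_const_mul_field, deriv_comp_mul_left, mul_zero, smul_eq_mul]
    ring
  rw [weightedRicci, weightedRicci, h2, h3]
  split_ifs with h4 h5 h6 h7 h7
  · rw [← EReal.coe_mul, mul_add]
  · rw [← EReal.coe_mul, mul_add]
  · exact absurd ((mul_eq_zero.1 h6).resolve_left hc.ne') h7
  · exact absurd (by rw [h7, mul_zero]) h6
  · rw [EReal.coe_mul_bot_of_pos (by positivity)]
  · rw [← EReal.coe_mul]
    congr 1
    ring

namespace ChartFinsler

variable {U : Set (E n)} {f K H L : E n × E n → ℝ} (hf : ChartFinsler U f) {y v : E n}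
include hf

/-- The projected flow line has velocity `c γ̇`, of constant norm `h'(F(v))`, so one determinant
factor `C` serves for all times; `g` does not see the scaling by `c`. The additive constant is `log
√C`. -/
theorem weightAlong_deformed (hK : IsChartHamiltonian U f K) {h : ℝ → ℝ}
    (hh : IsConvexDeformation h) (hH : ∀ y ∈ U, ∀ p : E n, H (y, p) = h (chartDual f (y, p)))
    (hL : ∀ y ∈ U, ∀ v : E n, L (y, v) = ⨆ p : E n, (inner ℝ p v - H (y, p))) {ρ : E n → ℝ}
    (hρ : ∀ y ∈ U, 0 < ρ y) (hy : y ∈ U) (hv : v ≠ 0) {η : ℝ → E n}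
    (hη : η =ᶠ[𝓝 0] fun t =>
      (hamFlow H (legendreMap (energy f) (y, v)) t (legendreMap (energy f) (y, v))).1) :
    ∃ A, weightAlong L ρ η =ᶠ[𝓝 0] fun t =>
      A + weightAlong (energy f) ρ (elCurve (energy f) (y, v))
        (deriv h (f (y, v)) / f (y, v) * t) := by
  obtain ⟨γ, h0, hγ, hflow⟩ := hf.hamFlow_deformed hK hh hH hy hv
  have hs := hf.pos hy hv
  have hspeed := hf.eventually_speed_eq hK hy hv h0 hγ
  have hel := hf.elCurve_eventuallyEq hy hv h0 hγ
  obtain ⟨C, hC, hdet⟩ := hf.exists_det_fibHessian hh hH hL hs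
  have hc : 0 < deriv h (f (y, v)) / f (y, v) := div_pos (hh.deriv_pos hs) hs
  have hcs : deriv h (f (y, v)) / f (y, v) * f (y, v) = deriv h (f (y, v)) :=
    div_mul_cancel₀ _ hs.ne'
  set c := deriv h (f (y, v)) / f (y, v)
  have hd : ∀ᶠ t in 𝓝 (0 : ℝ), deriv (elCurve (energy f) (y, v)) t = (γ t).2 := by
    filter_upwards [hel.eventually_nhds, hγ] with t h1 h2
    rw [EventuallyEq.deriv_eq h1]
    exact HasDerivAt.deriv (f := fun t => (γ t).1) h2.fst
  have hη' : η =ᶠ[𝓝 0] fun t => (γ (c * t)).1 := hη.trans hflow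
  have hdη : ∀ᶠ t in 𝓝 (0 : ℝ), deriv η t = c • (γ (c * t)).2 := by
    filter_upwards [hη'.eventually_nhds, eventually_mul_zero hγ c] with t h1 h2
    rw [EventuallyEq.deriv_eq h1]
    exact HasDerivAt.deriv (hasDerivAt_comp_const_mul (γ := fun t => (γ t).1) h2.fst)
  refine ⟨Real.log √C, ?_⟩
  filter_upwards [hη', hdη, eventually_mul_zero hel c, eventually_mul_zero hd c,
    eventually_mul_zero hspeed c] with t h1 h2 h3 h4 h5
  obtain ⟨h5, h6, h7⟩ := h5
  have h8 := hdet _ h5 (c • (γ (c * t)).2) (smul_ne_zero hc.ne' h6)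
    (by rw [hf.homogeneous _ h5 _ c hc, ← hcs]; exact congrArg (c * ·) h7)
  rw [homogOn_fibHessian hf.isOpen hf.homogOn_energy h5 h6 hc] at h8
  have h9 := (hf.posDef _ h5 _ h6).det_pos
  have h10 := hρ _ h5
  rw [weightAlong, weightAlong, h1, h2, h3, h4, h8, Real.sqrt_mul hC.le, mul_div_assoc,
    Real.log_mul (Real.sqrt_pos.2 hC).ne' (div_pos (Real.sqrt_pos.2 h9) h10).ne']

end ChartFinsler

end Weight

/-! ### Reading the manifold objects in a chart -/

section Chart

variable {n : ℕ} {M : Type*} [TopologicalSpace M] [ChartedSpace (E n) M]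

/-- The derivative of the inverse of a chart. -/
noncomputable def chartFrame (e : OpenPartialHomeomorph M (E n)) (y : E n) :
    E n →L[ℝ] TangentSpace (𝓡 n) (e.symm y) :=
  mfderiv (𝓡 n) (𝓡 n) e.symm y

/-- The derivative of a chart. -/
noncomputable def chartCoframe (e : OpenPartialHomeomorph M (E n)) (y : E n) :
    TangentSpace (𝓡 n) (e.symm y) →L[ℝ] E n :=
  mfderiv (𝓡 n) (𝓡 n) e (e.symm y)

theorem contMDiff_tangent_mk : ContMDiff 𝓘(ℝ, E n × E n) (𝓡 n).tangent ∞
    (fun z : E n × E n => (⟨z.1, z.2⟩ : TangentBundle (𝓡 n) (E n))) := by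
  intro z
  refine Bundle.contMDiffAt_totalSpace.2 ⟨contDiff_fst.contMDiff.contMDiffAt, ?_⟩
  convert! (contDiff_snd (𝕜 := ℝ) (E := E n) (F := E n)).contMDiff.contMDiffAt using 1
  ext w
  simp

theorem mdifferentiable_of_mem_maximalAtlas {e : OpenPartialHomeomorph M (E n)}
    (he : e ∈ IsManifold.maximalAtlas (𝓡 n) ∞ M) : e.MDifferentiable (𝓡 n) (𝓡 n) :=
  ⟨(contMDiffOn_of_mem_maximalAtlas he).mdifferentiableOn (by simp),
    (contMDiffOn_symm_of_mem_maximalAtlas he).mdifferentiableOn (by simp)⟩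

variable {e : OpenPartialHomeomorph M (E n)}
  (he : e ∈ IsManifold.maximalAtlas (𝓡 n) ∞ M) {y : E n} (hy : y ∈ e.target)
include he hy

theorem chartCoframe_chartFrame (v : E n) : chartCoframe e y (chartFrame e y v) = v :=
  congrArg (fun A : E n →L[ℝ] E n => A v)
    ((mdifferentiable_of_mem_maximalAtlas he).comp_symm_deriv hy)

theorem chartFrame_surjective : Function.Surjective (chartFrame e y) :=
  ((mdifferentiable_of_mem_maximalAtlas he).symm.mfderiv_bijective hy).2

theorem chartFrame_chartCoframe (w : TangentSpace (𝓡 n) (e.symm y)) :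
    chartFrame e y (chartCoframe e y w) = w := by
  obtain ⟨v, rfl⟩ := chartFrame_surjective he hy w
  rw [chartCoframe_chartFrame he hy]

theorem chartFrame_ne_zero {v : E n} (hv : v ≠ 0) : chartFrame e y v ≠ 0 := fun h => by
  have := chartCoframe_chartFrame he hy v
  rw [h, map_zero] at this
  exact hv this.symm

theorem vecCoord_chartFrame (v : E n) : vecCoord e (e.symm y) (chartFrame e y v) = (y, v) :=
  Prod.ext (e.right_inv hy) (chartCoframe_chartFrame he hy v)

omit he hy in
theorem covecCoord_symm (hy : y ∈ e.target) (α : Cotangent (n := n) (e.symm y)) :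
    covecCoord e (e.symm y) α =
      (y, WithLp.toLp 2 fun i => α (chartFrame e y (EuclideanSpace.single i 1))) :=
  congrArg (fun z => ((z, WithLp.toLp 2 fun i =>
    α.comp (mfderiv (𝓡 n) (𝓡 n) e.symm z : E n →L[ℝ] E n) (EuclideanSpace.single i 1)) :
      E n × E n)) (e.right_inv hy)

omit he hy in
theorem inner_covecCoord (α : Cotangent (n := n) (e.symm y)) (w : E n) :
    inner ℝ (WithLp.toLp 2 fun i => α (chartFrame e y (EuclideanSpace.single i 1)) : E n) w =
      α (chartFrame e y w) := by
  have h1 : w = ∑ i, w i • EuclideanSpace.single i (1 : ℝ) := by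
    ext j
    simp [Pi.single_apply]
  conv_rhs => rw [h1, map_sum, map_sum]
  simp [PiLp.inner_apply, map_smul]

theorem eq_comp_chartCoframe (α : Cotangent (n := n) (e.symm y)) :
    α = (innerSL ℝ (WithLp.toLp 2 fun i => α (chartFrame e y (EuclideanSpace.single i 1)) :
      E n)).comp (chartCoframe e y) := by
  ext w
  rw [ContinuousLinearMap.comp_apply, innerSL_apply_apply, inner_covecCoord,
    chartFrame_chartCoframe he hy]

theorem iSup_chartCoframe {L : TangentSpace (𝓡 n) (e.symm y) → ℝ} (p : E n) :
    ⨆ w, ((innerSL ℝ p).comp (chartCoframe e y) w - L w) =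
      ⨆ v : E n, (inner ℝ p v - L (chartFrame e y v)) :=
  ((chartFrame_surjective he hy).iSup_congr _ fun v => by
    rw [ContinuousLinearMap.comp_apply, innerSL_apply_apply, chartCoframe_chartFrame he hy]).symm

theorem onTangent_lagrangianOf (H : ∀ x : M, Cotangent (n := n) x → ℝ) (v : E n) :
    onTangent e (lagrangianOf H) (y, v) = ⨆ p : E n, (inner ℝ p v - onCotangent e H (y, p)) := by
  have h1 : Function.Surjective
      fun p : E n => ((innerSL ℝ p).comp (chartCoframe e y) : Cotangent (n := n) (e.symm y)) :=
    fun α => ⟨_, (eq_comp_chartCoframe he hy α).symm⟩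
  refine (h1.iSup_congr _ fun p => ?_).symm
  change ((innerSL ℝ p).comp (chartCoframe e y)) (chartFrame e y v) - _ = _
  rw [ContinuousLinearMap.comp_apply, innerSL_apply_apply, chartCoframe_chartFrame he hy]
  rfl

theorem dualNorm_chartCoframe (F : ∀ x : M, TangentSpace (𝓡 n) x → ℝ) (p : E n) :
    dualNorm F (e.symm y) ((innerSL ℝ p).comp (chartCoframe e y)) =
      chartDual (onTangent e F) (y, p) := by
  rw [dualNorm, chartDual]
  congr 1
  ext r
  constructor
  · rintro ⟨w, hw, rfl⟩
    obtain ⟨v, rfl⟩ := chartFrame_surjective he hy w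
    exact ⟨v, hw, by
      simp only [ContinuousLinearMap.comp_apply, innerSL_apply_apply,
        chartCoframe_chartFrame he hy]⟩
  · rintro ⟨v, hv, rfl⟩
    exact ⟨chartFrame e y v, hv, by
      simp only [ContinuousLinearMap.comp_apply, innerSL_apply_apply,
        chartCoframe_chartFrame he hy]⟩

omit hy

theorem isChartHamiltonian (F : ∀ x : M, TangentSpace (𝓡 n) x → ℝ) :
    IsChartHamiltonian e.target (onTangent e F) (onCotangent e (finslerHamiltonian F)) :=
  fun _ hy p => iSup_chartCoframe he hy p

/-- Transports the smoothness of `F` on the slit tangent bundle to its coordinate expression; the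
map is the tangent map of the inverse chart. -/
theorem contMDiffOn_chart_tangent [IsManifold (𝓡 n) ∞ M] : ContMDiffOn 𝓘(ℝ, E n × E n) (𝓡 n).tangent ∞
    (fun z : E n × E n => (⟨e.symm z.1, chartFrame e z.1 z.2⟩ : TangentBundle (𝓡 n) M))
    {z | z.1 ∈ e.target} := by
  have h1 : ContMDiffOn (𝓡 n).tangent (𝓡 n).tangent ∞
      (tangentMapWithin (𝓡 n) (𝓡 n) e.symm e.target) _ :=
    (contMDiffOn_symm_of_mem_maximalAtlas he).contMDiffOn_tangentMapWithin (by simp)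
      e.open_target.uniqueMDiffOn
  have h2 := h1.comp ((contMDiff_tangent_mk (n := n)).contMDiffOn
      (s := {z : E n × E n | z.1 ∈ e.target}))
    fun z hz => hz
  refine h2.congr fun z hz => ?_
  simp only [Function.comp_apply, tangentMapWithin, chartFrame]
  rw [mfderivWithin_of_isOpen e.open_target hz]
  rfl

theorem IsFinslerStructure.chartFinsler [IsManifold (𝓡 n) ∞ M] {F : ∀ x : M, TangentSpace (𝓡 n) x → ℝ}
    (hF : IsFinslerStructure F) : ChartFinsler e.target (onTangent e F) where
  isOpen := e.open_target
  nonneg y _ v := hF.nonneg _ _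
  smooth y hy v hv := by
    have hs : {z : E n × E n | z.1 ∈ e.target ∧ z.2 ≠ 0} ⊆ {z | z.1 ∈ e.target} := fun z hz => hz.1
    have h1 := hF.smooth.comp ((contMDiffOn_chart_tangent he).mono hs)
      fun z hz => chartFrame_ne_zero he hz.1 hz.2
    exact (contMDiffOn_iff_contDiffOn.1 h1).contDiffAt (eventually_mem_slit e.open_target hy hv)
  homogeneous y hy v c hc := by
    rw [onTangent, onTangent]
    refine Eq.trans (congrArg _ (map_smul (chartFrame e y) c v)) ?_
    exact hF.homogeneous _ _ c hc
  posDef y hy v hv := hF.strongly_convex e he y hy v hv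

end Chart

/-! ### Covectors as Legendre transforms on the manifold -/

section Chart

variable {n : ℕ} {M : Type*} [TopologicalSpace M] [ChartedSpace (E n) M]
  [IsManifold (𝓡 n) ∞ M] {e : OpenPartialHomeomorph M (E n)}
  (he : e ∈ IsManifold.maximalAtlas (𝓡 n) ∞ M) {y : E n} (hy : y ∈ e.target)
  {F : ∀ x : M, TangentSpace (𝓡 n) x → ℝ} (hF : IsFinslerStructure F)
include he hy hF

/-- In a chart, a nonzero covector is the Legendre transform of a nonzero vector. -/
theorem IsFinslerStructure.exists_covecCoord_eq {α : Cotangent (n := n) (e.symm y)} (hα : α ≠ 0) :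
    ∃ v : E n, v ≠ 0 ∧
      covecCoord e (e.symm y) α = legendreMap (energy (onTangent e F)) (y, v) ∧
      dualNorm F (e.symm y) α = onTangent e F (y, v) ∧
      legendre e (finslerHamiltonian F) (e.symm y) α = chartFrame e y v := by
  have hf := hF.chartFinsler he
  have hα' := eq_comp_chartCoframe he hy α
  have hcov := covecCoord_symm hy α
  set p : E n := WithLp.toLp 2 fun i => α (chartFrame e y (EuclideanSpace.single i 1))
  have hp : p ≠ 0 := fun h => hα (by rw [hα', h, map_zero, ContinuousLinearMap.zero_comp])
  obtain ⟨v, hv, hvp⟩ := hf.exists_fibGrad_eq hy hp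
  have hleg : legendreMap (energy (onTangent e F)) (y, v) = (y, p) := Prod.ext rfl hvp
  refine ⟨v, hv, hcov.trans hleg.symm, ?_, ?_⟩
  · rw [hα', dualNorm_chartCoframe he hy, ← hleg, hf.chartDual_legendreMap hy hv]
  · have h1 := congrArg Prod.fst (hf.hamVec_legendreMap (isChartHamiltonian he F) hy hv)
    rw [hleg, ← hcov] at h1
    change mfderiv (𝓡 n) (𝓡 n) e.symm (e (e.symm y))
      (hamVec (onCotangent e (finslerHamiltonian F)) (covecCoord e (e.symm y) α)).1 = _
    rw [h1]
    exact congrArg (fun z => (mfderiv (𝓡 n) (𝓡 n) e.symm z : E n →L[ℝ] E n) v) (e.right_inv hy)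

end Chart

end FinslerHamiltonian

/-! ### The main theorem -/

theorem mainTheorem6 {n : ℕ} {M : Type*} [TopologicalSpace M] [ChartedSpace (E n) M]
    [IsManifold (𝓡 n) ∞ M] [MeasurableSpace M] [BorelSpace M]
    (F : ∀ x : M, TangentSpace (𝓡 n) x → ℝ) (hF : IsFinslerStructure F)
    (h : ℝ → ℝ) (hh : IsConvexDeformation h)
    (m : Measure M) (hm : IsPositiveSmoothMeasure n m)
    (H : ∀ x : M, Cotangent (n := n) x → ℝ) (hH : ∀ x α, H x α = h (dualNorm F x α))
    (c : ∀ x : M, Cotangent (n := n) x → ℝ)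
    (hc : ∀ x α, c x α = deriv h (dualNorm F x α) / dualNorm F x α)
    (e : OpenPartialHomeomorph M (E n)) (he : e ∈ IsManifold.maximalAtlas (𝓡 n) ∞ M)
    (x : M) (hx : x ∈ e.source) (α : Cotangent (n := n) x) (hα : α ≠ 0) :
    (∃! R, IsCurvatureOperator (onCotangent e H) (covecCoord e x α) R) ∧
    (∃! R, IsCurvatureOperator (onCotangent e (finslerHamiltonian F)) (covecCoord e x α) R) ∧
    curvatureOperator e H x α
      = c x α ^ 2 • curvatureOperator e (finslerHamiltonian F) x α ∧
    hamRicci e H x α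
      = c x α ^ 2 * finslerRicci e F x (legendre e (finslerHamiltonian F) x α) ∧
    ∀ N : ℝ≥0∞, (n : ℝ≥0∞) ≤ N →
      hamWeightedRicci m e H N x α
        = ((c x α ^ 2 : ℝ) : EReal) *
          finslerWeightedRicci m e F N x (legendre e (finslerHamiltonian F) x α) := by
  -- With the base point written as `e.symm y`, its tangent and cotangent spaces are literally those
  -- of the chart lemmas.
  obtain ⟨y, hy, rfl⟩ : ∃ y ∈ e.target, e.symm y = x := ⟨e x, e.map_source hx, e.left_inv hx⟩
  obtain ⟨v, hv, hcov, hnorm, hleg⟩ := hF.exists_covecCoord_eq he hy hα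
  have hf := hF.chartFinsler he
  have hK := isChartHamiltonian he F
  have hHc : ∀ y ∈ e.target, ∀ p : E n,
      onCotangent e H (y, p) = h (chartDual (onTangent e F) (y, p)) := fun y hy p => by
    rw [← dualNorm_chartCoframe he hy, ← hH]
    rfl
  have hcα : c (e.symm y) α = deriv h (onTangent e F (y, v)) / onTangent e F (y, v) := by
    rw [hc, hnorm]
  have hpos : 0 < c (e.symm y) α := by
    rw [hcα]
    exact div_pos (hh.deriv_pos (hf.pos hy hv)) (hf.pos hy hv)
  have hKs := hf.smoothNear_hamiltonian hK hy hv
  have hHs := hf.smoothNear_deformed hK hh hHc hy hv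
  obtain ⟨R, hRK, htr, hRH⟩ := hf.exists_isCurvatureOperator hK hh hHc hy hv
  rw [← hcov] at hKs hHs hRK hRH
  rw [← hcα] at hRH
  -- The operator is defined by choice: existence shows that the choice satisfies its specification,
  -- and uniqueness computes it.
  have hR₁ : curvatureOperator e (finslerHamiltonian F) (e.symm y) α = R :=
    (Classical.epsilon_spec ⟨R, hRK⟩ : IsCurvatureOperator _ _ _).unique hKs hRK
  have hR₂ : curvatureOperator e H (e.symm y) α = c (e.symm y) α ^ 2 • R :=
    (Classical.epsilon_spec ⟨_, hRH⟩ : IsCurvatureOperator _ _ _).unique hHs hRH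
  have hric : hamRicci e H (e.symm y) α = c (e.symm y) α ^ 2 *
      finslerRicci e F (e.symm y) (legendre e (finslerHamiltonian F) (e.symm y) α) := by
    rw [hamRicci, if_neg hα, hR₂, map_smul, htr, smul_eq_mul, finslerRicci, hleg,
      if_neg (chartFrame_ne_zero he hy hv), vecCoord_chartFrame he hy]
    rfl
  refine ⟨⟨_, hRH, fun R' h' => h'.unique hHs hRH⟩, ⟨_, hRK, fun R' h' => h'.unique hKs hRK⟩,
    by rw [hR₁, hR₂], hric, fun N _ => ?_⟩
  -- Both weights use the same chosen density, and only its positivity enters: it allows the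
  -- logarithm of the product with `√C` to be split.
  have hρ : IsChartDensity m e (chartDensity m e) := Classical.epsilon_spec (hm e he)
  obtain ⟨A, hA⟩ := hf.weightAlong_deformed hK hh hHc
    (fun y hy v => onTangent_lagrangianOf he hy H v) hρ.2.1 hy hv
    (η := hamCurve e H (e.symm y) α) (Eventually.of_forall fun t => by rw [hamCurve, hcov])
  rw [← hcα] at hA
  rw [hamWeightedRicci, if_neg hα, hric, finslerWeightedRicci, hleg,
    if_neg (chartFrame_ne_zero he hy hv), vecCoord_chartFrame he hy]
  exact weightedRicci_comp_mul hpos _ N hA
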